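/- Let $(\Omega,\mathcal F,\mu)$ be a $\sigma$-finite measure space and let $\mathcal A$ be its measure algebra, i.e. the complete Boolean algebra of measurable sets modulo null sets, with smallest element $0$ and largest element $1$. A partition of $c\in\mathcal A$ is a family $(a_i)$ of pairwise disjoint elements with $\sup_i a_i=c$. **Conditional sets.** A conditional set $\mathbf X$ is a family of nonempty sets $X_a$, $a\in\mathcal A$, with surjections $\gamma_a:X_1\to X_a$ such that $X_0$ is a singleton, $\gamma_1=\mathrm{id}$, $\gamma_b(x)=\gamma_b(y)$ implies $\gamma_a(x)=\gamma_a(y)$ for $a\le b$, and for every partition $(a_i)$ of $1$ and all $x_i\in X_{a_i}$ there is exactly one $x\in X_1$ with $\gamma_{a_i}(x)=x_i$ for all $i$ (the gluing of the $x_i$). For $a\le b$ let $x\mapsto ax$ denote the induced restriction map $X_b\to X_a$. A conditional function $f:\mathbf X\to\mathbf Y$ is a family of maps $f_a:X_a\to Y_a$ commuting with all restrictions; it is a conditional bijection if every $f_a$ is injective and $f_1$ is surjective. A conditional subset $\mathbf Y$ of $\mathbf X$ living on $b\in\mathcal A$ is a family of nonempty sets $Y_a\subseteq X_a$, $a\le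 b$, such that $Y_a=\{ax:x\in Y_b\}$ and $Y_b$ is closed under gluing along partitions of $b$. The conditional subsets of $\mathbf X$, with the restriction of a conditional subset living on $b$ to $a\le b$, form the conditional power set $P(\mathbf X)$. Given a relation $\le$ on each $X_a$ that is compatible with restriction and gluing, write $x<y$ in $X_a$ if $x\le y$ and $bx\ne by$ for all $0\ne b\le a$. **Conditional real numbers.** For a nonempty set $E$, let $\mathbf E$ be the conditional set generated by $E$: the elements of $E_a$ are the functions $g:E\to\mathcal A$ with pairwise disjoint values and $\sup_{z\in E}g(z)=a$ ("the element takes the value $z$ on $g(z)$"), with restriction $(bg)(z)=b\wedge g(z)$. Operations and reflexive relations of $E$ extend to $\mathbf E$ piecewise. This gives $\mathbf N$ from $\mathbb N$ and $\mathbf Q$ from $\mathbb Q$. For $a\in\mathcal A$ let a sequence on $a$ be a conditional function from $\mathbf N$ to $\mathbf Q$ on $a$ (a family of maps $N_b\to Q_b$, $b\le a$, commuting with restrictions). It is Cauchy if for every $\varepsilon\in Q_a$ with $\varepsilon>0$ there is $n_0\in N_a$ with $|q_m-q_n|<\varepsilon$ for all $m,n\in N_a$ with $m,n\ge n_0$.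 The set $R_a$ consists of the Cauchy sequences on $a$ modulo the equivalence relation $(q_n)\sim(p_n)$ iff for every $\varepsilon\in Q_a$ with $\varepsilon>0$ there is $n_0\in N_a$ with $|q_n-p_n|<\varepsilon$ for all $n\ge n_0$ in $N_a$. The sets $R_a$, with restriction of sequences, form the conditional set $\mathbf R$ of conditional real numbers. Addition, multiplication, $0$ and $1$ are induced termwise, and $[(p_n)]\le[(q_n)]$ in $R_a$ iff for every $\varepsilon\in Q_a$ with $\varepsilon>0$ there is $n_0\in N_a$ with $q_n-p_n>-\varepsilon$ for all $n\ge n_0$ in $N_a$. **The conditional set $\mathbf L^0$.** Let $L^0$ be the set of measurable functions $\Omega\to\mathbb R$ modulo $\mu$-a.e. equality. The conditional set $\mathbf L^0$ has levels $(L^0)_a=\{1_af:f\in L^0\}$ and maps $\gamma_a(f)=1_af$, with pointwise operations and the $\mu$-a.e. order. **Topologies.** A conditional topology on $\mathbf X$ is a conditional subset of $P(\mathbf X)$ living on $1$ whose elements living on $1$ (the open sets) include $\mathbf X$ and the conditional subset living on $0$, and are closed under finite conditional intersections and arbitrary conditional unions (infima and suprema for conditional inclusion). For $\mathbf K=\mathbf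 R$ or $\mathbf L^0$ and $x,\varepsilon\in K_1$ with $\varepsilon>0$, let $B_\varepsilon(x)$ be the conditional subset of those $y$ with $|x-y|<\varepsilon$, where $|z|=\max\{z,-z\}$. Equip $\mathbf K$ with the smallest conditional topology for which all the balls $B_\varepsilon(x)$ are open. A conditional subset living on $1$ is a conditional neighbourhood of $x$ if it contains an open set that has $x$ as an element. A conditional function $f$ is conditionally continuous if for every $x$ the conditional preimage of each conditional neighbourhood of $f(x)$ is a conditional neighbourhood of $x$. **Theorem.** There is a conditional bijection $\varphi:\mathbf R\to\mathbf L^0$, with inverse conditional function $\psi:\mathbf L^0\to\mathbf R$ (that is, $\psi_a\circ\varphi_a=\mathrm{id}$ and $\varphi_a\circ\psi_a=\mathrm{id}$ for all $a\in\mathcal A$), such that 1. $\varphi(0)=0$, $\varphi(1)=1$, and $\varphi(x+y)=\varphi(x)+\varphi(y)$, $\varphi(xy)=\varphi(x)\varphi(y)$ for all $a\in\mathcal A$ and $x,y\in R_a$; 2. $x\le y$ if and only if $\varphi(x)\le\varphi(y)$, for all $a\in\mathcal A$ and $x,y\in R_a$; 3. $\varphi$ and $\psi$ are conditionally continuous.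 -/

import Mathlib

open MeasureTheory

namespace CondSetTheory

universe u

/-- `IsPart a c`: the family `a` belongs to `p(c)`, i.e. its members are pairwise disjoint and have
supremum `c` (members equal to `⊥` are allowed, also repeatedly). -/
def IsPart {A : Type u} [CompleteBooleanAlgebra A] {ι : Type*} (a : ι → A) (c : A) : Prop :=
  (⨆ i, a i) = c ∧ ∀ i j, i ≠ j → a i ⊓ a j = ⊥

theorem IsPart.le {A : Type u} [CompleteBooleanAlgebra A] {ι : Type*} {a : ι → A} {c : A}
    (h : IsPart a c) (i : ι) : a i ≤ c := h.1 ▸ le_iSup a i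

theorem IsPart.inf {A : Type u} [CompleteBooleanAlgebra A] {ι : Type*} {a : ι → A} {c : A}
    (h : IsPart a c) {b : A} (hb : b ≤ c) : IsPart (fun i => b ⊓ a i) b := by
  refine ⟨?_, fun i j hij => ?_⟩
  · rw [← inf_iSup_eq, h.1, inf_eq_left.2 hb]
  · rw [inf_inf_inf_comm, h.2 i j hij, inf_bot_eq]

theorem isPart_single {A : Type u} [CompleteBooleanAlgebra A] (a : A) :
    IsPart (fun _ : PUnit.{u+1} => a) a :=
  ⟨by simp, fun _ _ hij => absurd rfl hij⟩

/-- Adding the missing piece to a partition. -/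
theorem IsPart.extend {A : Type u} [CompleteBooleanAlgebra A] {ι : Type*} {a : ι → A} {c : A}
    (h : IsPart a c) {d : A} (hd : c ≤ d) :
    IsPart (fun o : Option ι => o.elim (d \ c) a) d := by
  refine ⟨?_, ?_⟩
  · rw [iSup_option]
    simp only [Option.elim]
    rw [h.1, sdiff_sup_cancel hd]
  · have key : ∀ i, a i ⊓ (d \ c) = ⊥ := fun i =>
      le_bot_iff.1 ((inf_le_inf_right _ (h.le i)).trans (by rw [inf_sdiff_self_right]))
    rintro (_ | i) (_ | j) hij
    · exact absurd rfl hij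
    · simpa [inf_comm] using key j
    · simpa using key i
    · exact h.2 i j (fun e => hij (e ▸ rfl))

/-- Every family can be made disjoint without changing the supremum. -/
theorem exists_isPart_le {A : Type u} [CompleteBooleanAlgebra A] {ι : Type*} (a : ι → A) :
    ∃ b : ι → A, IsPart b (⨆ i, a i) ∧ ∀ i, b i ≤ a i := by
  classical
  let r : ι → ι → Prop := WellOrderingRel
  have hw : IsWellOrder ι r := WellOrderingRel.isWellOrder
  let b : ι → A := fun i => a i \ ⨆ (j) (_ : r j i), a j
  have hb : ∀ i, b i ≤ a i := fun i => sdiff_le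
  refine ⟨b, ⟨le_antisymm (iSup_mono hb) (iSup_le ?_), ?_⟩, hb⟩
  · intro i
    induction i using hw.wf.induction with
    | _ i ih =>
      have h1 : (⨆ (j) (_ : r j i), a j) ≤ ⨆ i, b i := iSup₂_le ih
      calc a i ≤ (⨆ (j) (_ : r j i), a j) ⊔ b i := le_sup_sdiff
        _ ≤ _ := sup_le h1 (le_iSup b i)
  · have key : ∀ i j, r i j → b i ⊓ b j = ⊥ := by
      intro i j hij
      refine le_bot_iff.1 ?_
      calc b i ⊓ b j ≤ (⨆ (k) (_ : r k j), a k) ⊓ (a j \ ⨆ (k) (_ : r k j), a k) :=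
            inf_le_inf_right _ ((hb i).trans (le_iSup₂_of_le i hij le_rfl))
        _ = ⊥ := inf_sdiff_self_right
    intro i j hij
    rcases trichotomous_of r i j with h | h | h
    · exact key i j h
    · exact absurd h hij
    · rw [inf_comm]; exact key j i h

/-- A conditional set on the complete Boolean algebra `A`; `carrier a` is `X_a` and `res a` is
`γ_a : X_1 → X_a`. -/
structure CondSet (A : Type u) [CompleteBooleanAlgebra A] where
  carrier : A → Type u
  res : ∀ a, carrier ⊤ → carrier a
  bot_nonempty : Nonempty (carrier ⊥)
  bot_subsingleton : Subsingleton (carrier ⊥)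
  surjective : ∀ a, Function.Surjective (res a)
  identity : ∀ x, res ⊤ x = x
  consistency : ∀ a b, a ≤ b → ∀ x y, res b x = res b y → res a x = res a y
  stability : ∀ {ι : Type u} (a : ι → A), IsPart a ⊤ → ∀ x : ∀ i, carrier (a i),
    ∃! y, ∀ i, res (a i) y = x i

variable {A : Type u} [CompleteBooleanAlgebra A]

namespace CondSet

/-- The induced map `γ^b_a : X_b → X_a` for `a ≤ b`, i.e. `x ↦ ax`. -/
noncomputable def restr (X : CondSet A) {a b : A} (_h : a ≤ b) (x : X.carrier b) : X.carrier a :=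
  X.res a (X.surjective b x).choose

theorem restr_res (X : CondSet A) {a b : A} (h : a ≤ b) (y : X.carrier ⊤) :
    X.restr h (X.res b y) = X.res a y :=
  X.consistency a b h _ _ (X.surjective b (X.res b y)).choose_spec

theorem restr_top (X : CondSet A) {a : A} (h : a ≤ ⊤) (x : X.carrier ⊤) :
    X.restr h x = X.res a x := by
  conv_lhs => rw [← X.identity x]
  exact X.restr_res h x

theorem restr_restr (X : CondSet A) {a b c : A} (h : a ≤ b) (h' : b ≤ c) (x : X.carrier c) :
    X.restr h (X.restr h' x) = X.restr (h.trans h') x := by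
  obtain ⟨y, rfl⟩ := X.surjective c x
  rw [restr_res, restr_res, restr_res]

theorem restr_self (X : CondSet A) {a : A} (h : a ≤ a) (x : X.carrier a) : X.restr h x = x := by
  obtain ⟨y, rfl⟩ := X.surjective a x
  rw [restr_res]

theorem restr_surjective (X : CondSet A) {a b : A} (h : a ≤ b) :
    Function.Surjective (X.restr h) := fun x => by
  obtain ⟨y, rfl⟩ := X.surjective a x
  exact ⟨X.res b y, X.restr_res h y⟩

/-- Every matching family on a partition of `c` has exactly one amalgamation in `X_c`. -/
theorem existsUnique_glue (X : CondSet A) {ι : Type u} {a : ι → A} {c : A} (h : IsPart a c)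
    (x : ∀ i, X.carrier (a i)) : ∃! y : X.carrier c, ∀ i, X.restr (h.le i) y = x i := by
  obtain ⟨t⟩ := X.bot_nonempty
  obtain ⟨t, -⟩ := X.surjective ⊥ t
  have hp := h.extend (le_top : c ≤ ⊤)
  let x' : ∀ o : Option ι, X.carrier (o.elim (⊤ \ c) a) := fun o => match o with
    | none => X.res _ t
    | some i => x i
  obtain ⟨y, hy, -⟩ := X.stability _ hp x'
  refine ⟨X.res c y, fun i => ?_, fun z hz => ?_⟩
  · rw [restr_res]; exact hy (some i)
  · obtain ⟨z, rfl⟩ := X.surjective c z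
    let x'' : ∀ o : Option ι, X.carrier (o.elim (⊤ \ c) a) := fun o => X.res _ z
    obtain ⟨w, hw, hu⟩ := X.stability _ hp x''
    have hz' : z = w := hu z fun _ => rfl
    -- compare with the element equal to `y` on `c` and to `z` off `c`
    let x3 : ∀ o : Option PUnit.{u+1}, X.carrier (o.elim (⊤ \ c) fun _ => c) := fun o => match o with
      | none => X.res _ z
      | some _ => X.res c y
    obtain ⟨v, hv, -⟩ := X.stability _ ((isPart_single c).extend (le_top : c ≤ ⊤)) x3
    have hvc : X.res c v = X.res c y := hv (some ⟨⟩)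
    have hvw : v = w := by
      refine hu v ?_
      rintro (_ | i)
      · exact hv none
      · show X.res (a i) v = X.res (a i) z
        have e1 := hz i
        rw [restr_res] at e1
        rw [e1, X.consistency _ _ (h.le i) _ _ hvc]
        exact hy (some i)
    rw [hz', ← hvw, hvc]

theorem sep (X : CondSet A) {ι : Type u} {a : ι → A} {c : A} (h : IsPart a c) {x y : X.carrier c}
    (hxy : ∀ i, X.restr (h.le i) x = X.restr (h.le i) y) : x = y :=
  (X.existsUnique_glue h fun i => X.restr (h.le i) y).unique hxy fun _ => rfl

theorem glue₂ (X : CondSet A) {a c : A} (h : a ≤ c) (x : X.carrier a) (y : X.carrier c) :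
    ∃ z : X.carrier c, X.restr h z = x ∧
      X.restr (sdiff_le : c \ a ≤ c) z = X.restr sdiff_le y := by
  obtain ⟨z, hz, -⟩ := X.existsUnique_glue ((isPart_single a).extend h) (fun o => match o with
    | none => X.restr sdiff_le y
    | some _ => x)
  exact ⟨z, hz (some ⟨⟩), hz none⟩

theorem sep₂ (X : CondSet A) {a c : A} (h : a ≤ c) {x y : X.carrier c}
    (h1 : X.restr h x = X.restr h y)
    (h2 : X.restr (sdiff_le : c \ a ≤ c) x = X.restr sdiff_le y) : x = y := by
  refine X.sep ((isPart_single a).extend h) ?_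
  rintro (_ | i)
  · exact h2
  · exact h1

/-- The conditional product of two conditional sets. -/
noncomputable def prod (X Y : CondSet A) : CondSet A where
  carrier a := X.carrier a × Y.carrier a
  res a p := (X.res a p.1, Y.res a p.2)
  bot_nonempty := by
    obtain ⟨x⟩ := X.bot_nonempty
    obtain ⟨y⟩ := Y.bot_nonempty
    exact ⟨(x, y)⟩
  bot_subsingleton := ⟨fun p q => Prod.ext (X.bot_subsingleton.elim _ _)
    (Y.bot_subsingleton.elim _ _)⟩
  surjective a p := by
    obtain ⟨x, hx⟩ := X.surjective a p.1
    obtain ⟨y, hy⟩ := Y.surjective a p.2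
    exact ⟨(x, y), Prod.ext hx hy⟩
  identity p := Prod.ext (X.identity _) (Y.identity _)
  consistency a b h p q e := by
    rw [Prod.ext_iff] at e ⊢
    exact ⟨X.consistency a b h _ _ e.1, Y.consistency a b h _ _ e.2⟩
  stability a h p := by
    obtain ⟨x, hx, hx'⟩ := X.stability a h fun i => (p i).1
    obtain ⟨y, hy, hy'⟩ := Y.stability a h fun i => (p i).2
    exact ⟨(x, y), fun i => Prod.ext (hx i) (hy i), fun q hq => Prod.ext
      (hx' _ fun i => congrArg Prod.fst (hq i)) (hy' _ fun i => congrArg Prod.snd (hq i))⟩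

theorem prod_restr (X Y : CondSet A) {a b : A} (h : a ≤ b) (p : (X.prod Y).carrier b) :
    (X.prod Y).restr h p = (X.restr h p.1, Y.restr h p.2) := by
  obtain ⟨q, rfl⟩ := (X.prod Y).surjective b p
  rw [restr_res]
  exact Prod.ext (X.restr_res h _).symm (Y.restr_res h _).symm

end CondSet

/-- A predicate on the conditional elements of `X` (living on arbitrary conditions) is local if it
is inherited by restrictions and by amalgamations. -/
structure IsLocal (X : CondSet A) (P : ∀ a, X.carrier a → Prop) : Prop where
  restr : ∀ {a b : A} (h : a ≤ b) (x : X.carrier b), P b x → P a (X.restr h x)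
  glue : ∀ {ι : Type u} {a : ι → A} {c : A} (h : IsPart a c) (x : X.carrier c),
    (∀ i, P (a i) (X.restr (h.le i) x)) → P c x

theorem IsLocal.and {X : CondSet A} {P Q : ∀ a, X.carrier a → Prop} (hP : IsLocal X P)
    (hQ : IsLocal X Q) : IsLocal X fun a x => P a x ∧ Q a x :=
  ⟨fun h x hx => ⟨hP.restr h x hx.1, hQ.restr h x hx.2⟩,
    fun h x hx => ⟨hP.glue h x fun i => (hx i).1, hQ.glue h x fun i => (hx i).2⟩⟩

theorem IsLocal.comap {X Y : CondSet A} {P : ∀ a, Y.carrier a → Prop} (hP : IsLocal Y P)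
    (f : ∀ a, X.carrier a → Y.carrier a)
    (hf : ∀ {a b : A} (h : a ≤ b) x, f a (X.restr h x) = Y.restr h (f b x)) :
    IsLocal X fun a x => P a (f a x) :=
  ⟨fun h x hx => by rw [hf h]; exact hP.restr h _ hx,
    fun h x hx => hP.glue h _ fun i => by rw [← hf]; exact hx i⟩

theorem IsLocal.restr₂ {X Y : CondSet A} {P : ∀ a, X.carrier a → Y.carrier a → Prop}
    (hP : IsLocal (X.prod Y) fun a p => P a p.1 p.2) {a b : A} (h : a ≤ b) (x : X.carrier b)
    (y : Y.carrier b) (hxy : P b x y) : P a (X.restr h x) (Y.restr h y) :=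
  (congrArg (fun p : X.carrier a × Y.carrier a => P a p.1 p.2)
    (X.prod_restr Y h (x, y))).mp (hP.restr h (x, y) hxy)

theorem IsLocal.glue₂ {X Y : CondSet A} {P : ∀ a, X.carrier a → Y.carrier a → Prop}
    (hP : IsLocal (X.prod Y) fun a p => P a p.1 p.2) {ι : Type u} {a : ι → A} {c : A}
    (h : IsPart a c) (x : X.carrier c) (y : Y.carrier c)
    (hxy : ∀ i, P (a i) (X.restr (h.le i) x) (Y.restr (h.le i) y)) : P c x y :=
  hP.glue h (x, y) fun i => (congrArg (fun p : X.carrier (a i) × Y.carrier (a i) => P (a i) p.1 p.2)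
    (X.prod_restr Y (h.le i) (x, y))).mpr (hxy i)

theorem isLocal_prod {X Y : CondSet A} {P : ∀ a, X.carrier a → Y.carrier a → Prop}
    (h1 : ∀ {a b : A} (h : a ≤ b) x y, P b x y → P a (X.restr h x) (Y.restr h y))
    (h2 : ∀ {ι : Type u} {a : ι → A} {c : A} (h : IsPart a c) x y,
      (∀ i, P (a i) (X.restr (h.le i) x) (Y.restr (h.le i) y)) → P c x y) :
    IsLocal (X.prod Y) fun a p => P a p.1 p.2 :=
  ⟨fun h p hp => by
      have e := X.prod_restr Y h p
      exact (congrArg (fun p : X.carrier _ × Y.carrier _ => P _ p.1 p.2) e).mpr (h1 h p.1 p.2 hp),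
    fun h p hp => h2 h p.1 p.2 fun i => by
      have e := X.prod_restr Y (h.le i) p
      exact (congrArg (fun p : X.carrier _ × Y.carrier _ => P _ p.1 p.2) e).mp (hp i)⟩

theorem IsLocal.ex {X Y : CondSet A} {P : ∀ a, X.carrier a → Y.carrier a → Prop}
    (hP : IsLocal (X.prod Y) fun a p => P a p.1 p.2) :
    IsLocal X fun a x => ∃ y, P a x y := by
  refine ⟨fun h x ⟨y, hy⟩ => ⟨_, hP.restr₂ h x y hy⟩, fun h x hx => ?_⟩
  choose y hy using hx
  obtain ⟨z, hz, -⟩ := Y.existsUnique_glue h y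
  exact ⟨z, hP.glue₂ h x z fun i => by rw [hz]; exact hy i⟩

theorem IsLocal.all {X Y : CondSet A} {P Q : ∀ a, X.carrier a → Y.carrier a → Prop}
    (hP : IsLocal (X.prod Y) fun a p => P a p.1 p.2)
    (hQ : IsLocal (X.prod Y) fun a p => Q a p.1 p.2) :
    IsLocal X fun a x => (∃ y, P a x y) ∧ ∀ y, P a x y → Q a x y := by
  refine ⟨fun {a b} h x hx => ⟨hP.ex.restr h x hx.1, fun y hy => ?_⟩,
    fun h x hx => ⟨hP.ex.glue h x fun i => (hx i).1, fun y hy => ?_⟩⟩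
  · obtain ⟨y0, hy0⟩ := hx.1
    obtain ⟨z, hz1, hz2⟩ := Y.glue₂ h y y0
    have hz : P b x z := by
      refine hP.glue₂ ((isPart_single a).extend h) x z ?_
      rintro (_ | i)
      · show P (b \ a) (X.restr sdiff_le x) (Y.restr sdiff_le z)
        rw [hz2]
        exact hP.restr₂ sdiff_le x y0 hy0
      · show P a (X.restr h x) (Y.restr h z)
        rwa [hz1]
    have := hQ.restr₂ h x z (hx.2 z hz)
    rwa [hz1] at this
  · exact hQ.glue₂ h x y fun i => (hx i).2 _ (hP.restr₂ (h.le i) x y hy)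

theorem IsLocal.congr {X : CondSet A} {P Q : ∀ a, X.carrier a → Prop} (hP : IsLocal X P)
    (h : ∀ a x, Q a x ↔ P a x) : IsLocal X Q := by
  have : Q = P := by funext a x; exact propext (h a x)
  rwa [this]

/-- A conditional subset `Y ⊑ X` living on `on`.  `sets a` is `Y_a ⊆ X_a` for `a ≤ on`; for the
remaining `a`, where `Y_a` is not defined, we put `sets a = ∅`. -/
structure CondSubset (X : CondSet A) where
  on : A
  sets : ∀ a, Set (X.carrier a)
  sets_eq_empty : ∀ a, ¬ a ≤ on → sets a = ∅
  bot_nonempty : (sets ⊥).Nonempty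
  /-- the restriction maps `Y_on → Y_a` are well defined and surjective -/
  image_restr : ∀ a (h : a ≤ on), X.restr h '' sets on = sets a
  /-- every matching family in `Y` has its amalgamation in `Y` -/
  stability : ∀ {ι : Type u} (a : ι → A) (h : IsPart a on) (x : ∀ i, X.carrier (a i)),
    (∀ i, x i ∈ sets (a i)) → ∃ y ∈ sets on, ∀ i, X.restr (h.le i) y = x i

namespace CondSubset

theorem le_on {X : CondSet A} (Y : CondSubset X) {a : A} {x : X.carrier a} (hx : x ∈ Y.sets a) :
    a ≤ Y.on := by
  by_contra h
  rw [Y.sets_eq_empty a h] at hx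
  exact hx

theorem nonempty_iff {X : CondSet A} (Y : CondSubset X) (a : A) :
    (Y.sets a).Nonempty ↔ a ≤ Y.on := by
  refine ⟨fun ⟨x, hx⟩ => Y.le_on hx, fun h => ?_⟩
  have h0 : (Y.sets Y.on).Nonempty := by
    have := Y.bot_nonempty
    rw [← Y.image_restr ⊥ bot_le] at this
    exact this.of_image
  rw [← Y.image_restr a h]
  exact h0.image _

theorem ext' {X : CondSet A} {Y Z : CondSubset X} (h : ∀ a, Y.sets a = Z.sets a) : Y = Z := by
  have hs : Y.sets = Z.sets := funext h
  have ho : Y.on = Z.on := le_antisymm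
    ((Z.nonempty_iff _).1 (h Y.on ▸ (Y.nonempty_iff _).2 le_rfl))
    ((Y.nonempty_iff _).1 (h Z.on ▸ (Z.nonempty_iff _).2 le_rfl))
  cases Y; cases Z; cases hs; cases ho; rfl

theorem isLocal {X : CondSet A} (Y : CondSubset X) : IsLocal X fun a x => x ∈ Y.sets a := by
  have hr : ∀ {a b : A} (h : a ≤ b) (x : X.carrier b), x ∈ Y.sets b → X.restr h x ∈ Y.sets a := by
    intro a b h x hx
    have hb := Y.le_on hx
    rw [← Y.image_restr b hb] at hx
    obtain ⟨z, hz, rfl⟩ := hx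
    rw [X.restr_restr, ← Y.image_restr a (h.trans hb)]
    exact ⟨z, hz, rfl⟩
  refine ⟨hr, fun {ι a c} h x hx => ?_⟩
  have hc : c ≤ Y.on := h.1 ▸ iSup_le fun i => Y.le_on (hx i)
  obtain ⟨w, hw⟩ := (Y.nonempty_iff _).2 (le_refl Y.on)
  obtain ⟨y, hy, hy'⟩ := Y.stability _ (h.extend hc) (fun o => match o with
    | none => X.restr sdiff_le w
    | some i => X.restr (h.le i) x) (by
      rintro (_ | i)
      · exact hr _ _ hw
      · exact hx i)
  have e : x = X.restr hc y := X.sep h fun i => by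
    rw [X.restr_restr]; exact (hy' (some i)).symm
  rw [e]
  exact hr hc y hy

/-- A local predicate which holds at `⊥` determines a conditional subset.  It lives on the largest
condition on which the predicate is satisfied by some element. -/
noncomputable def ofLocal {X : CondSet A} (P : ∀ a, X.carrier a → Prop) (hP : IsLocal X P)
    (h0 : ∃ x, P ⊥ x) : CondSubset X :=
  have key : ∃ x, P (sSup {a | ∃ x, P a x}) x := by
    rw [sSup_eq_iSup']
    obtain ⟨b, hb, hle⟩ := exists_isPart_le (fun a : {a | ∃ x, P a x} => (a : A))
    have hx : ∀ i, ∃ x, P (b i) x := fun i => by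
      obtain ⟨x, hx⟩ := i.2
      exact ⟨_, hP.restr (hle i) x hx⟩
    choose x hx using hx
    obtain ⟨y, hy, -⟩ := X.existsUnique_glue hb x
    exact ⟨y, hP.glue hb y fun i => by rw [hy]; exact hx i⟩
  { on := sSup {a | ∃ x, P a x}
    sets := fun a => {x | P a x}
    sets_eq_empty := fun a h => Set.eq_empty_of_forall_notMem fun x hx => h (le_sSup ⟨x, hx⟩)
    bot_nonempty := h0
    image_restr := fun a h => by
      ext x
      refine ⟨?_, fun hx => ?_⟩
      · rintro ⟨y, hy, rfl⟩
        exact hP.restr h y hy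
      · obtain ⟨w, hw⟩ := key
        obtain ⟨z, hz1, hz2⟩ := X.glue₂ h x w
        refine ⟨z, hP.glue ((isPart_single a).extend h) z ?_, hz1⟩
        rintro (_ | i)
        · show P _ (X.restr sdiff_le z)
          rw [hz2]
          exact hP.restr _ w hw
        · show P _ (X.restr h z)
          rw [hz1]
          exact hx
    stability := fun a h x hx => by
      obtain ⟨y, hy, -⟩ := X.existsUnique_glue h x
      exact ⟨y, hP.glue h y fun i => by rw [hy]; exact hx i, hy⟩ }

theorem mem_ofLocal {X : CondSet A} (P : ∀ a, X.carrier a → Prop) (hP : IsLocal X P)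
    (h0 : ∃ x, P ⊥ x) (a : A) (x : X.carrier a) : x ∈ (ofLocal P hP h0).sets a ↔ P a x := Iff.rfl

/-- Conditional inclusion. -/
def Incl {X : CondSet A} (Y Z : CondSubset X) : Prop := ∀ a, Y.sets a ⊆ Z.sets a

/-- `X` as a conditional subset of itself. -/
noncomputable def full (X : CondSet A) : CondSubset X :=
  ofLocal (fun _ _ => True) ⟨fun _ _ _ => trivial, fun _ _ _ => trivial⟩
    ⟨X.bot_nonempty.some, trivial⟩

/-- The conditional empty set `𝟎`, i.e. the conditional subset living on `⊥`. -/
noncomputable def empty (X : CondSet A) : CondSubset X :=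
  ofLocal (fun a _ => a = ⊥)
    ⟨fun h _ hb => le_bot_iff.1 (hb ▸ h), fun h _ hx => by
      rw [← h.1]; simpa using hx⟩
    ⟨X.bot_nonempty.some, rfl⟩

theorem bot_mem {X : CondSet A} (Y : CondSubset X) (x : X.carrier ⊥) : x ∈ Y.sets ⊥ := by
  obtain ⟨y, hy⟩ := Y.bot_nonempty
  rwa [X.bot_subsingleton.elim x y]

/-- The conditional intersection of a set of conditional subsets: its level sets are the
intersections of the level sets. It lives on `sup {a | ⋂ Yᵢ_a ≠ ∅}`, and it is `X` for the empty
set. -/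
noncomputable def sInter {X : CondSet A} (S : Set (CondSubset X)) : CondSubset X :=
  ofLocal (fun a x => ∀ Y ∈ S, x ∈ Y.sets a)
    ⟨fun h x hx Y hY => Y.isLocal.restr h x (hx Y hY),
      fun h x hx Y hY => Y.isLocal.glue h x fun i => hx i Y hY⟩
    ⟨X.bot_nonempty.some, fun Y _ => Y.bot_mem _⟩

/-- The conditional union of a set of conditional subsets: the amalgamations of families of
elements of the members. It is `𝟎` for the empty set. -/
noncomputable def sUnion {X : CondSet A} (S : Set (CondSubset X)) : CondSubset X :=
  ofLocal (fun c x => ∃ (ι : Type u) (b : ι → A) (h : IsPart b c),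
      ∀ i, ∃ Y ∈ S, X.restr (h.le i) x ∈ Y.sets (b i))
    ⟨fun {a c} hac x ⟨ι, b, h, hx⟩ => ⟨ι, fun i => a ⊓ b i, h.inf hac, fun i => by
        obtain ⟨Y, hY, hi⟩ := hx i
        refine ⟨Y, hY, ?_⟩
        have := Y.isLocal.restr (inf_le_right : a ⊓ b i ≤ b i) _ hi
        rwa [X.restr_restr] at this ⊢⟩,
      fun {κ a c} hac x hx => by
        choose ι b h hx using hx
        have hle : ∀ k i, b k i ≤ c := fun k i => ((h k).le i).trans (hac.le k)
        have hp : IsPart (fun s : (k : κ) × ι k => b s.1 s.2) c := by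
          refine ⟨?_, ?_⟩
          · rw [iSup_sigma, ← hac.1]
            exact iSup_congr fun k => (h k).1
          · rintro ⟨k, i⟩ ⟨l, j⟩ hne
            by_cases hkl : k = l
            · subst hkl
              exact (h k).2 i j fun e => hne (by rw [e])
            · exact le_bot_iff.1 ((inf_le_inf ((h k).le i) ((h l).le j)).trans (hac.2 k l hkl).le)
        refine ⟨_, _, hp, ?_⟩
        rintro ⟨k, i⟩
        obtain ⟨Y, hY, hi⟩ := hx k i
        rw [X.restr_restr] at hi
        exact ⟨Y, hY, hi⟩⟩
    ⟨X.bot_nonempty.some, PEmpty, fun e => e.elim, ⟨by simp, fun i => i.elim⟩, fun i => i.elim⟩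

/-- The restriction of a conditional subset to a condition; it lives on `a ⊓ Y.on`. -/
noncomputable def cut {X : CondSet A} (a : A) (Y : CondSubset X) : CondSubset X :=
  ofLocal (fun b x => b ≤ a ∧ x ∈ Y.sets b)
    ⟨fun h x hx => ⟨h.trans hx.1, Y.isLocal.restr h x hx.2⟩,
      fun h x hx => ⟨h.1 ▸ iSup_le fun i => (hx i).1, Y.isLocal.glue h x fun i => (hx i).2⟩⟩
    ⟨X.bot_nonempty.some, bot_le, Y.bot_mem _⟩

theorem mem_cut {X : CondSet A} (a : A) (Y : CondSubset X) (b : A) (x : X.carrier b) :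
    x ∈ (Y.cut a).sets b ↔ b ≤ a ∧ x ∈ Y.sets b := Iff.rfl

theorem cut_on_le {X : CondSet A} (a : A) (Y : CondSubset X) : (Y.cut a).on ≤ a := by
  obtain ⟨x, hx⟩ := ((Y.cut a).nonempty_iff _).2 le_rfl
  exact hx.1

theorem cut_eq {X : CondSet A} {a : A} {Y : CondSubset X} (h : Y.on ≤ a) : Y.cut a = Y :=
  ext' fun b => by
    ext x
    exact ⟨fun hx => hx.2, fun hx => ⟨(Y.le_on hx).trans h, hx⟩⟩

theorem cut_cut {X : CondSet A} {a b : A} (h : a ≤ b) (Y : CondSubset X) :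
    (Y.cut b).cut a = Y.cut a :=
  ext' fun c => by
    ext x
    exact ⟨fun hx => ⟨hx.1, hx.2.2⟩, fun hx => ⟨hx.1, hx.1.trans h, hx.2⟩⟩

end CondSubset

/-- The conditional power set: `P(X)_a` consists of the conditional subsets of `X` living on a
condition `≤ a`, and `π_a` is restriction to `a`. -/
noncomputable def powerset (X : CondSet A) : CondSet A where
  carrier a := {Y : CondSubset X // Y.on ≤ a}
  res a Y := ⟨Y.1.cut a, Y.1.cut_on_le a⟩
  bot_nonempty := ⟨⟨(CondSubset.empty X).cut ⊥, CondSubset.cut_on_le _ _⟩⟩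
  bot_subsingleton := ⟨fun Y Z => Subtype.ext (CondSubset.ext' fun a => by
    ext x
    constructor
    · intro hx
      obtain rfl : a = ⊥ := le_bot_iff.1 ((Y.1.le_on hx).trans Y.2)
      exact Z.1.bot_mem x
    · intro hx
      obtain rfl : a = ⊥ := le_bot_iff.1 ((Z.1.le_on hx).trans Z.2)
      exact Y.1.bot_mem x)⟩
  surjective a Y := ⟨⟨Y.1, le_top⟩, Subtype.ext (CondSubset.cut_eq Y.2)⟩
  identity Y := Subtype.ext (CondSubset.cut_eq Y.2)
  consistency a b h Y Z e := by
    have e' : Y.1.cut b = Z.1.cut b := congrArg Subtype.val e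
    refine Subtype.ext ?_
    show Y.1.cut a = Z.1.cut a
    rw [← CondSubset.cut_cut h, e', CondSubset.cut_cut h]
  stability {ι} a h Y := by
    have hloc : IsLocal X fun c x => ∀ i,
        X.restr (inf_le_left : c ⊓ a i ≤ c) x ∈ (Y i).1.sets (c ⊓ a i) := by
      refine ⟨fun {b c} hbc x hx i => ?_, fun {κ b c} hb x hx i => ?_⟩
      · have := (Y i).1.isLocal.restr (inf_le_inf_right (a i) hbc) _ (hx i)
        rwa [X.restr_restr] at this ⊢
      · refine (Y i).1.isLocal.glue (hb.inf (inf_le_left : c ⊓ a i ≤ c)) _ fun k => ?_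
        have hk : (c ⊓ a i) ⊓ b k ≤ b k ⊓ a i := by
          rw [inf_right_comm, inf_comm (c ⊓ b k)]
          exact le_inf (inf_le_right.trans inf_le_right) inf_le_left
        have := (Y i).1.isLocal.restr hk _ (hx k i)
        rw [X.restr_restr, X.restr_restr] at this
        rwa [X.restr_restr]
    let Z : CondSubset X := CondSubset.ofLocal _ hloc
      ⟨X.bot_nonempty.some, fun i => by
        have h0 : (⊥ : A) ⊓ a i = ⊥ := bot_inf_eq _
        exact (Y i).1.isLocal.restr _ _ ((Y i).1.bot_mem _)⟩
    have hZ : ∀ i, Z.cut (a i) = (Y i).1 := by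
      intro i
      refine CondSubset.ext' fun b => ?_
      ext x
      constructor
      · rintro ⟨hb, hx⟩
        have := (Y i).1.isLocal.restr (le_inf le_rfl hb : b ≤ b ⊓ a i) _ (hx i)
        rwa [X.restr_restr, X.restr_self] at this
      · intro hx
        have hb : b ≤ a i := ((Y i).1.le_on hx).trans (Y i).2
        refine ⟨hb, fun j => ?_⟩
        by_cases hij : i = j
        · subst hij
          exact (Y i).1.isLocal.restr _ _ hx
        · have h0 : b ⊓ a j = ⊥ := le_bot_iff.1 ((inf_le_inf_right _ hb).trans (h.2 i j hij).le)
          obtain ⟨y, hy⟩ := ((Y j).1.nonempty_iff (b ⊓ a j)).2 (h0 ▸ bot_le)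
          have hs : Subsingleton (X.carrier (b ⊓ a j)) := h0 ▸ X.bot_subsingleton
          rwa [hs.elim (X.restr inf_le_left x) y]
    refine ⟨⟨Z, le_top⟩, fun i => Subtype.ext (hZ i), ?_⟩
    rintro ⟨W, hW⟩ hW'
    refine Subtype.ext (CondSubset.ext' fun c => ?_)
    have e : ∀ i, W.cut (a i) = (Y i).1 := fun i => congrArg Subtype.val (hW' i)
    ext x
    constructor
    · intro hx i
      rw [← e i]
      exact ⟨inf_le_right, W.isLocal.restr _ _ hx⟩
    · intro hx
      refine W.isLocal.glue (h.inf (le_top : c ≤ ⊤)) x fun i => ?_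
      have := hx i
      rw [← e i] at this
      exact this.2

/-- A family of maps `X_a → Y_a` which commutes with the restriction maps. -/
structure Natural {X Y : CondSet A} (f : ∀ a, X.carrier a → Y.carrier a) : Prop where
  eq : ∀ {a b : A} (h : a ≤ b) (x : X.carrier b), f a (X.restr h x) = Y.restr h (f b x)

theorem Natural.comp {X Y Z : CondSet A} {g : ∀ a, Y.carrier a → Z.carrier a}
    {f : ∀ a, X.carrier a → Y.carrier a} (hg : Natural g) (hf : Natural f) :
    Natural (X := X) (Y := Z) fun a x => g a (f a x) :=
  ⟨fun h x => (congrArg (g _) (hf.eq h x)).trans (hg.eq h _)⟩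

theorem natural_id {X : CondSet A} : Natural (X := X) (Y := X) fun _ x => x := ⟨fun _ _ => rfl⟩

theorem natural_fst {X Y : CondSet A} : Natural (X := X.prod Y) (Y := X) fun _ p => p.1 :=
  ⟨fun h p => congrArg Prod.fst (X.prod_restr Y h p)⟩

theorem natural_snd {X Y : CondSet A} : Natural (X := X.prod Y) (Y := Y) fun _ p => p.2 :=
  ⟨fun h p => congrArg Prod.snd (X.prod_restr Y h p)⟩

theorem Natural.pair {X Y Z : CondSet A} {f : ∀ a, X.carrier a → Y.carrier a}
    {g : ∀ a, X.carrier a → Z.carrier a} (hf : Natural f) (hg : Natural g) :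
    Natural (X := X) (Y := Y.prod Z) fun a x => (f a x, g a x) :=
  ⟨fun h x => (Prod.ext (hf.eq h x) (hg.eq h x)).trans (Y.prod_restr Z h _).symm⟩

theorem IsLocal.comp {X Y : CondSet A} {P : ∀ a, Y.carrier a → Prop} (hP : IsLocal Y P)
    {f : ∀ a, X.carrier a → Y.carrier a} (hf : Natural f) : IsLocal X fun a x => P a (f a x) :=
  hP.comap f fun h x => hf.eq h x

/-- A conditional function `cX → cY` on the condition `c`: a family of functions
`f_b : X_b → Y_b`, `b ≤ c`, commuting with restrictions; equivalently (see `CondFun.graph` and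
`CondFun.exists_of_graph`) a conditional subset of `X × Y` living on `c` whose level sets are graphs
of functions. A conditional function `X → Y` is the case `c = ⊤`. -/
@[ext] structure CondFun (X Y : CondSet A) (c : A) where
  toFun : ∀ b, b ≤ c → X.carrier b → Y.carrier b
  restr_toFun : ∀ {a b : A} (h : a ≤ b) (hb : b ≤ c) (x : X.carrier b),
    toFun a (h.trans hb) (X.restr h x) = Y.restr h (toFun b hb x)

/-- The value of a conditional function `X → Y` at a conditional element. -/
def CondFun.app {X Y : CondSet A} (f : CondFun X Y ⊤) {a : A} (x : X.carrier a) : Y.carrier a :=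
  f.toFun a le_top x

theorem CondFun.natural {X Y : CondSet A} (f : CondFun X Y ⊤) :
    Natural (X := X) (Y := Y) fun _ x => f.app x := ⟨fun h x => f.restr_toFun h le_top x⟩

theorem CondSet.nonempty (X : CondSet A) (a : A) : Nonempty (X.carrier a) :=
  ⟨X.res a (X.surjective ⊥ X.bot_nonempty.some).choose⟩

/-- The graph of a conditional function. -/
noncomputable def CondFun.graph {X Y : CondSet A} {c : A} (f : CondFun X Y c) :
    CondSubset (X.prod Y) :=
  CondSubset.ofLocal (X := X.prod Y) (fun a p => ∃ h : a ≤ c, p.2 = f.toFun a h p.1)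
    (isLocal_prod (P := fun a x y => ∃ h : a ≤ c, y = f.toFun a h x)
      (fun {a b} h x y ⟨hb, e⟩ => ⟨h.trans hb, by rw [f.restr_toFun h hb, e]⟩)
      (fun {ι a b} h x y hxy => by
        have hb : b ≤ c := h.1 ▸ iSup_le fun i => (hxy i).1
        refine ⟨hb, Y.sep h fun i => ?_⟩
        rw [(hxy i).2, f.restr_toFun (h.le i) hb]))
    ⟨((X.nonempty ⊥).some, f.toFun ⊥ bot_le (X.nonempty ⊥).some), bot_le, rfl⟩

theorem CondFun.graph_on {X Y : CondSet A} {c : A} (f : CondFun X Y c) : f.graph.on = c := by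
  refine le_antisymm ?_ ?_
  · obtain ⟨p, hp, -⟩ := (f.graph.nonempty_iff _).2 le_rfl
    exact hp
  · exact (f.graph.nonempty_iff _).1 ⟨((X.nonempty c).some, f.toFun c le_rfl (X.nonempty c).some),
      le_rfl, rfl⟩

theorem CondFun.exists_of_graph {X Y : CondSet A} {c : A} (G : CondSubset (X.prod Y))
    (hc : G.on = c) (hG : ∀ a ≤ c, ∀ x : X.carrier a, ∃! y : Y.carrier a, (x, y) ∈ G.sets a) :
    ∃ f : CondFun X Y c, f.graph = G := by
  choose f hf hu using hG
  refine ⟨⟨f, fun {a b} h hb x => ?_⟩, CondSubset.ext' fun a => ?_⟩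
  · refine (hu a (h.trans hb) _ _ ?_).symm
    exact IsLocal.restr₂ (P := fun a x y => (x, y) ∈ G.sets a) G.isLocal h x _ (hf b hb x)
  · ext ⟨x, y⟩
    constructor
    · rintro ⟨h, e⟩
      simp only at e
      rw [e]
      exact hf a h x
    · intro hp
      have h : a ≤ c := hc ▸ G.le_on hp
      exact ⟨h, hu a h x y hp⟩

/-- The conditional set `M(X, Y)` of conditional functions; `M(X, Y)_c` consists of the conditional
functions `cX → cY`. -/
noncomputable def funSpace (X Y : CondSet A) : CondSet A :=
  have glue : ∀ {ι : Type u} (a : ι → A), IsPart a ⊤ → ∀ f : ∀ i, CondFun X Y (a i),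
      ∃ g : CondFun X Y ⊤, ∀ i b (h : b ≤ a i) x, g.toFun b le_top x = (f i).toFun b h x := by
    intro ι a h f
    have key : ∀ b (x : X.carrier b), ∃! y : Y.carrier b, ∀ i,
        Y.restr ((h.inf (le_top : b ≤ ⊤)).le i) y =
          (f i).toFun (b ⊓ a i) inf_le_right (X.restr inf_le_left x) :=
      fun b x => Y.existsUnique_glue (h.inf (le_top : b ≤ ⊤)) _
    choose g hg hu using key
    have hr : ∀ {c b : A} (hcb : c ≤ b) (hb : b ≤ ⊤) (x : X.carrier b),
        g c (X.restr hcb x) = Y.restr hcb (g b x) := by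
      intro c b hcb hb x
      refine (hu c _ _ fun i => ?_).symm
      have e := congrArg (Y.restr (inf_le_inf_right (a i) hcb)) (hg b x i)
      rw [← (f i).restr_toFun (inf_le_inf_right (a i) hcb) inf_le_right, X.restr_restr,
        Y.restr_restr] at e
      rw [X.restr_restr, Y.restr_restr]
      exact e
    refine ⟨⟨fun b _ x => g b x, hr⟩, fun i b hb x => ?_⟩
    have e := congrArg (Y.restr (le_inf le_rfl hb : b ≤ b ⊓ a i)) (hg b x i)
    rw [← (f i).restr_toFun (le_inf le_rfl hb) inf_le_right, X.restr_restr, Y.restr_restr,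
      X.restr_self, Y.restr_self] at e
    exact e
  have const : ∀ c, Nonempty (CondFun X Y c) := fun c =>
    ⟨⟨fun b _ _ => Y.res b (Y.nonempty ⊤).some, fun h _ _ => (Y.restr_res h _).symm⟩⟩
  { carrier := CondFun X Y
    res := fun c f => ⟨fun b _ x => f.toFun b le_top x, fun h _ x => f.restr_toFun h le_top x⟩
    bot_nonempty := const ⊥
    bot_subsingleton := ⟨fun f g => by
      refine CondFun.ext ?_
      funext b hb x
      obtain rfl := le_bot_iff.1 hb
      exact Y.bot_subsingleton.elim _ _⟩
    surjective := fun c f => by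
      obtain ⟨g, hg⟩ := glue _ ((isPart_single c).extend le_top) (fun o => match o with
        | none => (const _).some
        | some _ => f)
      refine ⟨g, CondFun.ext ?_⟩
      funext b hb x
      exact hg (some ⟨⟩) b hb x
    identity := fun f => rfl
    consistency := fun a b h f g e => by
      refine CondFun.ext ?_
      funext c hc x
      exact congrFun (congrFun (congrFun (congrArg CondFun.toFun e) c) (hc.trans h)) x
    stability := fun a h f => by
      obtain ⟨g, hg⟩ := glue a h f
      refine ⟨g, fun i => ?_, fun g' hg' => ?_⟩
      · refine CondFun.ext ?_
        funext b hb x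
        exact hg i b hb x
      · refine CondFun.ext ?_
        funext b hb x
        refine Y.sep (h.inf (le_top : b ≤ ⊤)) fun i => ?_
        rw [← g'.restr_toFun _ le_top, ← g.restr_toFun _ le_top]
        exact (congrFun (congrFun (congrFun (congrArg CondFun.toFun (hg' i)) (b ⊓ a i))
          inf_le_right) _).trans (hg i _ inf_le_right _).symm }

theorem funSpace_restr {X Y : CondSet A} {a b : A} (h : a ≤ b) (f : CondFun X Y b) :
    (funSpace X Y).restr h f =
      (⟨fun c hc x => f.toFun c (hc.trans h) x, fun h' hb x => f.restr_toFun h' (hb.trans h) x⟩ :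
        CondFun X Y a) := by
  obtain ⟨g, rfl⟩ := (funSpace X Y).surjective b f
  rw [CondSet.restr_res]
  rfl

/-- The value `f(x)` of a conditional function on `a` at a conditional element on `a`. -/
def CondFun.eval {X Y : CondSet A} {a : A} (f : CondFun X Y a) (x : X.carrier a) : Y.carrier a :=
  f.toFun a le_rfl x

theorem natural_eval {X Y : CondSet A} :
    Natural (X := (funSpace X Y).prod X) (Y := Y) fun _ p => CondFun.eval p.1 p.2 := by
  refine ⟨fun {a b} h p => ?_⟩
  refine (congrArg (fun q : CondFun X Y a × X.carrier a => q.1.eval q.2)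
    (CondSet.prod_restr (funSpace X Y) X h p)).trans ?_
  exact (congrArg (fun g : CondFun X Y a => g.eval (X.restr h p.2)) (funSpace_restr h p.1)).trans
    (CondFun.restr_toFun p.1 h le_rfl p.2)

/-- A conditional subset living on `⊤` as a conditional set. -/
noncomputable def CondSubset.toCondSet {X : CondSet A} (Y : CondSubset X) (h : Y.on = ⊤) :
    CondSet A where
  carrier a := {x : X.carrier a // x ∈ Y.sets a}
  res a x := ⟨X.res a x.1, by
    rw [← X.restr_top le_top]; exact Y.isLocal.restr le_top x.1 x.2⟩
  bot_nonempty := Y.bot_nonempty.to_subtype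
  bot_subsingleton := ⟨fun x y => Subtype.ext (X.bot_subsingleton.elim _ _)⟩
  surjective a x := by
    obtain ⟨z, hz, e⟩ := (Set.ext_iff.1 (Y.image_restr a (h ▸ le_top)) x.1).2 x.2
    have hY : ∀ c (hc : c = ⊤) (hac : a ≤ c) (z : X.carrier c), z ∈ Y.sets c →
        ∃ w ∈ Y.sets ⊤, X.res a w = X.restr hac z := by
      rintro c rfl hac z hz
      exact ⟨z, hz, (X.restr_top hac z).symm⟩
    obtain ⟨w, hw, e'⟩ := hY _ h _ z hz
    exact ⟨⟨w, hw⟩, Subtype.ext (e'.trans e)⟩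
  identity x := Subtype.ext (X.identity _)
  consistency a b hab x y e :=
    Subtype.ext (X.consistency a b hab _ _ (congrArg Subtype.val e))
  stability a ha x := by
    obtain ⟨y, hy, hu⟩ := X.stability a ha fun i => (x i).1
    refine ⟨⟨y, Y.isLocal.glue ha y fun i => ?_⟩, fun i => Subtype.ext (hy i), fun z hz =>
      Subtype.ext (hu z.1 fun i => congrArg Subtype.val (hz i))⟩
    rw [X.restr_top, hy]
    exact (x i).2

theorem CondSubset.natural_val {X : CondSet A} (Y : CondSubset X) (h : Y.on = ⊤) :
    Natural (X := Y.toCondSet h) (Y := X) fun _ x => x.1 := by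
  refine ⟨fun {a b} hab x => ?_⟩
  obtain ⟨y, rfl⟩ := (Y.toCondSet h).surjective b x
  rw [CondSet.restr_res]
  exact (X.restr_res hab _).symm

theorem CondSubset.natural_mk {X Z : CondSet A} (Y : CondSubset X) (h : Y.on = ⊤)
    {f : ∀ a, Z.carrier a → X.carrier a} (hf : Natural f) (hY : ∀ a z, f a z ∈ Y.sets a) :
    Natural (X := Z) (Y := Y.toCondSet h) fun a z => ⟨f a z, hY a z⟩ := by
  refine ⟨fun {a b} hab x => ?_⟩
  refine Subtype.ext ?_
  have := (Y.natural_val h).eq hab ⟨f b x, hY b x⟩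
  exact (hf.eq hab x).trans this.symm

/-- A conditional binary relation on `X`, i.e. a conditional subset of `X × X` living on `⊤`
(see `CondRel.toCondSubset`), written as a family of relations on the sets `X_a`. -/
structure CondRel (X : CondSet A) where
  rel : ∀ a, X.carrier a → X.carrier a → Prop
  isLocal : IsLocal (X.prod X) fun a p => rel a p.1 p.2
  nonempty : ∃ x y, rel ⊤ x y

/-- The conditional subset of `X × X` belonging to a conditional relation. -/
noncomputable def CondRel.toCondSubset {X : CondSet A} (R : CondRel X) : CondSubset (X.prod X) :=
  CondSubset.ofLocal (X := X.prod X) (fun a p => R.rel a p.1 p.2) R.isLocal (by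
    obtain ⟨x, y, h⟩ := R.nonempty
    exact ⟨(X.restr bot_le x, X.restr bot_le y),
      IsLocal.restr₂ (P := R.rel) R.isLocal (bot_le : ⊥ ≤ ⊤) x y h⟩)

theorem CondRel.toCondSubset_on {X : CondSet A} (R : CondRel X) : R.toCondSubset.on = ⊤ := by
  obtain ⟨x, y, h⟩ := R.nonempty
  exact top_le_iff.1 ((R.toCondSubset.nonempty_iff ⊤).1 ⟨(x, y), h⟩)

/-- The strict relation of a conditional order: `x < y` iff `x ≤ y` and `bx = by` only for
`b = ⊥`. -/
def CondRel.lt {X : CondSet A} (R : CondRel X) (a : A) (x y : X.carrier a) : Prop :=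
  R.rel a x y ∧ ∀ b (h : b ≤ a), X.restr h x = X.restr h y → b = ⊥

theorem CondRel.isLocal_lt {X : CondSet A} (R : CondRel X) :
    IsLocal (X.prod X) fun a p => R.lt a p.1 p.2 :=
  isLocal_prod (P := R.lt)
    (fun h x y hxy => ⟨IsLocal.restr₂ (P := R.rel) R.isLocal h x y hxy.1, fun b hb e =>
      hxy.2 b (hb.trans h) (by rwa [X.restr_restr, X.restr_restr] at e)⟩)
    (fun {ι a c} h x y hxy => ⟨IsLocal.glue₂ (P := R.rel) R.isLocal h x y fun i => (hxy i).1,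
      fun b hb e => by
        rw [← (h.inf hb).1]
        simp only [iSup_eq_bot]
        intro i
        refine (hxy i).2 _ inf_le_right ?_
        have := congrArg (X.restr (inf_le_left : b ⊓ a i ≤ b)) e
        rw [X.restr_restr, X.restr_restr] at this
        rwa [X.restr_restr, X.restr_restr]⟩)

/-- The conditional quotient of `X` by a conditional equivalence relation. -/
noncomputable def quot (X : CondSet A) (R : CondRel X) (hR : ∀ a, Equivalence (R.rel a)) :
    CondSet A where
  carrier a := Quotient (⟨R.rel a, hR a⟩ : Setoid (X.carrier a))
  res a := Quotient.map' (s₁ := ⟨R.rel ⊤, hR ⊤⟩) (s₂ := ⟨R.rel a, hR a⟩) (X.res a) (by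
    intro x y h
    have := IsLocal.restr₂ (P := R.rel) R.isLocal (le_top : a ≤ ⊤) x y h
    rwa [X.restr_top, X.restr_top] at this)
  bot_nonempty := ⟨Quotient.mk _ X.bot_nonempty.some⟩
  bot_subsingleton := ⟨fun x y => by
    induction x using Quotient.inductionOn with | _ x =>
    induction y using Quotient.inductionOn with | _ y =>
    rw [X.bot_subsingleton.elim x y]⟩
  surjective a x := by
    induction x using Quotient.inductionOn with | _ x =>
    obtain ⟨y, rfl⟩ := X.surjective a x
    exact ⟨Quotient.mk _ y, rfl⟩
  identity x := by
    induction x using Quotient.inductionOn with | _ x =>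
    exact congrArg (Quotient.mk _) (X.identity x)
  consistency a b h x y e := by
    induction x using Quotient.inductionOn with | _ x =>
    induction y using Quotient.inductionOn with | _ y =>
    refine Quotient.sound (s := ⟨R.rel a, hR a⟩) ?_
    have e' : R.rel b (X.res b x) (X.res b y) := Quotient.exact (s := ⟨R.rel b, hR b⟩) e
    have := IsLocal.restr₂ (P := R.rel) R.isLocal h _ _ e'
    rwa [X.restr_res, X.restr_res] at this
  stability {ι} a h x := by
    have hx : ∀ i, ∃ y, Quotient.mk (⟨R.rel (a i), hR (a i)⟩ : Setoid (X.carrier (a i))) y = x i :=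
      fun i => Quotient.exists_rep (x i)
    choose y hy using hx
    obtain ⟨z, hz, -⟩ := X.stability a h y
    refine ⟨Quotient.mk _ z, fun i => ?_, fun w hw => ?_⟩
    · rw [← hy i]
      exact congrArg (Quotient.mk _) (hz i)
    · induction w using Quotient.inductionOn with | _ w =>
      refine Quotient.sound (s := ⟨R.rel ⊤, hR ⊤⟩)
        (IsLocal.glue₂ (P := R.rel) R.isLocal h w z fun i => ?_)
      rw [X.restr_top, X.restr_top, hz i]
      exact Quotient.exact (s := ⟨R.rel (a i), hR (a i)⟩) ((hw i).trans (hy i).symm)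

theorem quot_restr {X : CondSet A} {R : CondRel X} {hR : ∀ a, Equivalence (R.rel a)} {a b : A}
    (h : a ≤ b) (x : X.carrier b) :
    (quot X R hR).restr h (Quotient.mk ⟨R.rel b, hR b⟩ x) =
      Quotient.mk ⟨R.rel a, hR a⟩ (X.restr h x) := by
  obtain ⟨y, rfl⟩ := X.surjective b x
  have e := (quot X R hR).restr_res h (Quotient.mk ⟨R.rel ⊤, hR ⊤⟩ y)
  rw [X.restr_res]
  exact e

/-- A conditional operation on `X` which respects `R` induces one on the quotient. -/
noncomputable def quotMap₂ {X : CondSet A} (R : CondRel X) (hR : ∀ a, Equivalence (R.rel a))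
    (f : ∀ a, X.carrier a → X.carrier a → X.carrier a)
    (hf : Natural (X := X.prod X) (Y := X) fun a p => f a p.1 p.2)
    (hfR : ∀ a x x' y y', R.rel a x x' → R.rel a y y' → R.rel a (f a x y) (f a x' y')) :
    CondFun ((quot X R hR).prod (quot X R hR)) (quot X R hR) ⊤ where
  toFun b _ p := Quotient.map₂ (sa := ⟨R.rel b, hR b⟩) (sb := ⟨R.rel b, hR b⟩)
    (sc := ⟨R.rel b, hR b⟩) (f b) (fun x x' hx y y' hy => hfR b x x' y y' hx hy) p.1 p.2
  restr_toFun {a b} h hb p := by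
    obtain ⟨x, y⟩ := p
    induction x using Quotient.inductionOn with | _ x =>
    induction y using Quotient.inductionOn with | _ y =>
    have e := CondSet.prod_restr (quot X R hR) (quot X R hR) h
      (Quotient.mk ⟨R.rel b, hR b⟩ x, Quotient.mk ⟨R.rel b, hR b⟩ y)
    rw [e]
    simp only
    rw [quot_restr, quot_restr]
    refine Eq.trans ?_ (quot_restr h (f b x y)).symm
    have e2 := hf.eq h (x, y)
    have e3 := CondSet.prod_restr X X h (x, y)
    rw [e3] at e2
    exact congrArg (Quotient.mk _) e2

/-- A conditional map on `X` which respects `R` induces one on the quotient. -/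
noncomputable def quotMap {X : CondSet A} (R : CondRel X) (hR : ∀ a, Equivalence (R.rel a))
    (f : ∀ a, X.carrier a → X.carrier a) (hf : Natural (X := X) (Y := X) f)
    (hfR : ∀ a x x', R.rel a x x' → R.rel a (f a x) (f a x')) :
    CondFun (quot X R hR) (quot X R hR) ⊤ where
  toFun b _ p := Quotient.map (sa := ⟨R.rel b, hR b⟩) (sb := ⟨R.rel b, hR b⟩) (f b)
    (fun x x' hx => hfR b x x' hx) p
  restr_toFun {a b} h hb x := by
    induction x using Quotient.inductionOn with | _ x =>
    rw [quot_restr]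
    refine Eq.trans ?_ (quot_restr h (f b x)).symm
    exact congrArg (Quotient.mk _) (hf.eq h x)

/-- A conditional relation on `X` which respects `R` induces one on the quotient. -/
noncomputable def quotRel {X : CondSet A} (R : CondRel X) (hR : ∀ a, Equivalence (R.rel a))
    (S : CondRel X)
    (hS : ∀ a x x' y y', R.rel a x x' → R.rel a y y' → (S.rel a x y ↔ S.rel a x' y')) :
    CondRel (quot X R hR) where
  rel a := Quotient.lift₂ (s₁ := ⟨R.rel a, hR a⟩) (s₂ := ⟨R.rel a, hR a⟩) (S.rel a)
    fun x y x' y' hx hy => propext (hS a x x' y y' hx hy)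
  isLocal := by
    refine isLocal_prod (fun h x y hxy => ?_) (fun h x y hxy => ?_)
    · induction x using Quotient.inductionOn with | _ x =>
      induction y using Quotient.inductionOn with | _ y =>
      rw [quot_restr, quot_restr]
      exact IsLocal.restr₂ (P := S.rel) S.isLocal h x y hxy
    · induction x using Quotient.inductionOn with | _ x =>
      induction y using Quotient.inductionOn with | _ y =>
      refine IsLocal.glue₂ (P := S.rel) S.isLocal h x y fun i => ?_
      have := hxy i
      rw [quot_restr, quot_restr] at this
      exact this
  nonempty := by
    obtain ⟨x, y, h⟩ := S.nonempty
    exact ⟨Quotient.mk _ x, Quotient.mk _ y, h⟩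

/-- The conditional set generated by a non-empty set `E`. An amalgamation `∑ aᵢ xᵢ` with `(aᵢ)` in
`p(a)` is represented by the function `z ↦ sup {aᵢ | xᵢ = z}`, which determines it; the functions
obtained in this way are those whose values form a partition of `a`. -/
noncomputable def gen (A : Type u) [CompleteBooleanAlgebra A] (E : Type) [Nonempty E] :
    CondSet A where
  carrier a := {g : E → A // IsPart g a}
  res a g := ⟨fun z => a ⊓ g.1 z, g.2.inf le_top⟩
  bot_nonempty := ⟨⟨fun _ => ⊥, by simp, fun _ _ _ => by simp⟩⟩
  bot_subsingleton := ⟨fun g h => Subtype.ext (funext fun z => by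
    rw [le_bot_iff.1 (g.2.le z), le_bot_iff.1 (h.2.le z)])⟩
  surjective a g := by
    classical
    obtain ⟨z0⟩ := ‹Nonempty E›
    have h0 : ∀ z, g.1 z ⊓ aᶜ = ⊥ := fun z =>
      le_bot_iff.1 ((inf_le_inf_right _ (g.2.le z)).trans inf_compl_eq_bot.le)
    refine ⟨⟨fun z => g.1 z ⊔ if z = z0 then aᶜ else ⊥, ?_, fun i j hij => ?_⟩,
      Subtype.ext (funext fun z => ?_)⟩
    · rw [iSup_sup_eq, g.2.1, iSup_ite, iSup_iSup_eq_left]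
      simp
    · have hg := g.2.2 i j hij
      beta_reduce
      split_ifs with hi hj hj
      · exact absurd (hi.trans hj.symm) hij
      · rw [sup_bot_eq, inf_sup_right, hg, inf_comm, h0, bot_sup_eq]
      · rw [sup_bot_eq, inf_sup_left, hg, h0, bot_sup_eq]
      · rw [sup_bot_eq, sup_bot_eq, hg]
    · show a ⊓ (g.1 z ⊔ if z = z0 then aᶜ else ⊥) = g.1 z
      rw [inf_sup_left, inf_eq_right.2 (g.2.le z)]
      split_ifs <;> simp
  identity g := Subtype.ext (funext fun z => top_inf_eq _)
  consistency a b h g k e := Subtype.ext (funext fun z => by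
    have e' : b ⊓ g.1 z = b ⊓ k.1 z := congrFun (congrArg Subtype.val e) z
    show a ⊓ g.1 z = a ⊓ k.1 z
    rw [← inf_eq_left.2 h, inf_assoc, e', inf_assoc])
  stability {ι} a h g := by
    have hz : ∀ i z, a i ⊓ (⨆ j, (g j).1 z) = (g i).1 z := fun i z => by
      refine le_antisymm ?_ (le_inf ((g i).2.le z) (le_iSup (fun j => (g j).1 z) i))
      rw [inf_iSup_eq]
      refine iSup_le fun j => ?_
      by_cases hij : i = j
      · subst hij; exact inf_le_right
      · exact ((inf_le_inf_left _ ((g j).2.le z)).trans (h.2 i j hij).le).trans bot_le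
    refine ⟨⟨fun z => ⨆ i, (g i).1 z, ?_, fun z w hzw => ?_⟩,
      fun i => Subtype.ext (funext fun z => hz i z), fun k hk => Subtype.ext (funext fun z => ?_)⟩
    · rw [iSup_comm, ← h.1]
      exact iSup_congr fun i => (g i).2.1
    · rw [iSup_inf_eq]
      simp only [iSup_eq_bot]
      intro i
      have : (g i).1 z ⊓ ⨆ j, (g j).1 w = (g i).1 z ⊓ (g i).1 w := by
        rw [← hz i w, ← inf_assoc, inf_eq_left.2 ((g i).2.le z)]
      rw [this, (g i).2.2 z w hzw]
    · show k.1 z = ⨆ i, (g i).1 z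
      have e : k.1 z = (⨆ i, a i) ⊓ k.1 z := by rw [h.1, top_inf_eq]
      rw [e, iSup_inf_eq]
      exact iSup_congr fun i => congrFun (congrArg Subtype.val (hk i)) z

theorem gen_restr {E : Type} [Nonempty E] {a b : A} (h : a ≤ b) (g : (gen A E).carrier b) (z : E) :
    ((gen A E).restr h g).1 z = a ⊓ g.1 z := by
  obtain ⟨k, rfl⟩ := (gen A E).surjective b g
  rw [CondSet.restr_res]
  show a ⊓ k.1 z = a ⊓ (b ⊓ k.1 z)
  rw [← inf_assoc, inf_eq_left.2 h]

/-- The amalgamation `∑ aᵢ xᵢ` of elements of `E` along a partition `(aᵢ)` of `a`. -/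
noncomputable def genMk {E : Type} [Nonempty E] {ι : Type*} {c : A} (a : ι → A) (h : IsPart a c)
    (x : ι → E) : (gen A E).carrier c :=
  ⟨fun z => ⨆ (i) (_ : x i = z), a i, by
    refine ⟨?_, fun z w hzw => ?_⟩
    · rw [iSup_comm, ← h.1]
      exact iSup_congr fun i => by simp
    · simp only [iSup_inf_eq, inf_iSup_eq, iSup_eq_bot]
      rintro i rfl j rfl
      exact h.2 _ _ fun e => hzw (by rw [e])⟩

theorem exists_eq_genMk {E : Type} [Nonempty E] {c : A} (g : (gen A E).carrier c) :
    ∃ (a : E → A) (h : IsPart a c), g = genMk a h id :=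
  ⟨g.1, g.2, Subtype.ext (funext fun z => by simp [genMk])⟩

/-- The conditional element `az` for `z ∈ E`. -/
noncomputable def genConst {E : Type} [Nonempty E] (a : A) (z : E) : (gen A E).carrier a :=
  genMk _ (isPart_single a) fun _ => z

/-- The conditional function generated by a classical function `E → F`: `∑ aᵢ xᵢ ↦ ∑ aᵢ f(xᵢ)`. -/
noncomputable def genMap {E F : Type} [Nonempty E] [Nonempty F] (f : E → F) {a : A}
    (g : (gen A E).carrier a) : (gen A F).carrier a :=
  genMk g.1 g.2 f

/-- The conditional function generated by a classical function `E × F → G`: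
`(∑ aᵢ xᵢ, ∑ bⱼ yⱼ) ↦ ∑ (aᵢ ∧ bⱼ) f(xᵢ, yⱼ)`. -/
noncomputable def genMap₂ {E F G : Type} [Nonempty E] [Nonempty F] [Nonempty G] (f : E → F → G)
    {a : A} (g : (gen A E).carrier a) (h : (gen A F).carrier a) : (gen A G).carrier a :=
  genMk (fun p : E × F => g.1 p.1 ⊓ h.1 p.2)
    (by
      refine ⟨?_, fun p q hpq => ?_⟩
      · rw [iSup_prod]
        simp only [← inf_iSup_eq, ← iSup_inf_eq, g.2.1, h.2.1, inf_idem]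
      · by_cases h1 : p.1 = q.1
        · have h2 : p.2 ≠ q.2 := fun e => hpq (Prod.ext h1 e)
          rw [inf_inf_inf_comm, h.2.2 _ _ h2, inf_bot_eq]
        · rw [inf_inf_inf_comm, g.2.2 _ _ h1, bot_inf_eq])
    fun p => f p.1 p.2

theorem genMk_restr {E : Type} [Nonempty E] {ι : Type*} {b c : A} (a : ι → A) (h : IsPart a c)
    (x : ι → E) (hb : b ≤ c) :
    (gen A E).restr hb (genMk a h x) = genMk (fun i => b ⊓ a i) (h.inf hb) x :=
  Subtype.ext (funext fun z => by
    rw [gen_restr]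
    simp only [genMk, inf_iSup_eq])

theorem genConst_restr {E : Type} [Nonempty E] {a b : A} (h : a ≤ b) (z : E) :
    (gen A E).restr h (genConst b z) = genConst a z :=
  Subtype.ext (funext fun w => by
    rw [gen_restr]
    simp only [genConst, genMk, inf_iSup_eq, inf_eq_left.2 h])

theorem natural_genMap₂ {E F G : Type} [Nonempty E] [Nonempty F] [Nonempty G] (f : E → F → G) :
    Natural (X := (gen A E).prod (gen A F)) (Y := gen A G) fun _ p => genMap₂ f p.1 p.2 := by
  refine ⟨fun {a b} hab p => ?_⟩
  refine (congrArg (fun q : (gen A E).carrier a × (gen A F).carrier a => genMap₂ f q.1 q.2)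
    (CondSet.prod_restr _ _ hab p)).trans (Subtype.ext (funext fun z => ?_))
  rw [gen_restr]
  simp only [genMap₂, genMk, gen_restr, inf_iSup_eq]
  refine iSup_congr fun q => iSup_congr fun _ => ?_
  rw [inf_inf_inf_comm, inf_idem]

theorem natural_genMap {E F : Type} [Nonempty E] [Nonempty F] (f : E → F) :
    Natural (X := gen A E) (Y := gen A F) fun _ g => genMap f g := by
  refine ⟨fun {a b} hab g => ?_⟩
  refine Subtype.ext (funext fun z => ?_)
  rw [gen_restr]
  simp only [genMap, genMk, gen_restr, inf_iSup_eq]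

/-- The conditional relation generated by a classical reflexive relation: `∑ aᵢ xᵢ` and `∑ bⱼ yⱼ`
are related iff `xᵢ` and `yⱼ` are related whenever `aᵢ ∧ bⱼ ≠ 0`. -/
noncomputable def genRel {E : Type} [Nonempty E] (r : E → E → Prop) (hr : ∀ x, r x x) :
    CondRel (gen A E) where
  rel a g h := ∀ x y, g.1 x ⊓ h.1 y ≠ ⊥ → r x y
  isLocal := by
    refine isLocal_prod (P := fun a (g h : (gen A E).carrier a) => ∀ x y, g.1 x ⊓ h.1 y ≠ ⊥ → r x y)
      (fun {a b} hab g h hgh x y hxy => hgh x y fun e => hxy ?_)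
      (fun {ι a c} ha g h hgh x y hxy => ?_)
    · rw [gen_restr, gen_restr, inf_inf_inf_comm, e, inf_bot_eq]
    · by_contra hn
      refine hxy ?_
      have e : g.1 x ⊓ h.1 y = (⨆ i, a i) ⊓ (g.1 x ⊓ h.1 y) := by
        rw [ha.1]; exact (inf_eq_right.2 (inf_le_left.trans (g.2.le x))).symm
      rw [e, iSup_inf_eq]
      simp only [iSup_eq_bot]
      intro i
      by_contra hne
      refine hn (hgh i x y ?_)
      rwa [gen_restr, gen_restr, inf_inf_inf_comm, inf_idem]
  nonempty := by
    refine ⟨genConst ⊤ (Classical.arbitrary E), genConst ⊤ (Classical.arbitrary E),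
      fun x y hxy => ?_⟩
    have : x = y := by
      by_contra hne
      exact hxy ((genConst ⊤ (Classical.arbitrary E)).2.2 x y hne)
    rw [this]
    exact hr y

/-- The conditional natural numbers. -/
noncomputable abbrev condNat (A : Type u) [CompleteBooleanAlgebra A] : CondSet A := gen A ℕ

/-- The conditional rational numbers. -/
noncomputable abbrev condRat (A : Type u) [CompleteBooleanAlgebra A] : CondSet A := gen A ℚ

/-- The conditional order of the conditional natural numbers. -/
noncomputable def natLE (A : Type u) [CompleteBooleanAlgebra A] : CondRel (condNat A) :=
  genRel (fun m n => m ≤ n) le_refl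

/-- The conditional order of the conditional rational numbers. -/
noncomputable def ratLE (A : Type u) [CompleteBooleanAlgebra A] : CondRel (condRat A) :=
  genRel (fun p q => p ≤ q) le_refl

/-- The conditional distance `|p - q|` of conditional rational numbers. -/
noncomputable def ratDist {a : A} (p q : (condRat A).carrier a) : (condRat A).carrier a :=
  genMap₂ (fun x y => |x - y|) p q

/-- Conditional sequences of rational numbers, i.e. conditional functions `𝐍 → 𝐐`. -/
noncomputable abbrev ratSeq (A : Type u) [CompleteBooleanAlgebra A] : CondSet A :=
  funSpace (condNat A) (condRat A)

/-- A conditional sequence `(qₙ)` on `a` is conditionally Cauchy: for every `ε > 0` in `𝐐` there is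
`n₀ ∈ 𝐍` such that `|qₘ - qₙ| < ε` for all `m, n ≥ n₀`. -/
def IsCauchySeq (a : A) (q : (ratSeq A).carrier a) : Prop :=
  ∀ ε : (condRat A).carrier a, (ratLE A).lt a (genConst a 0) ε →
    ∃ n₀ : (condNat A).carrier a, ∀ m n : (condNat A).carrier a,
      (natLE A).rel a n₀ m → (natLE A).rel a n₀ n →
        (ratLE A).lt a (ratDist (CondFun.eval q m) (CondFun.eval q n)) ε

/-- `(qₙ) ∼ (pₙ)` iff `qₙ - pₙ → 0`. -/
def IsNullDiff (a : A) (q p : (ratSeq A).carrier a) : Prop :=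
  ∀ ε : (condRat A).carrier a, (ratLE A).lt a (genConst a 0) ε →
    ∃ n₀ : (condNat A).carrier a, ∀ n : (condNat A).carrier a, (natLE A).rel a n₀ n →
      (ratLE A).lt a (ratDist (CondFun.eval q n) (CondFun.eval p n)) ε

/-- The relation defining `[(pₙ)] ≤ [(qₙ)]`: for every `ε > 0` in `𝐐` there is `n₀ ∈ 𝐍` such that
`qₙ - pₙ > -ε` for all `n ≥ n₀`. -/
def IsSeqLE (a : A) (p q : (ratSeq A).carrier a) : Prop :=
  ∀ ε : (condRat A).carrier a, (ratLE A).lt a (genConst a 0) ε →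
    ∃ n₀ : (condNat A).carrier a, ∀ n : (condNat A).carrier a, (natLE A).rel a n₀ n →
      (ratLE A).lt a (genMap (fun x => -x) ε)
        (genMap₂ (fun x y => x - y) (CondFun.eval q n) (CondFun.eval p n))

section GenValues

variable {E F G : Type} [Nonempty E] [Nonempty F] [Nonempty G]

theorem gen_exists_val {a b : A} (g : (gen A E).carrier a) (hba : b ≤ a) (hb : b ≠ ⊥) :
    ∃ c x, c ≤ b ∧ c ≠ ⊥ ∧ c ≤ g.1 x := by
  by_contra! h
  refine hb ?_
  rw [← inf_eq_left.2 hba, ← g.2.1, inf_iSup_eq]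
  simp only [iSup_eq_bot]
  intro x
  by_contra hne
  exact h _ x inf_le_left hne inf_le_right

theorem gen_val_unique {a b : A} (g : (gen A E).carrier a) (hb : b ≠ ⊥) {x y : E} (hx : b ≤ g.1 x)
    (hy : b ≤ g.1 y) : x = y := by
  by_contra hne
  exact hb (le_bot_iff.1 ((le_inf hx hy).trans (g.2.2 x y hne).le))

theorem gen_val_const {a b : A} (h : b ≤ a) (z : E) : b ≤ (genConst a z : (gen A E).carrier a).1 z :=
  h.trans (le_iSup₂_of_le (⟨⟩ : PUnit) rfl le_rfl)

theorem gen_val_map (f : E → F) {a b : A} {g : (gen A E).carrier a} {x : E} (hx : b ≤ g.1 x) :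
    b ≤ (genMap f g).1 (f x) :=
  hx.trans (le_iSup₂_of_le x rfl le_rfl)

theorem gen_val_map₂ (f : E → F → G) {a b : A} {g : (gen A E).carrier a} {h : (gen A F).carrier a}
    {x : E} {y : F} (hx : b ≤ g.1 x) (hy : b ≤ h.1 y) : b ≤ (genMap₂ f g h).1 (f x y) :=
  (le_inf hx hy).trans
    (le_iSup₂_of_le (f := fun (p : E × F) (_ : f p.1 p.2 = f x y) => g.1 p.1 ⊓ h.1 p.2)
      (x, y) rfl le_rfl)

theorem genRel_iff (r : E → E → Prop) (hr : ∀ x, r x x) {a : A} (g h : (gen A E).carrier a) :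
    (genRel r hr).rel a g h ↔ ∀ b x y, b ≠ ⊥ → b ≤ g.1 x → b ≤ h.1 y → r x y :=
  ⟨fun H _ x y hb hx hy => H x y fun e => hb (le_bot_iff.1 (e ▸ le_inf hx hy)),
    fun H x y hxy => H _ x y hxy inf_le_left inf_le_right⟩

theorem genRel_lt_iff (r : E → E → Prop) (hr : ∀ x, r x x) {a : A} (g h : (gen A E).carrier a) :
    (genRel r hr).lt a g h ↔ ∀ b x y, b ≠ ⊥ → b ≤ g.1 x → b ≤ h.1 y → r x y ∧ x ≠ y := by
  have hc : ∀ (k : (gen A E).carrier a) {b : A} (hba : b ≤ a) {x : E}, b ≤ k.1 x →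
      (gen A E).restr hba k = genConst b x := by
    intro k b hba x hx
    refine Subtype.ext (funext fun z => ?_)
    rw [gen_restr]
    by_cases hz : x = z
    · subst hz
      exact le_antisymm (inf_le_left.trans (gen_val_const le_rfl x)) (le_inf
        ((genConst b x : (gen A E).carrier b).2.le x)
        (((genConst b x : (gen A E).carrier b).2.le x).trans hx))
    · have h1 : b ⊓ k.1 z = ⊥ :=
        le_bot_iff.1 ((inf_le_inf_right _ hx).trans (k.2.2 x z hz).le)
      rw [h1]
      simp [genConst, genMk, hz]
  constructor
  · intro H b x y hb hx hy
    refine ⟨(genRel_iff r hr g h).1 H.1 b x y hb hx hy, ?_⟩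
    rintro rfl
    have hba : b ≤ a := hx.trans (g.2.le x)
    exact hb (H.2 b hba ((hc g hba hx).trans (hc h hba hy).symm))
  · intro H
    refine ⟨(genRel_iff r hr g h).2 fun b x y hb hx hy => (H b x y hb hx hy).1, fun b hba e => ?_⟩
    by_contra hb
    obtain ⟨c, x, hcb, hc0, hcx⟩ := gen_exists_val g hba hb
    have e' : b ⊓ g.1 x = b ⊓ h.1 x := by rw [← gen_restr hba, ← gen_restr hba, e]
    have : c ≤ h.1 x := (le_inf hcb hcx).trans (e'.le.trans inf_le_right)
    exact (H c x x hc0 hcx this).2 rfl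

end GenValues

theorem ratLT_iff {a : A} (g h : (condRat A).carrier a) :
    (ratLE A).lt a g h ↔ ∀ b x y, b ≠ ⊥ → b ≤ g.1 x → b ≤ h.1 y → x < y := by
  unfold ratLE
  rw [genRel_lt_iff]
  exact ⟨fun H b x y hb hx hy => lt_of_le_of_ne (H b x y hb hx hy).1 (H b x y hb hx hy).2,
    fun H b x y hb hx hy => ⟨(H b x y hb hx hy).le, (H b x y hb hx hy).ne⟩⟩

theorem natLE_iff {a : A} (g h : (condNat A).carrier a) :
    (natLE A).rel a g h ↔ ∀ b x y, b ≠ ⊥ → b ≤ g.1 x → b ≤ h.1 y → x ≤ y :=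
  genRel_iff _ _ g h

theorem natLE_refl {a : A} (g : (condNat A).carrier a) : (natLE A).rel a g g :=
  (natLE_iff g g).2 fun _ _ _ hb hx hy => (gen_val_unique g hb hx hy).le

theorem natLE_max {a : A} {m n k : (condNat A).carrier a}
    (h : (natLE A).rel a (genMap₂ max m n) k) : (natLE A).rel a m k ∧ (natLE A).rel a n k := by
  rw [natLE_iff] at h
  constructor <;> rw [natLE_iff] <;> intro b x y hb hx hy
  · obtain ⟨c, z, hcb, hc, hz⟩ := gen_exists_val n (hx.trans (m.2.le x)) hb
    exact (le_max_left x z).trans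
      (h c _ y hc (gen_val_map₂ max (hcb.trans hx) hz) (hcb.trans hy))
  · obtain ⟨c, z, hcb, hc, hz⟩ := gen_exists_val m (hx.trans (n.2.le x)) hb
    exact (le_max_right z x).trans
      (h c _ y hc (gen_val_map₂ max hz (hcb.trans hx)) (hcb.trans hy))

theorem ratLT_one {a : A} : (ratLE A).lt a (genConst a 0) (genConst a 1) := by
  rw [ratLT_iff]
  intro b x y hb hx hy
  have hba : b ≤ a := hx.trans ((genConst a 0 : (condRat A).carrier a).2.le x)
  rw [gen_val_unique _ hb hx (gen_val_const hba 0), gen_val_unique _ hb hy (gen_val_const hba 1)]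
  exact one_pos

theorem ratLT_zero_iff {a : A} (ε : (condRat A).carrier a) :
    (ratLE A).lt a (genConst a 0) ε ↔ ∀ b x, b ≠ ⊥ → b ≤ ε.1 x → 0 < x := by
  rw [ratLT_iff]
  constructor
  · intro H b x hb hx
    exact H b 0 x hb (gen_val_const (hx.trans (ε.2.le x)) 0) hx
  · intro H b x y hb hx hy
    rw [gen_val_unique _ hb hx (gen_val_const (hy.trans (ε.2.le y)) 0)]
    exact H b y hb hy

theorem isLocal_pos : IsLocal (condRat A) fun a ε => (ratLE A).lt a (genConst a 0) ε :=
  (ratLE A).isLocal_lt.comp (X := condRat A) (f := fun a ε => (genConst a 0, ε))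
    (Natural.pair (X := condRat A) (Y := condRat A) (Z := condRat A)
      ⟨fun h _ => (genConst_restr h 0).symm⟩ natural_id)

theorem isLocal_isCauchySeq : IsLocal (ratSeq A) IsCauchySeq := by
  let M := ratSeq A
  let Q := condRat A
  let N := condNat A
  let Z := ((M.prod Q).prod N).prod (N.prod N)
  have p1 : Natural (X := Z) (Y := (M.prod Q).prod N) fun _ p => p.1 := natural_fst
  have p11 : Natural (X := Z) (Y := M.prod Q) fun _ p => p.1.1 := natural_fst.comp p1
  have pq : Natural (X := Z) (Y := M) fun _ p => p.1.1.1 := natural_fst.comp p11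
  have pe : Natural (X := Z) (Y := Q) fun _ p => p.1.1.2 := natural_snd.comp p11
  have pn0 : Natural (X := Z) (Y := N) fun _ p => p.1.2 := natural_snd.comp p1
  have p2 : Natural (X := Z) (Y := N.prod N) fun _ p => p.2 := natural_snd
  have pm : Natural (X := Z) (Y := N) fun _ p => p.2.1 := natural_fst.comp p2
  have pn : Natural (X := Z) (Y := N) fun _ p => p.2.2 := natural_snd.comp p2
  have hT : IsLocal Z fun a p => (ratLE A).lt a
      (ratDist (CondFun.eval p.1.1.1 p.2.1) (CondFun.eval p.1.1.1 p.2.2)) p.1.1.2 :=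
    (ratLE A).isLocal_lt.comp (((natural_genMap₂ fun x y : ℚ => |x - y|).comp
      ((natural_eval.comp (pq.pair pm)).pair (natural_eval.comp (pq.pair pn)))).pair pe)
  have hP : IsLocal Z fun a p => (natLE A).rel a p.1.2 p.2.1 ∧ (natLE A).rel a p.1.2 p.2.2 :=
    ((natLE A).isLocal.comp (pn0.pair pm)).and ((natLE A).isLocal.comp (pn0.pair pn))
  have h1 := IsLocal.all (X := (M.prod Q).prod N) (Y := N.prod N)
    (P := fun a p y => (natLE A).rel a p.2 y.1 ∧ (natLE A).rel a p.2 y.2)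
    (Q := fun a p y => (ratLE A).lt a
      (ratDist (CondFun.eval p.1.1 y.1) (CondFun.eval p.1.1 y.2)) p.1.2) hP hT
  have h2 := IsLocal.ex (X := M.prod Q) (Y := N) (P := fun a p n₀ =>
    (∃ y : N.carrier a × N.carrier a, (natLE A).rel a n₀ y.1 ∧ (natLE A).rel a n₀ y.2) ∧
    ∀ y : N.carrier a × N.carrier a, (natLE A).rel a n₀ y.1 ∧ (natLE A).rel a n₀ y.2 →
      (ratLE A).lt a (ratDist (CondFun.eval p.1 y.1) (CondFun.eval p.1 y.2)) p.2) h1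
  have h3 := IsLocal.all (X := M) (Y := Q) (P := fun a _ ε => (ratLE A).lt a (genConst a 0) ε)
    (Q := fun a q ε => ∃ n₀,
      (∃ y : N.carrier a × N.carrier a, (natLE A).rel a n₀ y.1 ∧ (natLE A).rel a n₀ y.2) ∧
      ∀ y : N.carrier a × N.carrier a, (natLE A).rel a n₀ y.1 ∧ (natLE A).rel a n₀ y.2 →
        (ratLE A).lt a (ratDist (CondFun.eval q y.1) (CondFun.eval q y.2)) ε)
    (isLocal_pos.comp (X := M.prod Q) natural_snd) h2
  refine h3.congr fun a q => ⟨fun H => ⟨⟨_, ratLT_one⟩, fun ε hε => ?_⟩, fun H ε hε => ?_⟩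
  · obtain ⟨n₀, hn⟩ := H ε hε
    exact ⟨n₀, ⟨(n₀, n₀), natLE_refl n₀, natLE_refl n₀⟩, fun y hy => hn y.1 y.2 hy.1 hy.2⟩
  · obtain ⟨n₀, -, hn⟩ := H.2 ε hε
    exact ⟨n₀, fun m n hm hn' => hn (m, n) ⟨hm, hn'⟩⟩

/-- Locality of relations of the form `∀ ε > 0, ∃ n₀, ∀ n ≥ n₀, D qₙ pₙ ε`. -/
theorem isLocal_eventually
    (D : ∀ a, (condRat A).carrier a → (condRat A).carrier a → (condRat A).carrier a → Prop)
    (hD : IsLocal (((condRat A).prod (condRat A)).prod (condRat A))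
      fun a p => D a p.1.1 p.1.2 p.2) :
    IsLocal ((ratSeq A).prod (ratSeq A)) fun a s =>
      ∀ ε : (condRat A).carrier a, (ratLE A).lt a (genConst a 0) ε →
        ∃ n₀ : (condNat A).carrier a, ∀ n : (condNat A).carrier a, (natLE A).rel a n₀ n →
          D a (CondFun.eval s.1 n) (CondFun.eval s.2 n) ε := by
  let M := (ratSeq A).prod (ratSeq A)
  let Q := condRat A
  let N := condNat A
  let Z := ((M.prod Q).prod N).prod N
  have p1 : Natural (X := Z) (Y := (M.prod Q).prod N) fun _ p => p.1 := natural_fst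
  have p11 : Natural (X := Z) (Y := M.prod Q) fun _ p => p.1.1 := natural_fst.comp p1
  have pM : Natural (X := Z) (Y := M) fun _ p => p.1.1.1 := natural_fst.comp p11
  have pq : Natural (X := Z) (Y := ratSeq A) fun _ p => p.1.1.1.1 := natural_fst.comp pM
  have pp : Natural (X := Z) (Y := ratSeq A) fun _ p => p.1.1.1.2 := natural_snd.comp pM
  have pe : Natural (X := Z) (Y := Q) fun _ p => p.1.1.2 := natural_snd.comp p11
  have pn0 : Natural (X := Z) (Y := N) fun _ p => p.1.2 := natural_snd.comp p1
  have pn : Natural (X := Z) (Y := N) fun _ p => p.2 := natural_snd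
  have hT : IsLocal Z fun a p => D a (CondFun.eval p.1.1.1.1 p.2) (CondFun.eval p.1.1.1.2 p.2)
      p.1.1.2 :=
    hD.comp (((natural_eval.comp (pq.pair pn)).pair (natural_eval.comp (pp.pair pn))).pair pe)
  have hP : IsLocal Z fun a p => (natLE A).rel a p.1.2 p.2 := (natLE A).isLocal.comp (pn0.pair pn)
  have h1 := IsLocal.all (X := (M.prod Q).prod N) (Y := N)
    (P := fun a p y => (natLE A).rel a p.2 y)
    (Q := fun a p y => D a (CondFun.eval p.1.1.1 y) (CondFun.eval p.1.1.2 y) p.1.2) hP hT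
  have h2 := IsLocal.ex (X := M.prod Q) (Y := N) (P := fun a p n₀ =>
    (∃ y : N.carrier a, (natLE A).rel a n₀ y) ∧ ∀ y : N.carrier a, (natLE A).rel a n₀ y →
      D a (CondFun.eval p.1.1 y) (CondFun.eval p.1.2 y) p.2) h1
  have h3 := IsLocal.all (X := M) (Y := Q) (P := fun a _ ε => (ratLE A).lt a (genConst a 0) ε)
    (Q := fun a s ε => ∃ n₀,
      (∃ y : N.carrier a, (natLE A).rel a n₀ y) ∧ ∀ y : N.carrier a, (natLE A).rel a n₀ y →
        D a (CondFun.eval s.1 y) (CondFun.eval s.2 y) ε)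
    (isLocal_pos.comp (X := M.prod Q) natural_snd) h2
  refine h3.congr fun a q => ⟨fun H => ⟨⟨_, ratLT_one⟩, fun ε hε => ?_⟩, fun H ε hε => ?_⟩
  · obtain ⟨n₀, hn⟩ := H ε hε
    exact ⟨n₀, ⟨n₀, natLE_refl n₀⟩, hn⟩
  · obtain ⟨n₀, -, hn⟩ := H.2 ε hε
    exact ⟨n₀, hn⟩

theorem isLocal_isNullDiff : IsLocal ((ratSeq A).prod (ratSeq A)) fun a s => IsNullDiff a s.1 s.2 :=
  isLocal_eventually (fun a x y ε => (ratLE A).lt a (ratDist x y) ε)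
    ((ratLE A).isLocal_lt.comp
      (((natural_genMap₂ fun x y : ℚ => |x - y|).comp natural_fst).pair natural_snd))

theorem isLocal_isSeqLE : IsLocal ((ratSeq A).prod (ratSeq A)) fun a s => IsSeqLE a s.1 s.2 :=
  isLocal_eventually
    (fun a x y ε => (ratLE A).lt a (genMap (fun x => -x) ε) (genMap₂ (fun x y => x - y) y x))
    ((ratLE A).isLocal_lt.comp
      (((natural_genMap fun x : ℚ => -x).comp natural_snd).pair
        ((natural_genMap₂ fun x y : ℚ => x - y).comp
          ((natural_snd.comp natural_fst).pair (natural_fst.comp natural_fst)))))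

/-- The constant conditional sequence with value `z`. -/
noncomputable def constSeq (A : Type u) [CompleteBooleanAlgebra A] (z : ℚ) :
    CondFun (condNat A) (condRat A) ⊤ :=
  ⟨fun b _ _ => genConst b z, fun h _ _ => (genConst_restr h z).symm⟩

theorem isCauchySeq_const (a : A) (z : ℚ) :
    IsCauchySeq a ((ratSeq A).restr le_top (constSeq A z)) := by
  refine isLocal_isCauchySeq.restr le_top _ fun ε hε => ⟨genConst ⊤ 0, fun m n _ _ => ?_⟩
  rw [ratLT_zero_iff] at hε
  rw [ratLT_iff]
  intro b x y hb hx hy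
  have h1 : b ≤ (ratDist (CondFun.eval (constSeq A z) m) (CondFun.eval (constSeq A z) n)).1
      |z - z| := gen_val_map₂ (fun x y : ℚ => |x - y|) (gen_val_const le_top z)
        (gen_val_const le_top z)
  rw [gen_val_unique _ hb hx h1]
  simpa using hε b y hb hy

/-- The conditional set `𝒞` of conditional Cauchy sequences, as a conditional subset of the
conditional sequences. -/
noncomputable def cauchySubset (A : Type u) [CompleteBooleanAlgebra A] : CondSubset (ratSeq A) :=
  CondSubset.ofLocal IsCauchySeq isLocal_isCauchySeq ⟨_, isCauchySeq_const ⊥ 0⟩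

theorem cauchySubset_on : (cauchySubset A).on = ⊤ :=
  top_le_iff.1 (((cauchySubset A).nonempty_iff ⊤).1 ⟨_, isCauchySeq_const ⊤ 0⟩)

/-- The conditional set `𝒞` of conditional Cauchy sequences. -/
noncomputable def cauchySet (A : Type u) [CompleteBooleanAlgebra A] : CondSet A :=
  (cauchySubset A).toCondSet cauchySubset_on

theorem ratDist_self_lt {a : A} (x ε : (condRat A).carrier a)
    (hε : (ratLE A).lt a (genConst a 0) ε) : (ratLE A).lt a (ratDist x x) ε := by
  rw [ratLT_zero_iff] at hε
  rw [ratLT_iff]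
  intro b u v hb hu hv
  obtain ⟨c, z, hcb, hc, hz⟩ := gen_exists_val x (hv.trans (ε.2.le v)) hb
  rw [gen_val_unique _ hc (hcb.trans hu) (gen_val_map₂ (fun x y : ℚ => |x - y|) hz hz)]
  simpa using hε b v hb hv

theorem ratDist_comm {a : A} {x y ε : (condRat A).carrier a}
    (h : (ratLE A).lt a (ratDist x y) ε) : (ratLE A).lt a (ratDist y x) ε := by
  rw [ratLT_iff] at h ⊢
  intro b u v hb hu hv
  have hba := hv.trans (ε.2.le v)
  obtain ⟨c, z, hcb, hc, hz⟩ := gen_exists_val x hba hb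
  obtain ⟨d, w, hdc, hd, hw⟩ := gen_exists_val y ((hcb.trans hba)) hc
  have hz' := hdc.trans hz
  have hdb := hdc.trans hcb
  rw [gen_val_unique _ hd (hdb.trans hu) (gen_val_map₂ (fun x y : ℚ => |x - y|) hw hz'), abs_sub_comm]
  exact h d _ v hd (gen_val_map₂ (fun x y : ℚ => |x - y|) hz' hw) (hdb.trans hv)

theorem ratHalf_pos {a : A} {ε : (condRat A).carrier a} (hε : (ratLE A).lt a (genConst a 0) ε)
    {k : ℚ} (hk : 0 < k) : (ratLE A).lt a (genConst a 0) (genMap (fun x => x / k) ε) := by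
  rw [ratLT_zero_iff] at hε ⊢
  intro b x hb hx
  obtain ⟨c, z, hcb, hc, hz⟩ := gen_exists_val ε (hx.trans ((genMap _ ε).2.le x)) hb
  rw [gen_val_unique _ hc (hcb.trans hx) (gen_val_map (fun x : ℚ => x / k) hz)]
  exact div_pos (hε c z hc hz) hk

theorem ratDist_triangle {a : A} {x y z ε : (condRat A).carrier a}
    (h1 : (ratLE A).lt a (ratDist x y) (genMap (fun x => x / 2) ε))
    (h2 : (ratLE A).lt a (ratDist y z) (genMap (fun x => x / 2) ε)) :
    (ratLE A).lt a (ratDist x z) ε := by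
  rw [ratLT_iff] at h1 h2 ⊢
  intro b u v hb hu hv
  have hba := hv.trans (ε.2.le v)
  obtain ⟨c, xv, hcb, hc, hx⟩ := gen_exists_val x hba hb
  obtain ⟨d, yv, hdc, hd, hy⟩ := gen_exists_val y (hcb.trans hba) hc
  obtain ⟨e, zv, hed, he, hz⟩ := gen_exists_val z (hdc.trans (hcb.trans hba)) hd
  have heb := hed.trans (hdc.trans hcb)
  have hx := hed.trans (hdc.trans hx)
  have hy := hed.trans hy
  rw [gen_val_unique _ he (heb.trans hu) (gen_val_map₂ (fun x y : ℚ => |x - y|) hx hz)]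
  have e1 := h1 e _ _ he (gen_val_map₂ (fun x y : ℚ => |x - y|) hx hy)
    (gen_val_map (fun x : ℚ => x / 2) (heb.trans hv))
  have e2 := h2 e _ _ he (gen_val_map₂ (fun x y : ℚ => |x - y|) hy hz)
    (gen_val_map (fun x : ℚ => x / 2) (heb.trans hv))
  have := abs_sub_le xv yv zv
  linarith

/-- The conditional equivalence relation `∼` on `𝒞`. -/
noncomputable def nullRel (A : Type u) [CompleteBooleanAlgebra A] : CondRel (cauchySet A) where
  rel a q p := IsNullDiff a q.1 p.1
  isLocal :=
    have h := (cauchySubset A).natural_val cauchySubset_on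
    IsLocal.comp (X := (cauchySet A).prod (cauchySet A)) isLocal_isNullDiff
      ((h.comp natural_fst).pair (h.comp natural_snd))
  nonempty := ⟨⟨_, isCauchySeq_const ⊤ 0⟩, ⟨_, isCauchySeq_const ⊤ 0⟩,
    fun ε hε => ⟨genConst ⊤ 0, fun _ _ => ratDist_self_lt _ ε hε⟩⟩

theorem nullRel_equivalence (a : A) : Equivalence ((nullRel A).rel a) where
  refl q ε hε := ⟨genConst a 0, fun _ _ => ratDist_self_lt _ ε hε⟩
  symm {q p} h ε hε := by
    obtain ⟨n₀, hn⟩ := h ε hε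
    exact ⟨n₀, fun n hnn => ratDist_comm (hn n hnn)⟩
  trans {q p r} h h' ε hε := by
    obtain ⟨n₀, hn⟩ := h _ (ratHalf_pos hε two_pos)
    obtain ⟨m₀, hm⟩ := h' _ (ratHalf_pos hε two_pos)
    refine ⟨genMap₂ max n₀ m₀, fun n hnn => ?_⟩
    exact ratDist_triangle (hn n (natLE_max hnn).1) (hm n (natLE_max hnn).2)

/-- A modulus of continuity, on bounded sets, of an operation on the rational numbers. -/
structure HasModulus (f : ℚ → ℚ → ℚ) (δ : ℚ → ℚ → ℚ) : Prop where
  pos : ∀ W ε, 0 < ε → 0 < δ W ε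
  bound : ∀ W ε x x' y y', 0 < ε → |x| < W → |y'| < W →
    |x - x'| < δ W ε → |y - y'| < δ W ε → |f x y - f x' y'| < ε

theorem hasModulus_add : HasModulus (fun x y => x + y) fun _ ε => ε / 2 where
  pos _ _ h := half_pos h
  bound W ε x x' y y' _ _ _ h1 h2 := by
    have := abs_add_le (x - x') (y - y')
    have e : x + y - (x' + y') = (x - x') + (y - y') := by ring
    rw [e]
    linarith

theorem hasModulus_mul : HasModulus (fun x y => x * y) fun W ε => ε / (2 * (|W| + 1)) where
  pos W _ h := div_pos h (by positivity)
  bound W ε x x' y y' hε hx hy h1 h2 := by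
    have hW : 0 < 2 * (|W| + 1) := by positivity
    have e : x * y - x' * y' = x * (y - y') + (x - x') * y' := by ring
    rw [lt_div_iff₀ hW] at h1 h2
    have hWW := le_abs_self W
    have a1 : |x| * |y - y'| ≤ (|W| + 1) * |y - y'| :=
      mul_le_mul_of_nonneg_right (by linarith) (abs_nonneg _)
    have a2 : |x - x'| * |y'| ≤ |x - x'| * (|W| + 1) :=
      mul_le_mul_of_nonneg_left (by linarith) (abs_nonneg _)
    rw [e]
    refine (abs_add_le _ _).trans_lt ?_
    rw [abs_mul, abs_mul]
    linarith

theorem HasModulus.lt {f δ : ℚ → ℚ → ℚ} (hf : HasModulus f δ) {a : A}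
    {s s' t t' W ε : (condRat A).carrier a} (hε : (ratLE A).lt a (genConst a 0) ε)
    (hs : (ratLE A).lt a (genMap (fun x => |x|) s) W)
    (ht : (ratLE A).lt a (genMap (fun x => |x|) t') W)
    (hs' : (ratLE A).lt a (ratDist s s') (genMap₂ δ W ε))
    (ht' : (ratLE A).lt a (ratDist t t') (genMap₂ δ W ε)) :
    (ratLE A).lt a (ratDist (genMap₂ f s t) (genMap₂ f s' t')) ε := by
  rw [ratLT_zero_iff] at hε
  rw [ratLT_iff] at hs ht hs' ht' ⊢
  intro b u v hb hu hv
  have hba := hv.trans (ε.2.le v)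
  obtain ⟨c1, x, h1b, h1, hx⟩ := gen_exists_val s hba hb
  obtain ⟨c2, x', h21, h2, hx'⟩ := gen_exists_val s' (h1b.trans hba) h1
  have h2b := h21.trans h1b
  obtain ⟨c3, y, h32, h3, hy⟩ := gen_exists_val t (h2b.trans hba) h2
  have h3b := h32.trans h2b
  obtain ⟨c4, y', h43, h4, hy'⟩ := gen_exists_val t' (h3b.trans hba) h3
  have h4b := h43.trans h3b
  obtain ⟨c, w, hc4, hc, hw⟩ := gen_exists_val W (h4b.trans hba) h4
  have hv := (hc4.trans h4b).trans hv
  have hu := (hc4.trans h4b).trans hu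
  have hy' := hc4.trans hy'
  have hy := hc4.trans (h43.trans hy)
  have hx' := hc4.trans (h43.trans (h32.trans hx'))
  have hx := hc4.trans (h43.trans (h32.trans (h21.trans hx)))
  rw [gen_val_unique _ hc hu (gen_val_map₂ (fun x y : ℚ => |x - y|) (gen_val_map₂ f hx hy)
    (gen_val_map₂ f hx' hy'))]
  exact hf.bound w v x x' y y' (hε c v hc hv)
    (hs c _ _ hc (gen_val_map (fun x : ℚ => |x|) hx) hw)
    (ht c _ _ hc (gen_val_map (fun x : ℚ => |x|) hy') hw)
    (hs' c _ _ hc (gen_val_map₂ (fun x y : ℚ => |x - y|) hx hx') (gen_val_map₂ δ hw hv))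
    (ht' c _ _ hc (gen_val_map₂ (fun x y : ℚ => |x - y|) hy hy') (gen_val_map₂ δ hw hv))

theorem HasModulus.pos' {f δ : ℚ → ℚ → ℚ} (hf : HasModulus f δ) {a : A}
    {W ε : (condRat A).carrier a} (hε : (ratLE A).lt a (genConst a 0) ε) :
    (ratLE A).lt a (genConst a 0) (genMap₂ δ W ε) := by
  rw [ratLT_zero_iff] at hε ⊢
  intro b x hb hx
  have hba := hx.trans ((genMap₂ δ W ε).2.le x)
  obtain ⟨c, w, hcb, hc, hw⟩ := gen_exists_val W hba hb
  obtain ⟨d, e, hdc, hd, he⟩ := gen_exists_val ε (hcb.trans hba) hc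
  rw [gen_val_unique _ hd (hdc.trans (hcb.trans hx)) (gen_val_map₂ δ (hdc.trans hw) he)]
  exact hf.pos w e (hε d e hd he)

/-- Conditional Cauchy sequences are eventually bounded. -/
theorem IsCauchySeq.bounded {a : A} {q p : (ratSeq A).carrier a} (hq : IsCauchySeq a q)
    (hp : IsCauchySeq a p) : ∃ (W : (condRat A).carrier a) (n₀ : (condNat A).carrier a),
      ∀ n, (natLE A).rel a n₀ n →
        (ratLE A).lt a (genMap (fun x => |x|) (CondFun.eval q n)) W ∧
        (ratLE A).lt a (genMap (fun x => |x|) (CondFun.eval p n)) W := by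
  obtain ⟨n, hn⟩ := hq _ ratLT_one
  obtain ⟨m, hm⟩ := hp _ ratLT_one
  let F : ℚ → ℚ → ℚ := fun x y => |x| + |y| + 1
  have key : ∀ z s t : (condRat A).carrier a,
      ((ratLE A).lt a (ratDist z s) (genConst a 1) ∨ (ratLE A).lt a (ratDist z t) (genConst a 1)) →
      (ratLE A).lt a (genMap (fun x => |x|) z) (genMap₂ F s t) := by
    intro z s t h
    rw [ratLT_iff, ratLT_iff] at h
    rw [ratLT_iff]
    intro b u v hb hu hv
    have hba := hv.trans ((genMap₂ F s t).2.le v)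
    obtain ⟨c, x, hcb, hc, hx⟩ := gen_exists_val s hba hb
    obtain ⟨d, y, hdc, hd, hy⟩ := gen_exists_val t (hcb.trans hba) hc
    have hdb := hdc.trans hcb
    obtain ⟨e, w, hed, he, hw⟩ := gen_exists_val z (hdb.trans hba) hd
    have heb := hed.trans hdb
    have hx := hed.trans (hdc.trans hx)
    have hy := hed.trans hy
    rw [gen_val_unique _ he (heb.trans hu) (gen_val_map (fun x : ℚ => |x|) hw),
      gen_val_unique _ he (heb.trans hv) (gen_val_map₂ F hx hy)]
    have h3 := abs_nonneg x
    have h4 := abs_nonneg y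
    simp only [F]
    rcases h with h | h
    · have h1 := h e _ 1 he (gen_val_map₂ (fun x y : ℚ => |x - y|) hw hx)
        (gen_val_const (heb.trans hba) 1)
      have h2 := abs_sub_abs_le_abs_sub w x
      linarith
    · have h1 := h e _ 1 he (gen_val_map₂ (fun x y : ℚ => |x - y|) hw hy)
        (gen_val_const (heb.trans hba) 1)
      have h2 := abs_sub_abs_le_abs_sub w y
      linarith
  exact ⟨genMap₂ F (CondFun.eval q n) (CondFun.eval p m), genMap₂ max n m, fun k hk =>
    ⟨key _ _ _ (Or.inl (hn k n (natLE_max hk).1 (natLE_refl n))),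
      key _ _ _ (Or.inr (hm k m (natLE_max hk).2 (natLE_refl m)))⟩⟩

/-- Pointwise application of a classical operation to conditional sequences. -/
noncomputable def seqMap₂ (f : ℚ → ℚ → ℚ) {a : A} (q p : (ratSeq A).carrier a) :
    (ratSeq A).carrier a :=
  (⟨fun b hb n => genMap₂ f (CondFun.toFun q b hb n) (CondFun.toFun p b hb n),
    fun h hb x => by
      rw [CondFun.restr_toFun q h hb, CondFun.restr_toFun p h hb]
      have e := (natural_genMap₂ f).eq h (CondFun.toFun q _ hb x, CondFun.toFun p _ hb x)
      have e2 := CondSet.prod_restr (condRat A) (condRat A) h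
        (CondFun.toFun q _ hb x, CondFun.toFun p _ hb x)
      rw [e2] at e
      exact e⟩ : CondFun (condNat A) (condRat A) a)

/-- Pointwise negation of conditional sequences. -/
noncomputable def seqNeg {a : A} (q : (ratSeq A).carrier a) : (ratSeq A).carrier a :=
  (⟨fun b hb n => genMap (fun x => -x) (CondFun.toFun q b hb n),
    fun h hb x => by
      rw [CondFun.restr_toFun q h hb]
      exact (natural_genMap fun x : ℚ => -x).eq h _⟩ : CondFun (condNat A) (condRat A) a)

theorem natural_seqMap₂ (f : ℚ → ℚ → ℚ) :
    Natural (X := (ratSeq A).prod (ratSeq A)) (Y := ratSeq A) fun _ s => seqMap₂ f s.1 s.2 := by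
  refine ⟨fun {a b} h s => ?_⟩
  refine (congrArg (fun s : (ratSeq A).carrier a × (ratSeq A).carrier a => seqMap₂ f s.1 s.2)
    (CondSet.prod_restr _ _ h s)).trans ?_
  refine (congrArg₂ (seqMap₂ f) (funSpace_restr h s.1) (funSpace_restr h s.2)).trans ?_
  exact (funSpace_restr h (seqMap₂ f s.1 s.2)).symm

theorem natural_seqNeg : Natural (X := ratSeq A) (Y := ratSeq A) fun _ q => seqNeg q := by
  refine ⟨fun {a b} h s => ?_⟩
  exact (congrArg seqNeg (funSpace_restr h s)).trans (funSpace_restr h (seqNeg s)).symm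

theorem IsCauchySeq.map₂ {f δ : ℚ → ℚ → ℚ} (hf : HasModulus f δ) {a : A}
    {q p : (ratSeq A).carrier a} (hq : IsCauchySeq a q) (hp : IsCauchySeq a p) :
    IsCauchySeq a (seqMap₂ f q p) := by
  obtain ⟨W, k₀, hk⟩ := hq.bounded hp
  intro ε hε
  obtain ⟨n₀, hn⟩ := hq _ (hf.pos' (W := W) hε)
  obtain ⟨m₀, hm⟩ := hp _ (hf.pos' (W := W) hε)
  refine ⟨genMap₂ max k₀ (genMap₂ max n₀ m₀), fun m n h1 h2 => ?_⟩
  obtain ⟨h1k, h1⟩ := natLE_max h1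
  obtain ⟨h2k, h2⟩ := natLE_max h2
  exact hf.lt hε (hk m h1k).1 (hk n h2k).2 (hn m n (natLE_max h1).1 (natLE_max h2).1)
    (hm m n (natLE_max h1).2 (natLE_max h2).2)

theorem IsNullDiff.map₂ {f δ : ℚ → ℚ → ℚ} (hf : HasModulus f δ) {a : A}
    {q q' p p' : (ratSeq A).carrier a} (hq : IsCauchySeq a q) (hp' : IsCauchySeq a p')
    (h : IsNullDiff a q q') (h' : IsNullDiff a p p') :
    IsNullDiff a (seqMap₂ f q p) (seqMap₂ f q' p') := by
  obtain ⟨W, k₀, hk⟩ := hq.bounded hp'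
  intro ε hε
  obtain ⟨n₀, hn⟩ := h _ (hf.pos' (W := W) hε)
  obtain ⟨m₀, hm⟩ := h' _ (hf.pos' (W := W) hε)
  refine ⟨genMap₂ max k₀ (genMap₂ max n₀ m₀), fun n h1 => ?_⟩
  obtain ⟨h1k, h1⟩ := natLE_max h1
  exact hf.lt hε (hk n h1k).1 (hk n h1k).2 (hn n (natLE_max h1).1) (hm n (natLE_max h1).2)

theorem ratDist_neg {a : A} {x y ε : (condRat A).carrier a} (h : (ratLE A).lt a (ratDist x y) ε) :
    (ratLE A).lt a (ratDist (genMap (fun x => -x) x) (genMap (fun x => -x) y)) ε := by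
  rw [ratLT_iff] at h ⊢
  intro b u v hb hu hv
  have hba := hv.trans (ε.2.le v)
  obtain ⟨c, z, hcb, hc, hz⟩ := gen_exists_val x hba hb
  obtain ⟨d, w, hdc, hd, hw⟩ := gen_exists_val y (hcb.trans hba) hc
  have hz := hdc.trans hz
  have hdb := hdc.trans hcb
  rw [gen_val_unique _ hd (hdb.trans hu) (gen_val_map₂ (fun x y : ℚ => |x - y|)
    (gen_val_map (fun x : ℚ => -x) hz) (gen_val_map (fun x : ℚ => -x) hw))]
  have e : |(-z) - (-w)| = |z - w| := by rw [neg_sub_neg, abs_sub_comm]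
  rw [e]
  exact h d _ v hd (gen_val_map₂ (fun x y : ℚ => |x - y|) hz hw) (hdb.trans hv)

theorem ratSub_gt {a : A} {x x' y y' ε : (condRat A).carrier a}
    (h : (ratLE A).lt a (genMap (fun x => -x) (genMap (fun x => x / 3) ε))
      (genMap₂ (fun x y => x - y) y x))
    (hx : (ratLE A).lt a (ratDist x x') (genMap (fun x => x / 3) ε))
    (hy : (ratLE A).lt a (ratDist y y') (genMap (fun x => x / 3) ε)) :
    (ratLE A).lt a (genMap (fun x => -x) ε) (genMap₂ (fun x y => x - y) y' x') := by
  rw [ratLT_iff] at h hx hy ⊢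
  intro b u v hb hu hv
  have hba := hu.trans ((genMap (fun x => -x) ε).2.le u)
  obtain ⟨c1, e1, h1b, h1, he⟩ := gen_exists_val ε hba hb
  obtain ⟨c2, xv, h21, h2, hxv⟩ := gen_exists_val x (h1b.trans hba) h1
  have h2b := h21.trans h1b
  obtain ⟨c3, xv', h32, h3, hxv'⟩ := gen_exists_val x' (h2b.trans hba) h2
  have h3b := h32.trans h2b
  obtain ⟨c4, yv, h43, h4, hyv⟩ := gen_exists_val y (h3b.trans hba) h3
  have h4b := h43.trans h3b
  obtain ⟨c, yv', hc4, hc, hyv'⟩ := gen_exists_val y' (h4b.trans hba) h4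
  have hcb := hc4.trans h4b
  have hyv := hc4.trans hyv
  have hxv' := (hc4.trans h43).trans hxv'
  have hxv := (hc4.trans (h43.trans h32)).trans hxv
  have he := (hc4.trans (h43.trans (h32.trans h21))).trans he
  rw [gen_val_unique _ hc (hcb.trans hu) (gen_val_map (fun x : ℚ => -x) he),
    gen_val_unique _ hc (hcb.trans hv) (gen_val_map₂ (fun x y : ℚ => x - y) hyv' hxv')]
  have he3 := gen_val_map (fun x : ℚ => x / 3) he
  have k1 := h c _ _ hc (gen_val_map (fun x : ℚ => -x) he3)
    (gen_val_map₂ (fun x y : ℚ => x - y) hyv hxv)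
  have k2 := hx c _ _ hc (gen_val_map₂ (fun x y : ℚ => |x - y|) hxv hxv') he3
  have k3 := hy c _ _ hc (gen_val_map₂ (fun x y : ℚ => |x - y|) hyv hyv') he3
  rw [abs_lt] at k2 k3
  linarith [k2.1, k2.2, k3.1, k3.2]

theorem IsSeqLE.congr {a : A} {p p' q q' : (ratSeq A).carrier a} (hp : IsNullDiff a p p')
    (hq : IsNullDiff a q q') (h : IsSeqLE a p q) : IsSeqLE a p' q' := by
  intro ε hε
  have hε3 := ratHalf_pos hε (k := 3) (by norm_num)
  obtain ⟨n₀, hn⟩ := h _ hε3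
  obtain ⟨m₀, hm⟩ := hp _ hε3
  obtain ⟨k₀, hk⟩ := hq _ hε3
  refine ⟨genMap₂ max n₀ (genMap₂ max m₀ k₀), fun n h1 => ?_⟩
  obtain ⟨h1, h2⟩ := natLE_max h1
  exact ratSub_gt (hn n h1) (hm n (natLE_max h2).1) (hk n (natLE_max h2).2)

theorem isSeqLE_refl {a : A} (q : (ratSeq A).carrier a) : IsSeqLE a q q := by
  intro ε hε
  refine ⟨genConst a 0, fun n _ => ?_⟩
  rw [ratLT_zero_iff] at hε
  rw [ratLT_iff]
  intro b u v hb hu hv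
  have hba := hu.trans ((genMap (fun x => -x) ε).2.le u)
  obtain ⟨c, e, hcb, hc, he⟩ := gen_exists_val ε hba hb
  obtain ⟨d, x, hdc, hd, hx⟩ := gen_exists_val (CondFun.eval q n) (hcb.trans hba) hc
  have hdb := hdc.trans hcb
  rw [gen_val_unique _ hd (hdb.trans hu) (gen_val_map (fun x : ℚ => -x) (hdc.trans he)),
    gen_val_unique _ hd (hdb.trans hv) (gen_val_map₂ (fun x y : ℚ => x - y) hx hx)]
  have := hε d e hd (hdc.trans he)
  linarith

/-- A conditional set with the data of a conditional ordered ring: distinguished conditional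
elements `0`, `1`, conditional operations `+`, `·`, `-` and a conditional relation `≤`. -/
structure CondOrdRing (A : Type u) [CompleteBooleanAlgebra A] extends CondSet A where
  zero : carrier ⊤
  one : carrier ⊤
  add : CondFun (toCondSet.prod toCondSet) toCondSet ⊤
  mul : CondFun (toCondSet.prod toCondSet) toCondSet ⊤
  neg : CondFun toCondSet toCondSet ⊤
  le : CondRel toCondSet

/-- The conditional order on `𝒞` which induces the order of the conditional real numbers. -/
noncomputable def cauchyLE (A : Type u) [CompleteBooleanAlgebra A] : CondRel (cauchySet A) where
  rel a p q := IsSeqLE a p.1 q.1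
  isLocal :=
    have h := (cauchySubset A).natural_val cauchySubset_on
    IsLocal.comp (X := (cauchySet A).prod (cauchySet A)) isLocal_isSeqLE
      ((h.comp natural_fst).pair (h.comp natural_snd))
  nonempty := ⟨⟨_, isCauchySeq_const ⊤ 0⟩, ⟨_, isCauchySeq_const ⊤ 0⟩, isSeqLE_refl _⟩

/-- Pointwise application of an operation with a modulus of continuity to conditional Cauchy
sequences, on equivalence classes. -/
noncomputable def realMap₂ (A : Type u) [CompleteBooleanAlgebra A] {f δ : ℚ → ℚ → ℚ}
    (hf : HasModulus f δ) :
    CondFun ((quot (cauchySet A) (nullRel A) nullRel_equivalence).prod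
      (quot (cauchySet A) (nullRel A) nullRel_equivalence))
      (quot (cauchySet A) (nullRel A) nullRel_equivalence) ⊤ :=
  quotMap₂ (nullRel A) nullRel_equivalence
    (fun _ q p => ⟨seqMap₂ f q.1 p.1, IsCauchySeq.map₂ hf q.2 p.2⟩)
    ((cauchySubset A).natural_mk cauchySubset_on
      ((natural_seqMap₂ f).comp
        ((((cauchySubset A).natural_val cauchySubset_on).comp natural_fst).pair
          (((cauchySubset A).natural_val cauchySubset_on).comp natural_snd))) _)
    (fun _ q _ _ p' hq hp => IsNullDiff.map₂ hf q.2 p'.2 hq hp)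

/-- The conditional real numbers `𝐑 = 𝒞/∼` with
`[(qₙ)] + [(pₙ)] = [(qₙ + pₙ)]`, `[(qₙ)] [(pₙ)] = [(qₙ pₙ)]`, and `[(pₙ)] ≤ [(qₙ)]` iff for every
`ε > 0` in `𝐐` eventually `qₙ - pₙ > -ε`. -/
noncomputable def condReal (A : Type u) [CompleteBooleanAlgebra A] : CondOrdRing A where
  toCondSet := quot (cauchySet A) (nullRel A) nullRel_equivalence
  zero := Quotient.mk _ ⟨_, isCauchySeq_const ⊤ 0⟩
  one := Quotient.mk _ ⟨_, isCauchySeq_const ⊤ 1⟩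
  add := realMap₂ A hasModulus_add
  mul := realMap₂ A hasModulus_mul
  neg := quotMap (nullRel A) nullRel_equivalence
    (fun _ q => ⟨seqNeg q.1, fun ε hε => by
      obtain ⟨n₀, hn⟩ := q.2 ε hε
      exact ⟨n₀, fun m n hm hn' => ratDist_neg (hn m n hm hn')⟩⟩)
    ((cauchySubset A).natural_mk cauchySubset_on
      (natural_seqNeg.comp ((cauchySubset A).natural_val cauchySubset_on)) _)
    (fun _ q p h ε hε => by
      obtain ⟨n₀, hn⟩ := h ε hε
      exact ⟨n₀, fun n hn' => ratDist_neg (hn n hn')⟩)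
  le := quotRel (nullRel A) nullRel_equivalence (cauchyLE A)
    (fun a p p' q q' hp hq => ⟨IsSeqLE.congr hp hq, IsSeqLE.congr
      ((nullRel_equivalence a).symm hp) ((nullRel_equivalence a).symm hq)⟩)

namespace CondOrdRing

/-- The conditional difference `x - y = x + (-y)`. -/
noncomputable def sub (K : CondOrdRing A) {a : A} (x y : K.carrier a) : K.carrier a :=
  K.add.app (x, K.neg.app y)

/-- `m` is the conditional absolute value `|z| = max {z, -z}`, the least upper bound of `z` and
`-z`. -/
def IsAbs (K : CondOrdRing A) (a : A) (z m : K.carrier a) : Prop :=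
  (K.le.rel a z m ∧ K.le.rel a (K.neg.app z) m) ∧
    ∀ m', K.le.rel a z m' ∧ K.le.rel a (K.neg.app z) m' → K.le.rel a m m'

theorem isLocal_isAbs (K : CondOrdRing A) :
    IsLocal (K.toCondSet.prod K.toCondSet) fun a p => K.IsAbs a p.1 p.2 := by
  let X := K.toCondSet
  have hu : IsLocal (X.prod X) fun a p => K.le.rel a p.1 p.2 ∧ K.le.rel a (K.neg.app p.1) p.2 :=
    K.le.isLocal.and (K.le.isLocal.comp ((K.neg.natural.comp natural_fst).pair natural_snd))
  have h1 := IsLocal.all (X := X.prod X) (Y := X)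
    (P := fun a p m' => K.le.rel a p.1 m' ∧ K.le.rel a (K.neg.app p.1) m')
    (Q := fun a p m' => K.le.rel a p.2 m')
    (hu.comp ((natural_fst.comp natural_fst).pair natural_snd))
    (K.le.isLocal.comp ((natural_snd.comp natural_fst).pair natural_snd))
  exact (hu.and h1).congr fun a p =>
    ⟨fun h => ⟨h.1, ⟨⟨p.2, h.1⟩, h.2⟩⟩, fun h => ⟨h.1, h.2.2⟩⟩

theorem le_bot (K : CondOrdRing A) (x y : K.carrier ⊥) : K.le.rel ⊥ x y := by
  obtain ⟨u, v, h⟩ := K.le.nonempty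
  have h' := IsLocal.restr₂ (P := K.le.rel) K.le.isLocal (bot_le : ⊥ ≤ ⊤) u v h
  rwa [K.bot_subsingleton.elim x, K.bot_subsingleton.elim y]

/-- The conditional ball `B_ε(x) = {y | |x - y| < ε}`. -/
noncomputable def ball (K : CondOrdRing A) (x ε : K.carrier ⊤) : CondSubset K.toCondSet :=
  CondSubset.ofLocal
    (fun a y => ∃ m, K.IsAbs a (K.sub (K.restr le_top x) y) m ∧ K.le.lt a m (K.restr le_top ε))
    (by
      let X := K.toCondSet
      have hc : ∀ z : K.carrier ⊤, Natural (X := X.prod X) (Y := X)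
          fun a _ => X.restr (le_top : a ≤ ⊤) z := fun z => ⟨fun h _ => (X.restr_restr h _ z).symm⟩
      have hs : Natural (X := X.prod X) (Y := X) fun a p => K.sub (K.restr le_top x) p.1 :=
        K.add.natural.comp ((hc x).pair (K.neg.natural.comp natural_fst))
      exact IsLocal.ex (X := X) (Y := X)
        (P := fun a y m => K.IsAbs a (K.sub (K.restr le_top x) y) m ∧
          K.le.lt a m (K.restr le_top ε))
        ((K.isLocal_isAbs.comp (hs.pair natural_snd)).and
          (K.le.isLocal_lt.comp (natural_snd.pair (hc ε)))))
    (by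
      obtain ⟨y⟩ := K.bot_nonempty
      exact ⟨y, y, ⟨⟨K.le_bot _ _, K.le_bot _ _⟩, fun _ _ => K.le_bot _ _⟩,
        K.le_bot _ _, fun b hb _ => le_bot_iff.1 hb⟩)

/-- The balls `B_ε(x)`, where `x` and `ε > 0` live on `⊤`. -/
def balls (K : CondOrdRing A) : Set (CondSubset K.toCondSet) :=
  {B | ∃ x ε, K.le.lt ⊤ K.zero ε ∧ B = K.ball x ε}

end CondOrdRing

/-- The conditional subsets of `X` which are conditional elements, living on `⊤`, of a conditional
subset of the conditional power set. -/
def membersOf {X : CondSet A} (T : CondSubset (powerset X)) : Set (CondSubset X) :=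
  {O | (⟨O, le_top⟩ : {Y : CondSubset X // Y.on ≤ ⊤}) ∈ T.sets ⊤}

/-- A conditional topology on `X` is a conditional subset of `P(X)` which contains `𝟎` and `X` and is
closed under finite conditional intersections and arbitrary conditional unions. -/
structure IsCondTopology {X : CondSet A} (T : CondSubset (powerset X)) : Prop where
  empty_mem : CondSubset.empty X ∈ membersOf T
  full_mem : CondSubset.full X ∈ membersOf T
  inter_mem : ∀ U ∈ membersOf T, ∀ V ∈ membersOf T, CondSubset.sInter {U, V} ∈ membersOf T
  sUnion_mem : ∀ S : Set (CondSubset X), S ⊆ membersOf T → CondSubset.sUnion S ∈ membersOf T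

/-- The conditional topology conditionally generated by a set `G` of conditional subsets of `X` (or,
equivalently, by its stable hull): the conditional intersection of all conditional topologies which
contain `G`. -/
noncomputable def condTopology {X : CondSet A} (G : Set (CondSubset X)) : CondSubset (powerset X) :=
  CondSubset.sInter {T | IsCondTopology T ∧ G ⊆ membersOf T}

/-- `U` is a conditional neighbourhood of `x` (both living on `⊤`). -/
def IsCondNhd {X : CondSet A} (T : CondSubset (powerset X)) (x : X.carrier ⊤) (U : CondSubset X) :
    Prop :=
  U.on = ⊤ ∧ ∃ O ∈ membersOf T, x ∈ O.sets ⊤ ∧ O.Incl U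

namespace CondFun

/-- The conditional preimage. It lives on `sup {c | f_c⁻¹(V_c) ≠ ∅}`. -/
noncomputable def preimage {X Y : CondSet A} (f : CondFun X Y ⊤) (V : CondSubset Y) :
    CondSubset X :=
  CondSubset.ofLocal (fun a x => f.app x ∈ V.sets a) (V.isLocal.comp f.natural)
    ⟨X.bot_nonempty.some, V.bot_mem _⟩

/-- Conditional continuity with respect to conditional topologies `T` on `X` and `T'` on `Y`. -/
def CondContinuous {X Y : CondSet A} (T : CondSubset (powerset X)) (T' : CondSubset (powerset Y))
    (f : CondFun X Y ⊤) : Prop :=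
  ∀ x U, IsCondNhd T' (f.app x) U → IsCondNhd T x (f.preimage U)

/-- Conditional bijectivity: all `f_a` are injective and `f_1` is surjective. -/
def CondBijective {X Y : CondSet A} (f : CondFun X Y ⊤) : Prop :=
  (∀ a, Function.Injective fun x : X.carrier a => f.app x) ∧
    Function.Surjective fun x : X.carrier ⊤ => f.app x

end CondFun

/-- The conditional topology generated by the balls `B_ε(x)`. -/
noncomputable def CondOrdRing.topology (K : CondOrdRing A) : CondSubset (powerset K.toCondSet) :=
  condTopology K.balls

section MeasureAlgebra

variable {Ω : Type u} [MeasurableSpace Ω]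

/-- Equality of measurable sets up to a null set. -/
def aeSetoid (μ : Measure Ω) : Setoid {s : Set Ω // MeasurableSet s} where
  r s t := s.1 =ᵐ[μ] t.1
  iseqv := ⟨fun _ => Filter.EventuallyEq.rfl, fun h => h.symm, fun h h' => h.trans h'⟩

/-- The measure algebra of `μ`: the measurable sets modulo null sets. -/
def MeasureAlgebra (μ : Measure Ω) : Type u := Quotient (aeSetoid μ)

namespace MeasureAlgebra

variable {μ : Measure Ω}

/-- The class of a measurable set. -/
def mk (μ : Measure Ω) (s : Set Ω) (hs : MeasurableSet s) : MeasureAlgebra μ :=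
  Quotient.mk (aeSetoid μ) ⟨s, hs⟩

/-- A measurable set in the class `a`. -/
noncomputable def rep (a : MeasureAlgebra μ) : Set Ω := (Quotient.out (s := aeSetoid μ) a).1

theorem measurableSet_rep (a : MeasureAlgebra μ) : MeasurableSet a.rep :=
  (Quotient.out (s := aeSetoid μ) a).2

theorem mk_rep (a : MeasureAlgebra μ) : mk μ a.rep a.measurableSet_rep = a :=
  Quotient.out_eq (s := aeSetoid μ) a

theorem mk_eq_iff {s t : Set Ω} {hs : MeasurableSet s} {ht : MeasurableSet t} :
    mk μ s hs = mk μ t ht ↔ s =ᵐ[μ] t := Quotient.eq (r := aeSetoid μ)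

theorem rep_mk {s : Set Ω} (hs : MeasurableSet s) : (mk μ s hs).rep =ᵐ[μ] s :=
  mk_eq_iff.1 (mk_rep (mk μ s hs))

theorem ext {a b : MeasureAlgebra μ} (h : a.rep =ᵐ[μ] b.rep) : a = b := by
  rw [← mk_rep a, ← mk_rep b]
  exact mk_eq_iff.2 h

/-- The order is inclusion up to null sets; the Boolean operations are induced by those of sets. -/
noncomputable instance : PartialOrder (MeasureAlgebra μ) where
  le a b := a.rep ≤ᵐ[μ] b.rep
  le_refl _ := Filter.EventuallyLE.rfl
  le_trans _ _ _ h h' := h.trans h'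
  le_antisymm _ _ h h' := ext (h.antisymm h')

theorem le_def {a b : MeasureAlgebra μ} : a ≤ b ↔ ∀ᵐ ω ∂μ, ω ∈ a.rep → ω ∈ b.rep := Iff.rfl

theorem mem_rep_mk {s : Set Ω} (hs : MeasurableSet s) :
    ∀ᵐ ω ∂μ, ω ∈ (mk μ s hs).rep ↔ ω ∈ s :=
  (rep_mk hs).mem_iff

noncomputable instance : BooleanAlgebra (MeasureAlgebra μ) where
  sup a b := mk μ (a.rep ∪ b.rep) (a.measurableSet_rep.union b.measurableSet_rep)
  inf a b := mk μ (a.rep ∩ b.rep) (a.measurableSet_rep.inter b.measurableSet_rep)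
  compl a := mk μ a.repᶜ a.measurableSet_rep.compl
  top := mk μ Set.univ MeasurableSet.univ
  bot := mk μ ∅ MeasurableSet.empty
  le_sup_left a b := by
    filter_upwards [mem_rep_mk (μ := μ) (a.measurableSet_rep.union b.measurableSet_rep)] with ω h hω
    exact h.2 (Or.inl hω)
  le_sup_right a b := by
    filter_upwards [mem_rep_mk (μ := μ) (a.measurableSet_rep.union b.measurableSet_rep)] with ω h hω
    exact h.2 (Or.inr hω)
  sup_le a b c hac hbc := by
    filter_upwards [mem_rep_mk (μ := μ) (a.measurableSet_rep.union b.measurableSet_rep),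
      le_def.1 hac, le_def.1 hbc] with ω h h1 h2 hω
    exact (h.1 hω).elim h1 h2
  inf_le_left a b := by
    filter_upwards [mem_rep_mk (μ := μ) (a.measurableSet_rep.inter b.measurableSet_rep)] with ω h hω
    exact (h.1 hω).1
  inf_le_right a b := by
    filter_upwards [mem_rep_mk (μ := μ) (a.measurableSet_rep.inter b.measurableSet_rep)] with ω h hω
    exact (h.1 hω).2
  le_inf a b c hab hac := by
    filter_upwards [mem_rep_mk (μ := μ) (b.measurableSet_rep.inter c.measurableSet_rep),
      le_def.1 hab, le_def.1 hac] with ω h h1 h2 hω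
    exact h.2 ⟨h1 hω, h2 hω⟩
  le_sup_inf a b c := by
    filter_upwards [
      mem_rep_mk (μ := μ) (a.measurableSet_rep.union b.measurableSet_rep),
      mem_rep_mk (μ := μ) (a.measurableSet_rep.union c.measurableSet_rep),
      mem_rep_mk (μ := μ) (b.measurableSet_rep.inter c.measurableSet_rep),
      mem_rep_mk (μ := μ) ((mk μ _ (a.measurableSet_rep.union b.measurableSet_rep)).measurableSet_rep.inter
        (mk μ _ (a.measurableSet_rep.union c.measurableSet_rep)).measurableSet_rep),
      mem_rep_mk (μ := μ) (a.measurableSet_rep.union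
        (mk μ _ (b.measurableSet_rep.inter c.measurableSet_rep)).measurableSet_rep)]
      with ω h1 h2 h3 h4 h5 hω
    have h6 := h4.1 hω
    refine h5.2 ?_
    rcases h1.1 h6.1 with h | h
    · exact Or.inl h
    · rcases h2.1 h6.2 with h' | h'
      · exact Or.inl h'
      · exact Or.inr (h3.2 ⟨h, h'⟩)
  inf_compl_le_bot a := by
    filter_upwards [mem_rep_mk (μ := μ) a.measurableSet_rep.compl,
      mem_rep_mk (μ := μ) (a.measurableSet_rep.inter
        (mk μ _ a.measurableSet_rep.compl).measurableSet_rep)] with ω h1 h2 hω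
    exact absurd (h2.1 hω).1 (h1.1 (h2.1 hω).2)
  top_le_sup_compl a := by
    filter_upwards [mem_rep_mk (μ := μ) a.measurableSet_rep.compl,
      mem_rep_mk (μ := μ) (a.measurableSet_rep.union
        (mk μ _ a.measurableSet_rep.compl).measurableSet_rep)] with ω h1 h2 _
    refine h2.2 ?_
    by_cases h : ω ∈ a.rep
    · exact Or.inl h
    · exact Or.inr (h1.2 h)
  le_top a := by
    filter_upwards [mem_rep_mk (μ := μ) MeasurableSet.univ] with ω h _
    exact h.2 trivial
  bot_le a := by
    filter_upwards [mem_rep_mk (μ := μ) MeasurableSet.empty] with ω h hω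
    exact absurd (h.1 hω) id

theorem mem_inf (a b : MeasureAlgebra μ) :
    ∀ᵐ ω ∂μ, ω ∈ (a ⊓ b).rep ↔ ω ∈ a.rep ∧ ω ∈ b.rep :=
  mem_rep_mk (a.measurableSet_rep.inter b.measurableSet_rep)

theorem mem_bot : ∀ᵐ ω ∂μ, ω ∉ (⊥ : MeasureAlgebra μ).rep := by
  filter_upwards [mem_rep_mk (μ := μ) MeasurableSet.empty] with ω h hω
  exact h.1 hω

theorem mem_top : ∀ᵐ ω ∂μ, ω ∈ (⊤ : MeasureAlgebra μ).rep := by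
  filter_upwards [mem_rep_mk (μ := μ) MeasurableSet.univ] with ω h
  exact h.2 trivial

/-- In the measure algebra of a σ-finite measure every set has a supremum, and it is the supremum of
a sequence of members (or of `⊥`). -/
theorem exists_countable_sup [SigmaFinite μ] (S : Set (MeasureAlgebra μ)) :
    ∃ t : ℕ → MeasureAlgebra μ, (∀ n, t n ∈ insert ⊥ S) ∧
      ∀ a ∈ S, ∀ᵐ ω ∂μ, ω ∈ a.rep → ∃ n, ω ∈ (t n).rep := by
  let ν := μ.toFinite
  let v : (ℕ → MeasureAlgebra μ) → ENNReal := fun t => ν (⋃ n, (t n).rep)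
  let V : Set ENNReal := {x | ∃ t : ℕ → MeasureAlgebra μ, (∀ n, t n ∈ insert ⊥ S) ∧ v t = x}
  have hV : V.Nonempty := ⟨_, fun _ => ⊥, fun _ => Or.inl rfl, rfl⟩
  obtain ⟨x, -, hx, hxV⟩ := exists_seq_tendsto_sSup hV (OrderTop.bddAbove V)
  choose t ht htx using hxV
  let T : ℕ → MeasureAlgebra μ := fun n => t n.unpair.1 n.unpair.2
  have hT : ∀ n, T n ∈ insert ⊥ S := fun n => ht _ _
  have hle : ∀ k, (⋃ n, (t k n).rep) ⊆ ⋃ n, (T n).rep := fun k => by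
    refine Set.iUnion_subset fun n => ?_
    refine Set.Subset.trans ?_ (Set.subset_iUnion (fun n => (T n).rep) (Nat.pair k n))
    simp [T]
  have hmax : sSup V ≤ v T := by
    refine le_of_tendsto' hx fun k => ?_
    rw [← htx k]
    exact measure_mono (hle k)
  refine ⟨T, hT, fun a ha => ?_⟩
  let T' : ℕ → MeasureAlgebra μ := fun n => Nat.casesOn n a T
  have hT' : v T' ≤ sSup V := le_sSup ⟨T', fun n => by
    cases n with
    | zero => exact Or.inr ha
    | succ n => exact hT n, rfl⟩
  have hU : MeasurableSet (⋃ n, (T n).rep) := MeasurableSet.iUnion fun n => (T n).measurableSet_rep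
  have h0 : ν (a.rep \ ⋃ n, (T n).rep) = 0 := by
    have h1 : v T + ν (a.rep \ ⋃ n, (T n).rep) ≤ v T + 0 := by
      rw [add_zero]
      refine le_trans ?_ (hT'.trans hmax)
      rw [← measure_union Set.disjoint_sdiff_right (a.measurableSet_rep.diff hU)]
      refine measure_mono (Set.union_subset (Set.iUnion_subset fun n => ?_) ?_)
      · exact Set.subset_iUnion (fun n => (T' n).rep) (n + 1)
      · exact Set.sdiff_subset.trans (Set.subset_iUnion (fun n => (T' n).rep) 0)
    exact le_bot_iff.1 ((ENNReal.add_le_add_iff_left (measure_ne_top ν _)).1 h1)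
  have h2 : μ (a.rep \ ⋃ n, (T n).rep) = 0 := absolutelyContinuous_toFinite μ h0
  rw [measure_eq_zero_iff_ae_notMem] at h2
  filter_upwards [h2] with ω h hω
  by_contra hn
  exact h ⟨hω, fun hm => hn (Set.mem_iUnion.1 hm)⟩

theorem exists_isLUB [SigmaFinite μ] (S : Set (MeasureAlgebra μ)) : ∃ c, IsLUB S c := by
  obtain ⟨t, ht, hS⟩ := exists_countable_sup S
  have hU : MeasurableSet (⋃ n, (t n).rep) := MeasurableSet.iUnion fun n => (t n).measurableSet_rep
  refine ⟨mk μ _ hU, fun a ha => ?_, fun b hb => ?_⟩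
  · filter_upwards [hS a ha, mem_rep_mk hU] with ω h h' hω
    exact h'.2 (Set.mem_iUnion.2 (h hω))
  · have h1 : ∀ n, t n ≤ b := fun n => (ht n).elim (fun e => e ▸ bot_le) fun h => hb h
    filter_upwards [mem_rep_mk hU, ae_all_iff.2 fun n => le_def.1 (h1 n)] with ω h h' hω
    obtain ⟨n, hn⟩ := Set.mem_iUnion.1 (h.1 hω)
    exact h' n hn

theorem exists_isGLB [SigmaFinite μ] (S : Set (MeasureAlgebra μ)) : ∃ c, IsGLB S c := by
  obtain ⟨c, hc⟩ := exists_isLUB (lowerBounds S)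
  exact ⟨c, fun a ha => hc.2 fun b hb => hb ha, fun b hb => hc.1 hb⟩

noncomputable instance [SigmaFinite μ] : CompleteBooleanAlgebra (MeasureAlgebra μ) where
  sSup S := (exists_isLUB S).choose
  sInf S := (exists_isGLB S).choose
  isLUB_sSup S := (exists_isLUB S).choose_spec
  isGLB_sInf S := (exists_isGLB S).choose_spec
  __ := (inferInstance : BooleanAlgebra (MeasureAlgebra μ))

/-- The class of the indicator function `1_A` for `A ∈ a`. -/
noncomputable def ind (a : MeasureAlgebra μ) : Ω →ₘ[μ] ℝ :=
  AEEqFun.mk (a.rep.indicator fun _ => 1)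
    (measurable_const.indicator a.measurableSet_rep).aestronglyMeasurable

theorem coeFn_ind (a : MeasureAlgebra μ) : a.ind =ᵐ[μ] a.rep.indicator fun _ => 1 :=
  AEEqFun.coeFn_mk _ _

/-- `ind (mk s)` is the class of the indicator function of `s`. -/
theorem ind_mk {s : Set Ω} (hs : MeasurableSet s) : (mk μ s hs).ind =
    AEEqFun.mk (s.indicator fun _ => 1) (measurable_const.indicator hs).aestronglyMeasurable :=
  AEEqFun.mk_eq_mk.2 (indicator_ae_eq_of_ae_eq_set (rep_mk hs))

theorem coeFn_ind_mul (a : MeasureAlgebra μ) (f : Ω →ₘ[μ] ℝ) :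
    ∀ᵐ ω ∂μ, (ω ∈ a.rep → (a.ind * f) ω = f ω) ∧ (ω ∉ a.rep → (a.ind * f) ω = 0) := by
  filter_upwards [coeFn_ind a, AEEqFun.coeFn_mul a.ind f] with ω h1 h2
  rw [h2]
  simp only [Pi.mul_apply, h1]
  exact ⟨fun h => by simp [h], fun h => by simp [h]⟩

theorem ind_mul_eq_iff {a : MeasureAlgebra μ} {f g : Ω →ₘ[μ] ℝ} :
    a.ind * f = a.ind * g ↔ ∀ᵐ ω ∂μ, ω ∈ a.rep → f ω = g ω := by
  constructor
  · intro e
    filter_upwards [coeFn_ind_mul a f, coeFn_ind_mul a g] with ω h1 h2 hω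
    rw [← h1.1 hω, ← h2.1 hω, e]
  · intro h
    refine AEEqFun.ext ?_
    filter_upwards [coeFn_ind_mul a f, coeFn_ind_mul a g, h] with ω h1 h2 h3
    by_cases hω : ω ∈ a.rep
    · rw [h1.1 hω, h2.1 hω, h3 hω]
    · rw [h1.2 hω, h2.2 hω]

theorem ind_mul_ind_mul {a b : MeasureAlgebra μ} (h : a ≤ b) (f : Ω →ₘ[μ] ℝ) :
    a.ind * (b.ind * f) = a.ind * f := by
  rw [ind_mul_eq_iff]
  filter_upwards [coeFn_ind_mul b f, le_def.1 h] with ω h1 h2 hω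
  exact h1.1 (h2 hω)

theorem ind_top_mul (f : Ω →ₘ[μ] ℝ) : (⊤ : MeasureAlgebra μ).ind * f = f := by
  refine AEEqFun.ext ?_
  filter_upwards [coeFn_ind_mul ⊤ f, mem_top (μ := μ)] with ω h1 h2
  exact h1.1 h2

theorem ind_bot_mul (f : Ω →ₘ[μ] ℝ) : (⊥ : MeasureAlgebra μ).ind * f = 0 := by
  refine AEEqFun.ext ?_
  filter_upwards [coeFn_ind_mul ⊥ f, mem_bot (μ := μ),
    AEEqFun.coeFn_zero (α := Ω) (β := ℝ) (μ := μ)] with ω h1 h2 h3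
  rw [h1.2 h2, h3]
  rfl

/-- A statement which holds almost everywhere on all members of a partition of `c` holds almost
everywhere on `c`. -/
theorem ae_of_isPart [SigmaFinite μ] {ι : Type u} {a : ι → MeasureAlgebra μ} {c : MeasureAlgebra μ}
    (h : IsPart a c) {p : Ω → Prop} (hp : MeasurableSet {ω | p ω})
    (H : ∀ i, ∀ᵐ ω ∂μ, ω ∈ (a i).rep → p ω) : ∀ᵐ ω ∂μ, ω ∈ c.rep → p ω := by
  have h1 : c ≤ mk μ _ hp := by
    rw [← h.1]
    refine iSup_le fun i => ?_
    filter_upwards [H i, mem_rep_mk (μ := μ) hp] with ω h1 h2 hω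
    exact h2.2 (h1 hω)
  filter_upwards [le_def.1 h1, mem_rep_mk (μ := μ) hp] with ω h1 h2 hω
  exact h2.1 (h1 hω)

theorem exists_glue [SigmaFinite μ] {ι : Type u} {a : ι → MeasureAlgebra μ} {c : MeasureAlgebra μ}
    (h : IsPart a c) (f : ι → Ω →ₘ[μ] ℝ) :
    ∃ g : Ω →ₘ[μ] ℝ, ∀ i, (a i).ind * g = (a i).ind * f i := by
  classical
  obtain ⟨t, ht, hS⟩ := exists_countable_sup (Set.range a)
  have hbot : ∀ n, t n ≠ ⊥ → ∃ i, a i = t n := fun n hn => (ht n).resolve_left hn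
  let F : ℕ → Ω → ℝ := fun n => if hn : t n = ⊥ then 0 else f (hbot n hn).choose
  have hF : ∀ n, Measurable (F n) := fun n => by
    by_cases hn : t n = ⊥
    · simp only [F, hn, dite_true]; exact measurable_zero
    · simp only [F, hn, dite_false]; exact (f _).measurable
  let U := ⋃ n, (t n).rep
  have hU : MeasurableSet U := MeasurableSet.iUnion fun n => (t n).measurableSet_rep
  let p : ℕ → Ω → Prop := fun n ω => ω ∈ (t n).rep ∨ ω ∉ U
  have hp : ∀ n, MeasurableSet {ω | p n ω} := fun n => (t n).measurableSet_rep.union hU.compl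
  have hex : ∀ ω, ∃ n, p n ω := fun ω => by
    by_cases hω : ω ∈ U
    · obtain ⟨n, hn⟩ := Set.mem_iUnion.1 hω
      exact ⟨n, Or.inl hn⟩
    · exact ⟨0, Or.inr hω⟩
  have hG : Measurable fun ω => F (Nat.find (hex ω)) ω := Measurable.find hF hp hex
  refine ⟨AEEqFun.mk _ hG.aestronglyMeasurable, fun i => ?_⟩
  rw [ind_mul_eq_iff]
  have hdis : ∀ n, ∀ᵐ ω ∂μ, ω ∈ (a i).rep → ω ∈ (t n).rep → F n ω = f i ω := by
    intro n
    by_cases hn : t n = ⊥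
    · filter_upwards [mem_bot (μ := μ)] with ω h1 _ h2
      rw [hn] at h2
      exact absurd h2 h1
    · have hFn : F n = f (hbot n hn).choose := by simp [F, hn]
      have hj := (hbot n hn).choose_spec
      by_cases hij : i = (hbot n hn).choose
      · refine Filter.Eventually.of_forall fun ω _ _ => ?_
        rw [hFn, ← hij]
      · have h0 := h.2 i _ hij
        rw [hj] at h0
        filter_upwards [mem_inf (a i) (t n), mem_bot (μ := μ)] with ω h1 h2 h3 h4
        have := h1.2 ⟨h3, h4⟩
        rw [h0] at this
        exact absurd this h2
  filter_upwards [AEEqFun.coeFn_mk _ (hG.aestronglyMeasurable (μ := μ)), ae_all_iff.2 hdis,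
    hS (a i) ⟨i, rfl⟩] with ω h1 h2 h3 hω
  rw [h1]
  have hωU : ω ∈ U := Set.mem_iUnion.2 (h3 hω)
  exact h2 _ hω ((Nat.find_spec (hex ω)).resolve_right fun hn => hn hωU)

end MeasureAlgebra

open MeasureAlgebra

/-- The conditional set `𝐋⁰` on the measure algebra: `X_a = {1_A f | f ∈ L⁰}` for `A ∈ a` and
`γ_a(f) = 1_A f`. -/
noncomputable def l0Set (μ : Measure Ω) [SigmaFinite μ] : CondSet (MeasureAlgebra μ) where
  carrier a := {f : Ω →ₘ[μ] ℝ // ∃ g : Ω →ₘ[μ] ℝ, f = a.ind * g}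
  res a f := ⟨a.ind * f.1, f.1, rfl⟩
  bot_nonempty := ⟨⟨_, 0, rfl⟩⟩
  bot_subsingleton := ⟨by
    rintro ⟨_, f, rfl⟩ ⟨_, g, rfl⟩
    refine Subtype.ext ?_
    simp only [ind_bot_mul]⟩
  surjective a := by
    rintro ⟨_, f, rfl⟩
    exact ⟨⟨f, f, (ind_top_mul f).symm⟩, rfl⟩
  identity f := Subtype.ext (ind_top_mul f.1)
  consistency a b h f g e := Subtype.ext (by
    have e' : b.ind * f.1 = b.ind * g.1 := congrArg Subtype.val e
    show a.ind * f.1 = a.ind * g.1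
    rw [← ind_mul_ind_mul h, e', ind_mul_ind_mul h])
  stability {ι} a h f := by
    obtain ⟨g, hg⟩ := exists_glue h fun i => (f i).1
    have hf : ∀ i, (a i).ind * (f i).1 = (f i).1 := fun i => by
      obtain ⟨k, hk⟩ := (f i).2
      rw [hk, ind_mul_ind_mul le_rfl]
    refine ⟨⟨g, g, (ind_top_mul g).symm⟩, fun i => Subtype.ext ((hg i).trans (hf i)),
      fun k hk => Subtype.ext (AEEqFun.ext ?_)⟩
    have := ae_of_isPart h (p := fun ω => k.1 ω = g ω)
      (measurableSet_eq_fun k.1.measurable g.measurable) fun i => by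
        rw [← ind_mul_eq_iff, hg i, hf i]
        exact congrArg Subtype.val (hk i)
    filter_upwards [this, mem_top (μ := μ)] with ω h1 h2
    exact h1 h2

theorem l0_restr (μ : Measure Ω) [SigmaFinite μ] {a b : MeasureAlgebra μ} (h : a ≤ b)
    (f : (l0Set μ).carrier b) : ((l0Set μ).restr h f).1 = a.ind * f.1 := by
  obtain ⟨g, rfl⟩ := (l0Set μ).surjective b f
  rw [CondSet.restr_res]
  exact (ind_mul_ind_mul h g.1).symm

theorem l0_ind_mul {μ : Measure Ω} [SigmaFinite μ] {a : MeasureAlgebra μ}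
    (f : (l0Set μ).carrier a) : a.ind * f.1 = f.1 := by
  obtain ⟨k, hk⟩ := f.2
  rw [hk, ind_mul_ind_mul le_rfl]

theorem l0_ind_mul_le_iff {μ : Measure Ω} {a : MeasureAlgebra μ} {f g : Ω →ₘ[μ] ℝ} :
    a.ind * f ≤ a.ind * g ↔ ∀ᵐ ω ∂μ, ω ∈ a.rep → f ω ≤ g ω := by
  rw [← AEEqFun.coeFn_le]
  constructor
  · intro e
    filter_upwards [coeFn_ind_mul a f, coeFn_ind_mul a g, e] with ω h1 h2 h3 hω
    rwa [h1.1 hω, h2.1 hω] at h3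
  · intro h
    filter_upwards [coeFn_ind_mul a f, coeFn_ind_mul a g, h] with ω h1 h2 h3
    by_cases hω : ω ∈ a.rep
    · rw [h1.1 hω, h2.1 hω]; exact h3 hω
    · rw [h1.2 hω, h2.2 hω]

theorem ind_mul_add {μ : Measure Ω} (a : MeasureAlgebra μ) (f g : Ω →ₘ[μ] ℝ) :
    a.ind * (f + g) = a.ind * f + a.ind * g := by
  refine AEEqFun.ext ?_
  filter_upwards [AEEqFun.coeFn_add (a.ind * f) (a.ind * g), AEEqFun.coeFn_add f g,
    AEEqFun.coeFn_mul a.ind (f + g), AEEqFun.coeFn_mul a.ind f, AEEqFun.coeFn_mul a.ind g]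
    with ω h1 h2 h3 h4 h5
  rw [h1, h3]
  simp only [Pi.add_apply, Pi.mul_apply, h2, h4, h5]
  ring

theorem ind_mul_neg {μ : Measure Ω} (a : MeasureAlgebra μ) (f : Ω →ₘ[μ] ℝ) :
    a.ind * -f = -(a.ind * f) := by
  refine AEEqFun.ext ?_
  filter_upwards [AEEqFun.coeFn_neg (a.ind * f), AEEqFun.coeFn_neg f,
    AEEqFun.coeFn_mul a.ind (-f), AEEqFun.coeFn_mul a.ind f] with ω h1 h2 h3 h4
  rw [h1, h3]
  simp only [Pi.neg_apply, Pi.mul_apply, h2, h4]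
  ring

theorem ind_mul_mul {μ : Measure Ω} (a : MeasureAlgebra μ) (f g : Ω →ₘ[μ] ℝ) :
    a.ind * (f * g) = (a.ind * f) * (a.ind * g) := by
  rw [mul_assoc a.ind, mul_left_comm f, ind_mul_ind_mul le_rfl]

/-- Addition on `𝐋⁰`. -/
noncomputable def l0Add (μ : Measure Ω) [SigmaFinite μ] :
    CondFun ((l0Set μ).prod (l0Set μ)) (l0Set μ) ⊤ where
  toFun b _ p := ⟨p.1.1 + p.2.1, p.1.1 + p.2.1,
    ((ind_mul_add b _ _).trans (congrArg₂ (· + ·) (l0_ind_mul p.1) (l0_ind_mul p.2))).symm⟩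
  restr_toFun {a b} h _ p := by
    rw [CondSet.prod_restr]
    refine Subtype.ext ((congrArg₂ (· + ·) (l0_restr μ h p.1) (l0_restr μ h p.2)).trans ?_)
    refine Eq.trans ?_ (l0_restr μ h _).symm
    exact (ind_mul_add a _ _).symm

/-- Multiplication on `𝐋⁰`. -/
noncomputable def l0Mul (μ : Measure Ω) [SigmaFinite μ] :
    CondFun ((l0Set μ).prod (l0Set μ)) (l0Set μ) ⊤ where
  toFun b _ p := ⟨p.1.1 * p.2.1, p.1.1 * p.2.1,
    ((ind_mul_mul b _ _).trans (congrArg₂ (· * ·) (l0_ind_mul p.1) (l0_ind_mul p.2))).symm⟩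
  restr_toFun {a b} h _ p := by
    rw [CondSet.prod_restr]
    refine Subtype.ext ((congrArg₂ (· * ·) (l0_restr μ h p.1) (l0_restr μ h p.2)).trans ?_)
    refine Eq.trans ?_ (l0_restr μ h _).symm
    exact (ind_mul_mul a _ _).symm

/-- Negation on `𝐋⁰`. -/
noncomputable def l0Neg (μ : Measure Ω) [SigmaFinite μ] : CondFun (l0Set μ) (l0Set μ) ⊤ where
  toFun b _ f := ⟨-f.1, -f.1, ((ind_mul_neg b _).trans (congrArg (- ·) (l0_ind_mul f))).symm⟩
  restr_toFun {a b} h _ f := by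
    refine Subtype.ext ((congrArg (- ·) (l0_restr μ h f)).trans ?_)
    refine Eq.trans ?_ (l0_restr μ h _).symm
    exact (ind_mul_neg a _).symm

/-- `𝐋⁰` with the operations of `L⁰` and the order of almost sure dominance. -/
noncomputable def condL0 (μ : Measure Ω) [SigmaFinite μ] : CondOrdRing (MeasureAlgebra μ) where
  toCondSet := l0Set μ
  zero := ⟨0, 0, (ind_top_mul 0).symm⟩
  one := ⟨1, 1, (ind_top_mul 1).symm⟩
  add := l0Add μ
  mul := l0Mul μ
  neg := l0Neg μ
  le :=
    { rel := fun _ f g => f.1 ≤ g.1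
      isLocal := isLocal_prod (X := l0Set μ) (Y := l0Set μ) (P := fun _ f g => f.1 ≤ g.1)
        (fun h f g hfg => by
          rw [l0_restr, l0_restr, l0_ind_mul_le_iff]
          filter_upwards [AEEqFun.coeFn_le.2 hfg] with ω h1 _
          exact h1)
        (fun {ι a c} h f g hfg => by
          rw [← l0_ind_mul f, ← l0_ind_mul g, l0_ind_mul_le_iff]
          refine ae_of_isPart h (measurableSet_le f.1.measurable g.1.measurable) fun i => ?_
          have := hfg i
          rwa [l0_restr, l0_restr, l0_ind_mul_le_iff] at this)
      nonempty := ⟨⟨0, 0, (ind_top_mul 0).symm⟩, ⟨0, 0, (ind_top_mul 0).symm⟩, le_rfl⟩ }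

end MeasureAlgebra

end CondSetTheory

/-! Conditional objects over a measure algebra can be read pointwise. An element of the conditional
set generated by a countable set E splits its condition a into countably many pieces, so up to a
null set it is a measurable E-valued function on a (`genVal`, `genOf`). Operations and relations
then hold conditionally exactly when they hold at almost every point of a (`genVal_map₂`,
`genVal_rel_iff`). In this way conditional rationals become measurable rational-valued functions. A
conditional sequence commutes with restrictions, hence is determined by its values at constant
indices, and amounts to an ordinary sequence of measurable rational-valued functions
(`genVal_toFun`, `seqOf`).

The heart is `eventually_iff_ae`: a conditional statement "for every ε > 0 there is n₀ such that for
all m, n ≥ n₀" is equivalent to the classical statement at almost every point. In one direction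
countably many constant tolerances and indices suffice; in the other the least pointwise threshold
is a measurable function, hence a conditional natural number. Consequently conditionally Cauchy
means Cauchy almost everywhere, and the equivalence and order of conditional Cauchy sequences are
almost-everywhere equality and order of their limits.

The bijection sends a class to the pointwise limit of any representative. Equality of limits is
equivalence of sequences, which gives well-definedness and injectivity together (`seqLim_eq_iff`).
Every measurable f is the limit of ⌊f·(n+1)⌋/(n+1), which gives surjectivity. Algebra and order
follow from the limit laws.

Continuity is formal. The conditional subsets with open preimage form a conditional topology, so
only preimages of generators need checking (`condContinuous_condTopology`). A bijection that
preserves 0, addition, negation and order pulls balls back to balls (`condContinuous_of_inverse`),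
and this applies to both directions. -/

namespace CondSetTheory

universe u

/-! ### Generated conditional sets as measurable functions -/

section PointValues

open MeasureAlgebra

variable {Ω : Type u} [MeasurableSpace Ω] {μ : Measure Ω}

theorem MeasureAlgebra.eq_bot_of_ae {b : MeasureAlgebra μ} (h : ∀ᵐ ω ∂μ, ω ∉ b.rep) : b = ⊥ := by
  refine le_bot_iff.1 (le_def.2 ?_)
  filter_upwards [h] with ω h hω
  exact absurd hω h

theorem MeasureAlgebra.ae_notMem_of_eq_bot {b : MeasureAlgebra μ} (h : b = ⊥) :
    ∀ᵐ ω ∂μ, ω ∉ b.rep := by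
  rw [h]
  exact mem_bot

variable [SigmaFinite μ]

/-- The union of countably many representatives is measurable; its class is an upper bound of the
family, so it dominates the supremum. -/
theorem MeasureAlgebra.ae_exists_of_mem_iSup {ι : Type*} [Countable ι] (a : ι → MeasureAlgebra μ) :
    ∀ᵐ ω ∂μ, ω ∈ (⨆ i, a i).rep → ∃ i, ω ∈ (a i).rep := by
  have hU : MeasurableSet (⋃ i, (a i).rep) := MeasurableSet.iUnion fun i => (a i).measurableSet_rep
  have h : (⨆ i, a i) ≤ MeasureAlgebra.mk μ _ hU := iSup_le fun i => le_def.2 <| by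
    filter_upwards [mem_rep_mk (μ := μ) hU] with ω h hω
    exact h.2 (Set.mem_iUnion_of_mem i hω)
  filter_upwards [le_def.1 h, mem_rep_mk (μ := μ) hU] with ω h h' hω
  exact Set.mem_iUnion.1 (h'.1 (h hω))

variable {E F G : Type} [Nonempty E] [Countable E] [MeasurableSpace E]
  [Nonempty F] [Countable F] [MeasurableSpace F] [Nonempty G] [Countable G] [MeasurableSpace G]

/-- Representatives of the pieces are disjoint only up to null sets, so the value is read off from
the first piece, in an enumeration of E, that contains the point. Countably many null overlaps are
then discarded. -/
theorem exists_measurable_genVal {a : MeasureAlgebra μ}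
    (g : (gen (MeasureAlgebra μ) E).carrier a) :
    ∃ h : Ω → E, Measurable h ∧ ∀ z, ∀ᵐ ω ∂μ, ω ∈ (g.1 z).rep → h ω = z := by
  classical
  obtain ⟨s, hs⟩ := exists_surjective_nat E
  let U := ⋃ z, (g.1 z).rep
  have hU : MeasurableSet U := MeasurableSet.iUnion fun z => (g.1 z).measurableSet_rep
  -- The second alternative makes the search succeed at every point; outside all pieces the default
  -- value is `s 0`.
  let p : ℕ → Ω → Prop := fun n ω => ω ∈ (g.1 (s n)).rep ∨ ω ∉ U
  have hp : ∀ n, MeasurableSet {ω | p n ω} := fun n =>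
    (g.1 (s n)).measurableSet_rep.union hU.compl
  have hex : ∀ ω, ∃ n, p n ω := fun ω => by
    by_cases hω : ω ∈ U
    · obtain ⟨z, hz⟩ := Set.mem_iUnion.1 hω
      obtain ⟨n, rfl⟩ := hs z
      exact ⟨n, Or.inl hz⟩
    · exact ⟨0, Or.inr hω⟩
  refine ⟨fun ω => s (Nat.find (hex ω)),
    Measurable.find (f := fun n _ => s n) (fun _ => measurable_const) hp hex, fun z => ?_⟩
  have hdis : ∀ w, ∀ᵐ ω ∂μ, ω ∈ (g.1 z).rep → ω ∈ (g.1 w).rep → w = z := fun w => by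
    by_cases hwz : w = z
    · exact Filter.Eventually.of_forall fun _ _ _ => hwz
    · filter_upwards [mem_inf (g.1 w) (g.1 z), ae_notMem_of_eq_bot (g.2.2 w z hwz)] with ω h1 h2 h3 h4
      exact absurd (h1.2 ⟨h4, h3⟩) h2
  filter_upwards [ae_all_iff.2 hdis] with ω h hω
  exact h _ hω ((Nat.find_spec (hex ω)).resolve_right fun hn => hn (Set.mem_iUnion_of_mem z hω))

/-- The pointwise value of an element of the conditional set generated by a countable set. -/
noncomputable def genVal {a : MeasureAlgebra μ} (g : (gen (MeasureAlgebra μ) E).carrier a) :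
    Ω → E := (exists_measurable_genVal g).choose

theorem measurable_genVal {a : MeasureAlgebra μ} (g : (gen (MeasureAlgebra μ) E).carrier a) :
    Measurable (genVal g) := (exists_measurable_genVal g).choose_spec.1

theorem genVal_eq {a : MeasureAlgebra μ} (g : (gen (MeasureAlgebra μ) E).carrier a) :
    ∀ᵐ ω ∂μ, ∀ z, ω ∈ (g.1 z).rep → genVal g ω = z :=
  ae_all_iff.2 (exists_measurable_genVal g).choose_spec.2

theorem mem_rep_genVal {a : MeasureAlgebra μ} (g : (gen (MeasureAlgebra μ) E).carrier a) :
    ∀ᵐ ω ∂μ, ω ∈ a.rep → ω ∈ (g.1 (genVal g ω)).rep := by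
  have h := ae_exists_of_mem_iSup g.1
  rw [g.2.1] at h
  filter_upwards [h, genVal_eq g] with ω h1 h2 hω
  obtain ⟨z, hz⟩ := h1 hω
  rwa [h2 z hz]

/-- The bridge between algebra and points. If r fails for a pair of values, the corresponding pieces
must meet in ⊥, and there are only countably many such null overlaps to discard. Conversely, an
element b on which both values are constant and violate r has almost no points. The relation r is
arbitrary, so the same statement serves for both ≤ and <. -/
theorem genVal_rel_iff (r : E → F → Prop) {a : MeasureAlgebra μ}
    (g : (gen (MeasureAlgebra μ) E).carrier a) (h : (gen (MeasureAlgebra μ) F).carrier a) :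
    (∀ b x y, b ≠ ⊥ → b ≤ g.1 x → b ≤ h.1 y → r x y) ↔
      ∀ᵐ ω ∂μ, ω ∈ a.rep → r (genVal g ω) (genVal h ω) := by
  constructor
  · intro H
    have hdis : ∀ x y, ∀ᵐ ω ∂μ, ω ∈ (g.1 x).rep → ω ∈ (h.1 y).rep → r x y := fun x y => by
      by_cases hr : r x y
      · exact Filter.Eventually.of_forall fun _ _ _ => hr
      · have hb : g.1 x ⊓ h.1 y = ⊥ := by
          by_contra hb
          exact hr (H _ x y hb inf_le_left inf_le_right)
        filter_upwards [mem_inf (g.1 x) (h.1 y), ae_notMem_of_eq_bot hb] with ω h1 h2 h3 h4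
        exact absurd (h1.2 ⟨h3, h4⟩) h2
    filter_upwards [ae_all_iff.2 fun x => ae_all_iff.2 (hdis x), mem_rep_genVal g,
      mem_rep_genVal h] with ω h1 h2 h3 hω
    exact h1 _ _ (h2 hω) (h3 hω)
  · intro H b x y hb hx hy
    by_contra hr
    refine hb (eq_bot_of_ae ?_)
    filter_upwards [H, le_def.1 hx, le_def.1 hy, le_def.1 (g.2.le x), genVal_eq g, genVal_eq h]
      with ω h1 h2 h3 h4 h5 h6 hω
    have := h1 (h4 (h2 hω))
    rw [h5 x (h2 hω), h6 y (h3 hω)] at this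
    exact hr this

/-- The piece over z is, up to a null set, the part of a where the value is z, so the pieces can be
recovered from the value function. -/
theorem gen_ext_of_ae {a : MeasureAlgebra μ} {g h : (gen (MeasureAlgebra μ) E).carrier a}
    (H : ∀ᵐ ω ∂μ, ω ∈ a.rep → genVal g ω = genVal h ω) : g = h := by
  have key : ∀ {g h : (gen (MeasureAlgebra μ) E).carrier a},
      (∀ᵐ ω ∂μ, ω ∈ a.rep → genVal g ω = genVal h ω) → ∀ z, g.1 z ≤ h.1 z := by
    intro g h H z
    refine le_def.2 ?_
    filter_upwards [H, genVal_eq g, mem_rep_genVal h, le_def.1 (g.2.le z)] with ω h1 h2 h3 h4 hω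
    have := h3 (h4 hω)
    rwa [← h1 (h4 hω), h2 z hω] at this
  refine Subtype.ext (funext fun z => le_antisymm (key H z) (key ?_ z))
  filter_upwards [H] with ω h hω
  exact (h hω).symm

theorem genVal_restr {a b : MeasureAlgebra μ} (hab : a ≤ b)
    (g : (gen (MeasureAlgebra μ) E).carrier b) :
    ∀ᵐ ω ∂μ, ω ∈ a.rep → genVal ((gen (MeasureAlgebra μ) E).restr hab g) ω = genVal g ω := by
  have h : ∀ z, ((gen (MeasureAlgebra μ) E).restr hab g).1 z ≤ g.1 z := fun z => by
    rw [gen_restr]; exact inf_le_right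
  filter_upwards [mem_rep_genVal ((gen (MeasureAlgebra μ) E).restr hab g), genVal_eq g,
    ae_all_iff.2 fun z => le_def.1 (h z)] with ω h1 h2 h3 hω
  exact (h2 _ (h3 _ (h1 hω))).symm

theorem genVal_const (a : MeasureAlgebra μ) (z : E) :
    ∀ᵐ ω ∂μ, ω ∈ a.rep → genVal (genConst a z) ω = z := by
  filter_upwards [genVal_eq (genConst a z), le_def.1 (gen_val_const (le_refl a) z)] with ω h1 h2 hω
  exact h1 z (h2 hω)

theorem genVal_map (f : E → F) {a : MeasureAlgebra μ}
    (g : (gen (MeasureAlgebra μ) E).carrier a) :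
    ∀ᵐ ω ∂μ, ω ∈ a.rep → genVal (genMap f g) ω = f (genVal g ω) := by
  have h : ∀ x, g.1 x ≤ (genMap f g).1 (f x) := fun x => gen_val_map f le_rfl
  filter_upwards [genVal_eq (genMap f g), mem_rep_genVal g, ae_all_iff.2 fun x => le_def.1 (h x)]
    with ω h1 h2 h3 hω
  exact h1 _ (h3 _ (h2 hω))

theorem genVal_map₂ (f : E → F → G) {a : MeasureAlgebra μ}
    (g : (gen (MeasureAlgebra μ) E).carrier a) (h : (gen (MeasureAlgebra μ) F).carrier a) :
    ∀ᵐ ω ∂μ, ω ∈ a.rep → genVal (genMap₂ f g h) ω = f (genVal g ω) (genVal h ω) := by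
  have hle : ∀ x y, g.1 x ⊓ h.1 y ≤ (genMap₂ f g h).1 (f x y) := fun x y =>
    gen_val_map₂ f inf_le_left inf_le_right
  filter_upwards [genVal_eq (genMap₂ f g h), mem_rep_genVal g, mem_rep_genVal h,
    ae_all_iff.2 fun x => ae_all_iff.2 fun y => le_def.1 (hle x y),
    ae_all_iff.2 fun x => ae_all_iff.2 fun y => mem_inf (g.1 x) (h.1 y)] with ω h1 h2 h3 h4 h5 hω
  exact h1 _ (h4 _ _ ((h5 _ _).2 ⟨h2 hω, h3 hω⟩))

/-- The element of the conditional set generated by a countable set which has the given pointwise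
values. -/
noncomputable def genOf [MeasurableSingletonClass E] (a : MeasureAlgebra μ) (h : Ω → E)
    (hh : Measurable h) : (gen (MeasureAlgebra μ) E).carrier a :=
  ⟨fun z => a ⊓ MeasureAlgebra.mk μ (h ⁻¹' {z}) (hh (measurableSet_singleton z)), by
    refine ⟨le_antisymm (iSup_le fun _ => inf_le_left) (le_def.2 ?_), fun z w hzw => ?_⟩
    · have hle : ∀ z, a ⊓ MeasureAlgebra.mk μ (h ⁻¹' {z}) (hh (measurableSet_singleton z)) ≤
          ⨆ z, a ⊓ MeasureAlgebra.mk μ (h ⁻¹' {z}) (hh (measurableSet_singleton z)) :=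
        fun z => le_iSup (fun z => a ⊓ MeasureAlgebra.mk μ (h ⁻¹' {z})
          (hh (measurableSet_singleton z))) z
      filter_upwards [ae_all_iff.2 fun z => le_def.1 (hle z),
        ae_all_iff.2 fun z => mem_rep_mk (μ := μ) (hh (measurableSet_singleton z)),
        ae_all_iff.2 fun z => mem_inf a (MeasureAlgebra.mk μ (h ⁻¹' {z})
          (hh (measurableSet_singleton z)))] with ω h1 h2 h3 hω
      -- A point of a lies in the fibre over its own value, so the countably many fibres exhaust a.
      exact h1 (h ω) ((h3 _).2 ⟨hω, (h2 _).2 rfl⟩)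
    · refine eq_bot_of_ae ?_
      filter_upwards [mem_inf (a ⊓ MeasureAlgebra.mk μ (h ⁻¹' {z}) (hh (measurableSet_singleton z)))
          (a ⊓ MeasureAlgebra.mk μ (h ⁻¹' {w}) (hh (measurableSet_singleton w))),
        mem_inf a (MeasureAlgebra.mk μ (h ⁻¹' {z}) (hh (measurableSet_singleton z))),
        mem_inf a (MeasureAlgebra.mk μ (h ⁻¹' {w}) (hh (measurableSet_singleton w))),
        mem_rep_mk (μ := μ) (hh (measurableSet_singleton z)),
        mem_rep_mk (μ := μ) (hh (measurableSet_singleton w))] with ω h1 h2 h3 h4 h5 hω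
      have hz : h ω = z := h4.1 (h2.1 (h1.1 hω).1).2
      have hw : h ω = w := h5.1 (h3.1 (h1.1 hω).2).2
      exact hzw (hz.symm.trans hw)⟩

theorem genVal_genOf [MeasurableSingletonClass E] (a : MeasureAlgebra μ) (h : Ω → E)
    (hh : Measurable h) : ∀ᵐ ω ∂μ, ω ∈ a.rep → genVal (genOf a h hh) ω = h ω := by
  filter_upwards [genVal_eq (genOf a h hh),
    ae_all_iff.2 fun z => mem_inf a (MeasureAlgebra.mk μ (h ⁻¹' {z})
      (hh (measurableSet_singleton z))),
    ae_all_iff.2 fun z => mem_rep_mk (μ := μ) (hh (measurableSet_singleton z))] with ω h1 h2 h3 hω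
  exact h1 _ ((h2 _).2 ⟨hω, (h3 _).2 rfl⟩)

end PointValues

/-! ### Rational sequences and their real limits -/

section RationalSequences

open Filter Topology

/-- Rational tolerances suffice because every positive real has a positive rational below it. -/
theorem cauchySeq_ratCast_iff (s : ℕ → ℚ) :
    (∀ ε : ℚ, 0 < ε → ∃ N, ∀ m ≥ N, ∀ n ≥ N, |s m - s n| < ε) ↔
      CauchySeq fun n => (s n : ℝ) := by
  rw [Metric.cauchySeq_iff]
  constructor
  · intro H ε hε
    obtain ⟨δ, hδ, hδε⟩ := exists_rat_btwn hε
    obtain ⟨N, hN⟩ := H δ (by exact_mod_cast hδ)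
    refine ⟨N, fun m hm n hn => lt_trans ?_ hδε⟩
    rw [Real.dist_eq]
    exact_mod_cast hN m hm n hn
  · intro H ε hε
    obtain ⟨N, hN⟩ := H ε (by exact_mod_cast hε)
    refine ⟨N, fun m hm n hn => ?_⟩
    have := hN m hm n hn
    rw [Real.dist_eq] at this
    exact_mod_cast this

/-- From left to right the bounds pass to the limit and give -δ ≤ y - x for arbitrarily small δ.
From right to left y - x ≥ 0 lies strictly above -ε, and so do all late terms of the difference. -/
theorem le_lim_iff_of_tendsto {s t : ℕ → ℚ} {x y : ℝ}
    (hs : Tendsto (fun n => (s n : ℝ)) atTop (𝓝 x))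
    (ht : Tendsto (fun n => (t n : ℝ)) atTop (𝓝 y)) :
    (∀ ε : ℚ, 0 < ε → ∃ N, ∀ n ≥ N, -ε < t n - s n) ↔ x ≤ y := by
  have h := ht.sub hs
  constructor
  · intro H
    refine le_of_forall_pos_lt_add fun ε hε => ?_
    obtain ⟨δ, hδ, hδε⟩ := exists_rat_btwn hε
    obtain ⟨N, hN⟩ := H δ (by exact_mod_cast hδ)
    have : -(δ : ℝ) ≤ y - x := by
      refine ge_of_tendsto h (eventually_atTop.2 ⟨N, fun n hn => ?_⟩)
      have := (hN n hn).le
      exact_mod_cast this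
    linarith
  · intro H ε hε
    have hε' : (0 : ℝ) < ε := by exact_mod_cast hε
    obtain ⟨N, hN⟩ := eventually_atTop.1 (h.eventually (lt_mem_nhds (show -(ε : ℝ) < y - x by linarith)))
    exact ⟨N, fun n hn => by exact_mod_cast hN n hn⟩

/-- The two-sided bound splits into the one-sided criterion for x ≤ y and the one for y ≤ x. -/
theorem lim_eq_iff_of_tendsto {s t : ℕ → ℚ} {x y : ℝ}
    (hs : Tendsto (fun n => (s n : ℝ)) atTop (𝓝 x))
    (ht : Tendsto (fun n => (t n : ℝ)) atTop (𝓝 y)) :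
    (∀ ε : ℚ, 0 < ε → ∃ N, ∀ n ≥ N, |s n - t n| < ε) ↔ x = y := by
  rw [le_antisymm_iff, ← le_lim_iff_of_tendsto hs ht, ← le_lim_iff_of_tendsto ht hs]
  constructor
  · refine fun H => ⟨fun ε hε => ?_, fun ε hε => ?_⟩ <;>
    · obtain ⟨N, hN⟩ := H ε hε
      exact ⟨N, fun n hn => by linarith [abs_lt.1 (hN n hn)]⟩
  · rintro ⟨H1, H2⟩ ε hε
    obtain ⟨N, hN⟩ := H1 ε hε
    obtain ⟨M, hM⟩ := H2 ε hε
    refine ⟨max N M, fun n hn => abs_lt.2 ⟨hM n (le_of_max_le_right hn), ?_⟩⟩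
    linarith [hN n (le_of_max_le_left hn)]

/-- Rounding down to the grid of mesh 1/(n+1) errs by at most 1/(n+1). This particular choice of
rational approximants matters because it is measurable in x; the shift by one avoids division by
zero. -/
theorem tendsto_floor_mul_div (x : ℝ) :
    Tendsto (fun n : ℕ => (((⌊x * (n + 1)⌋ : ℚ) / (n + 1) : ℚ) : ℝ)) atTop (𝓝 x) := by
  have h0 : Tendsto (fun n : ℕ => x - 1 / ((n : ℝ) + 1)) atTop (𝓝 x) := by
    simpa using tendsto_one_div_add_atTop_nhds_zero_nat.const_sub x
  refine tendsto_of_tendsto_of_tendsto_of_le_of_le h0 tendsto_const_nhds (fun n => ?_) fun n => ?_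
  · have hn : (0 : ℝ) < n + 1 := by positivity
    push_cast
    rw [sub_div' hn.ne']
    gcongr
    exact (Int.sub_one_lt_floor _).le
  · have hn : (0 : ℝ) < n + 1 := by positivity
    push_cast
    rw [div_le_iff₀ hn]
    exact Int.floor_le _

end RationalSequences

/-! ### Conditional sequences and their pointwise limits -/

section PointSequences

open MeasureAlgebra Filter Topology

variable {Ω : Type u} [MeasurableSpace Ω] {μ : Measure Ω} [SigmaFinite μ] {a : MeasureAlgebra μ}

theorem ratLT_iff_ae (g h : (condRat (MeasureAlgebra μ)).carrier a) :
    (ratLE (MeasureAlgebra μ)).lt a g h ↔ ∀ᵐ ω ∂μ, ω ∈ a.rep → genVal g ω < genVal h ω :=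
  (ratLT_iff g h).trans (genVal_rel_iff (fun x y => x < y) g h)

theorem natLE_iff_ae (g h : (condNat (MeasureAlgebra μ)).carrier a) :
    (natLE (MeasureAlgebra μ)).rel a g h ↔ ∀ᵐ ω ∂μ, ω ∈ a.rep → genVal g ω ≤ genVal h ω :=
  (natLE_iff g h).trans (genVal_rel_iff (fun x y => x ≤ y) g h)

theorem ratLT_zero_iff_ae (e : (condRat (MeasureAlgebra μ)).carrier a) :
    (ratLE (MeasureAlgebra μ)).lt a (genConst a 0) e ↔
      ∀ᵐ ω ∂μ, ω ∈ a.rep → 0 < genVal e ω := by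
  rw [ratLT_iff_ae]
  refine eventually_congr ?_
  filter_upwards [genVal_const (E := ℚ) a 0] with ω h
  exact forall_congr' fun hω => by rw [h hω]

/-- Conditional `ε`-`n₀`-statements are the classical ones, almost everywhere. -/
theorem eventually_iff_ae (S : ℚ → ℕ → ℕ → Ω → Prop)
    (hS : ∀ ε m n, MeasurableSet {ω | S ε m n ω}) :
    (∀ e : (condRat (MeasureAlgebra μ)).carrier a, (ratLE _).lt a (genConst a 0) e →
      ∃ n₀ : (condNat (MeasureAlgebra μ)).carrier a,
        ∀ m n : (condNat (MeasureAlgebra μ)).carrier a,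
          (natLE _).rel a n₀ m → (natLE _).rel a n₀ n →
          ∀ᵐ ω ∂μ, ω ∈ a.rep → S (genVal e ω) (genVal m ω) (genVal n ω) ω) ↔
      ∀ᵐ ω ∂μ, ω ∈ a.rep → ∀ ε : ℚ, 0 < ε → ∃ N, ∀ m ≥ N, ∀ n ≥ N, S ε m n ω := by
  classical
  constructor
  · intro H
    -- Only constant tolerances are tested. There are countably many of them, so their exceptional
    -- null sets can be united afterwards.
    have key : ∀ ε : ℚ, ∀ᵐ ω ∂μ, ω ∈ a.rep → 0 < ε → ∃ N, ∀ m ≥ N, ∀ n ≥ N, S ε m n ω := by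
      intro ε
      by_cases hε : 0 < ε
      swap
      · exact Eventually.of_forall fun _ _ h => absurd h hε
      obtain ⟨n₀, hn₀⟩ := H (genConst a ε) ((ratLT_zero_iff_ae _).2 (by
        filter_upwards [genVal_const a ε] with ω h hω
        rwa [h hω]))
      -- A constant index i need not dominate `n₀` on all of a, so the admissible index max(n₀, i)
      -- is used instead; wherever i is at least the value of `n₀` it has value i.
      have hmax : ∀ i : ℕ, (natLE _).rel a n₀ (genMap₂ max n₀ (genConst a i)) := fun i => by
        rw [natLE_iff_ae]
        filter_upwards [genVal_map₂ max n₀ (genConst a i)] with ω h hω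
        rw [h hω]
        exact le_max_left _ _
      filter_upwards [ae_all_iff.2 fun i => ae_all_iff.2 fun j => hn₀ _ _ (hmax i) (hmax j),
        ae_all_iff.2 fun i => genVal_map₂ max n₀ (genConst a i),
        ae_all_iff.2 fun i : ℕ => genVal_const a i, genVal_const a ε] with ω h1 h2 h3 h4 hω _
      refine ⟨genVal n₀ ω, fun m hm n hn => ?_⟩
      have := h1 m n hω
      rwa [h4 hω, h2 m hω, h2 n hω, h3 m hω, h3 n hω, max_eq_right hm, max_eq_right hn] at this
    filter_upwards [ae_all_iff.2 key] with ω h hω ε hε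
    exact h ε hω hε
  · intro H e he
    -- The threshold N works at ω for the tolerance that e takes there.
    let p : Ω → ℕ → Prop := fun ω N => ∀ m ≥ N, ∀ n ≥ N, S (genVal e ω) m n ω
    have hp : ∀ N, MeasurableSet {ω | p ω N} := fun N => by
      have hm : ∀ m n, MeasurableSet {ω | S (genVal e ω) m n ω} := fun m n => by
        -- Splitting Ω according to the countably many values of e reduces measurability to `hS`,
        -- where the tolerance is fixed.
        have : {ω | S (genVal e ω) m n ω} = ⋃ ε : ℚ, genVal e ⁻¹' {ε} ∩ {ω | S ε m n ω} := by
          ext ω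
          simp
        rw [this]
        exact MeasurableSet.iUnion fun ε =>
          (measurable_genVal e (measurableSet_singleton ε)).inter (hS ε m n)
      simp only [p, Set.ofPred_forall]
      exact MeasurableSet.iInter fun m => MeasurableSet.iInter fun _ =>
        MeasurableSet.iInter fun n => MeasurableSet.iInter fun _ => hm m n
    -- The second alternative makes the search total, so the least N is a measurable function on Ω
    -- and can be turned into the conditional index `n₀`. At almost every point of a it does not
    -- occur, because e is positive there and `H` supplies a threshold.
    let p' : Ω → ℕ → Prop := fun ω N => p ω N ∨ ¬ ∃ N, p ω N
    have hp' : ∀ N, MeasurableSet {ω | p' ω N} := fun N => by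
      refine (hp N).union (MeasurableSet.compl (s := {ω | ∃ N, p ω N}) ?_)
      simp only [Set.ofPred_exists]
      exact MeasurableSet.iUnion hp
    have hex : ∀ ω, ∃ N, p' ω N := fun ω => by
      by_cases h : ∃ N, p ω N
      · exact h.imp fun _ => Or.inl
      · exact ⟨0, Or.inr h⟩
    refine ⟨genOf a _ (measurable_find hex hp'), fun m n hm hn => ?_⟩
    rw [natLE_iff_ae] at hm hn
    filter_upwards [hm, hn, genVal_genOf a _ (measurable_find hex hp'), H,
      (ratLT_zero_iff_ae e).1 he] with ω h1 h2 h3 h4 h5 hω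
    have hN := (Nat.find_spec (hex ω)).resolve_right (not_not_intro (h4 hω _ (h5 hω)))
    rw [← h3 hω] at hN
    exact hN _ (h1 hω) _ (h2 hω)

/-- The pointwise values of a conditional sequence. -/
noncomputable def seqVal (q : (ratSeq (MeasureAlgebra μ)).carrier a) (n : ℕ) : Ω → ℚ :=
  genVal (CondFun.eval q (genConst a n))

theorem measurable_seqVal (q : (ratSeq (MeasureAlgebra μ)).carrier a) (n : ℕ) :
    Measurable (seqVal q n) := measurable_genVal _

/-- A conditional sequence is determined by its values at constant indices. On the piece where the
index n equals k, n and the constant k have the same restriction, so compatibility with restrictions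
forces equal values; countably many such pieces cover b. -/
theorem genVal_toFun (q : (ratSeq (MeasureAlgebra μ)).carrier a) {b : MeasureAlgebra μ}
    (hb : b ≤ a) (n : (condNat (MeasureAlgebra μ)).carrier b) :
    ∀ᵐ ω ∂μ, ω ∈ b.rep → genVal (CondFun.toFun q b hb n) ω = seqVal q (genVal n ω) ω := by
  have key : ∀ k, ∀ᵐ ω ∂μ, ω ∈ (n.1 k).rep →
      genVal (CondFun.toFun q b hb n) ω = seqVal q k ω := by
    intro k
    have hk : n.1 k ≤ b := n.2.le k
    have hn : (condNat _).restr hk n = (condNat _).restr (hk.trans hb) (genConst a k) := by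
      rw [genConst_restr]
      refine gen_ext_of_ae ?_
      filter_upwards [genVal_restr hk n, genVal_const (n.1 k) k, genVal_eq n] with ω h1 h2 h3 hω
      rw [h1 hω, h2 hω, h3 k hω]
    have e := congrArg (CondFun.toFun q (n.1 k) (hk.trans hb)) hn
    rw [CondFun.restr_toFun q hk hb, CondFun.restr_toFun q (hk.trans hb) le_rfl] at e
    filter_upwards [genVal_restr hk (CondFun.toFun q b hb n),
      genVal_restr (hk.trans hb) (CondFun.toFun q a le_rfl (genConst a k))] with ω h1 h2 hω
    rw [← h1 hω, e, h2 hω]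
    rfl
  filter_upwards [ae_all_iff.2 key, mem_rep_genVal n] with ω h1 h2 hω
  exact h1 _ (h2 hω)

theorem genVal_eval (q : (ratSeq (MeasureAlgebra μ)).carrier a)
    (n : (condNat (MeasureAlgebra μ)).carrier a) :
    ∀ᵐ ω ∂μ, ω ∈ a.rep → genVal (CondFun.eval q n) ω = seqVal q (genVal n ω) ω :=
  genVal_toFun q le_rfl n

theorem seqVal_restr {b : MeasureAlgebra μ} (hb : b ≤ a)
    (q : (ratSeq (MeasureAlgebra μ)).carrier a) :
    ∀ᵐ ω ∂μ, ω ∈ b.rep → ∀ n, seqVal ((ratSeq (MeasureAlgebra μ)).restr hb q) n ω = seqVal q n ω := by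
  have key : ∀ n, ∀ᵐ ω ∂μ, ω ∈ b.rep →
      seqVal ((ratSeq (MeasureAlgebra μ)).restr hb q) n ω = seqVal q n ω := fun n => by
    have e : CondFun.eval ((ratSeq (MeasureAlgebra μ)).restr hb q) (genConst b n) =
        CondFun.toFun q b hb (genConst b n) := congrArg (fun f : CondFun _ _ b =>
      f.eval (genConst b n)) (funSpace_restr hb q)
    filter_upwards [genVal_toFun q hb (genConst b n), genVal_const b n] with ω h1 h2 hω
    rw [seqVal, e, h1 hω, h2 hω]
  filter_upwards [ae_all_iff.2 key] with ω h hω n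
  exact h n hω

/-- The conditional sequence with given pointwise values. -/
noncomputable def seqOf (a : MeasureAlgebra μ) (Q : ℕ → Ω → ℚ) (hQ : ∀ n, Measurable (Q n)) :
    (ratSeq (MeasureAlgebra μ)).carrier a :=
  -- Since ℕ is countable, (k, ω) ↦ Q k ω is jointly measurable, and an index that depends
  -- measurably on ω may be substituted.
  have hm : ∀ {b} (n : (condNat (MeasureAlgebra μ)).carrier b),
      Measurable fun ω => Q (genVal n ω) ω := fun n =>
    (measurable_from_prod_countable_right (f := fun p : ℕ × Ω => Q p.1 p.2) hQ).comp
      ((measurable_genVal n).prodMk measurable_id)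
  (⟨fun b _ n => genOf b (fun ω => Q (genVal n ω) ω) (hm n), fun {b c} h hc n => by
    refine gen_ext_of_ae ?_
    filter_upwards [genVal_genOf b _ (hm ((condNat _).restr h n)), genVal_restr h n,
      genVal_restr h (genOf c _ (hm n)), genVal_genOf c _ (hm n), le_def.1 h]
      with ω h1 h2 h3 h4 h5 hω
    rw [h1 hω, h2 hω, h3 hω, h4 (h5 hω)]⟩ :
    CondFun (condNat (MeasureAlgebra μ)) (condRat (MeasureAlgebra μ)) a)

theorem seqVal_seqOf (a : MeasureAlgebra μ) (Q : ℕ → Ω → ℚ) (hQ : ∀ n, Measurable (Q n)) :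
    ∀ᵐ ω ∂μ, ω ∈ a.rep → ∀ n, seqVal (seqOf a Q hQ) n ω = Q n ω := by
  have key : ∀ n, ∀ᵐ ω ∂μ, ω ∈ a.rep → seqVal (seqOf a Q hQ) n ω = Q n ω := fun n => by
    have hm : Measurable fun ω => Q (genVal (genConst a n) ω) ω :=
      (measurable_from_prod_countable_right (f := fun p : ℕ × Ω => Q p.1 p.2) hQ).comp
        ((measurable_genVal _).prodMk measurable_id)
    filter_upwards [genVal_genOf a _ hm, genVal_const a n] with ω h1 h2 hω
    exact (h1 hω).trans (by rw [h2 hω])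
  filter_upwards [ae_all_iff.2 key] with ω h hω n
  exact h n hω

theorem seqVal_const (a : MeasureAlgebra μ) (z : ℚ) :
    ∀ᵐ ω ∂μ, ω ∈ a.rep → ∀ n,
      seqVal ((ratSeq (MeasureAlgebra μ)).restr le_top (constSeq _ z) : (ratSeq _).carrier a) n ω =
        z := by
  have hc : ∀ n : ℕ, ∀ᵐ ω ∂μ, seqVal (constSeq (MeasureAlgebra μ) z) n ω = z := fun n => by
    filter_upwards [genVal_const (⊤ : MeasureAlgebra μ) z, mem_top (μ := μ)] with ω h1 h2
    exact h1 h2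
  filter_upwards [ae_all_iff.2 hc, seqVal_restr (le_top : a ≤ ⊤) (constSeq _ z)] with ω h1 h2 hω n
  rw [h2 hω, h1]

theorem seqVal_map₂ (f : ℚ → ℚ → ℚ) (q p : (ratSeq (MeasureAlgebra μ)).carrier a) :
    ∀ᵐ ω ∂μ, ω ∈ a.rep → ∀ n, seqVal (seqMap₂ f q p) n ω = f (seqVal q n ω) (seqVal p n ω) := by
  filter_upwards [ae_all_iff.2 fun n : ℕ => genVal_map₂ f (CondFun.eval q (genConst a n))
    (CondFun.eval p (genConst a n))] with ω h hω n
  exact h n hω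

theorem seqVal_neg (q : (ratSeq (MeasureAlgebra μ)).carrier a) :
    ∀ᵐ ω ∂μ, ω ∈ a.rep → ∀ n, seqVal (seqNeg q) n ω = -seqVal q n ω := by
  filter_upwards [ae_all_iff.2 fun n : ℕ => genVal_map (fun x : ℚ => -x)
    (CondFun.eval q (genConst a n))] with ω h hω n
  exact h n hω

/-- Two sequences and two indices are allowed so that one statement covers the Cauchy condition (q =
p) and null differences (m = n). -/
theorem ratDist_eval_lt_iff_ae (q p : (ratSeq (MeasureAlgebra μ)).carrier a)
    (m n : (condNat (MeasureAlgebra μ)).carrier a) (e : (condRat (MeasureAlgebra μ)).carrier a) :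
    (ratLE _).lt a (ratDist (CondFun.eval q m) (CondFun.eval p n)) e ↔ ∀ᵐ ω ∂μ, ω ∈ a.rep →
      |seqVal q (genVal m ω) ω - seqVal p (genVal n ω) ω| < genVal e ω := by
  rw [ratLT_iff_ae]
  refine eventually_congr ?_
  filter_upwards [genVal_map₂ (fun x y : ℚ => |x - y|) (CondFun.eval q m) (CondFun.eval p n),
    genVal_eval q m, genVal_eval p n] with ω h1 h2 h3
  refine forall_congr' fun hω => ?_
  rw [ratDist, h1 hω, h2 hω, h3 hω]

theorem neg_lt_sub_eval_iff_ae (q p : (ratSeq (MeasureAlgebra μ)).carrier a)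
    (n : (condNat (MeasureAlgebra μ)).carrier a) (e : (condRat (MeasureAlgebra μ)).carrier a) :
    (ratLE _).lt a (genMap (fun x => -x) e)
      (genMap₂ (fun x y => x - y) (CondFun.eval q n) (CondFun.eval p n)) ↔ ∀ᵐ ω ∂μ, ω ∈ a.rep →
      -genVal e ω < seqVal q (genVal n ω) ω - seqVal p (genVal n ω) ω := by
  rw [ratLT_iff_ae]
  refine eventually_congr ?_
  filter_upwards [genVal_map₂ (fun x y : ℚ => x - y) (CondFun.eval q n) (CondFun.eval p n),
    genVal_map (fun x : ℚ => -x) e,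
    genVal_eval q n, genVal_eval p n] with ω h1 h2 h3 h4
  refine forall_congr' fun hω => ?_
  rw [h1 hω, h2 hω, h3 hω, h4 hω]

/-- `eventually_iff_ae` moves the quantifiers to the points of a, where the rational Cauchy
criterion is the real one by `cauchySeq_ratCast_iff`. -/
theorem isCauchySeq_iff_ae (q : (ratSeq (MeasureAlgebra μ)).carrier a) :
    IsCauchySeq a q ↔ ∀ᵐ ω ∂μ, ω ∈ a.rep → CauchySeq fun n => (seqVal q n ω : ℝ) := by
  simp only [← cauchySeq_ratCast_iff]
  rw [← eventually_iff_ae (fun ε m n ω => |seqVal q m ω - seqVal q n ω| < ε)]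
  · simp only [← ratDist_eval_lt_iff_ae]
    rfl
  · intro ε m n
    exact measurableSet_lt ((measurable_seqVal q m).sub (measurable_seqVal q n)).abs
      measurable_const

theorem isNullDiff_iff_ae (q p : (ratSeq (MeasureAlgebra μ)).carrier a) :
    IsNullDiff a q p ↔ ∀ᵐ ω ∂μ, ω ∈ a.rep →
      ∀ ε : ℚ, 0 < ε → ∃ N, ∀ n ≥ N, |seqVal q n ω - seqVal p n ω| < ε := by
  have h := eventually_iff_ae (a := a) (fun ε _ n ω => |seqVal q n ω - seqVal p n ω| < ε)
    fun ε m n => measurableSet_lt ((measurable_seqVal q n).sub (measurable_seqVal p n)).abs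
      measurable_const
  simp only [← ratDist_eval_lt_iff_ae] at h
  -- Only the second index of `eventually_iff_ae` occurs here. The idle first index is removed by
  -- setting it equal to the threshold, pointwise by reflexivity on ℕ and conditionally by
  -- `natLE_refl`.
  refine Iff.trans ?_ (h.trans (eventually_congr (Eventually.of_forall fun ω =>
    forall_congr' fun _ => forall_congr' fun ε => forall_congr' fun _ => exists_congr fun N =>
      ⟨fun h => h N le_rfl, fun h _ _ => h⟩)))
  exact forall_congr' fun ε => forall_congr' fun _ => exists_congr fun N =>
      ⟨fun h _ n _ => h n, fun h n => h N n (natLE_refl N)⟩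

theorem isSeqLE_iff_ae (p q : (ratSeq (MeasureAlgebra μ)).carrier a) :
    IsSeqLE a p q ↔ ∀ᵐ ω ∂μ, ω ∈ a.rep →
      ∀ ε : ℚ, 0 < ε → ∃ N, ∀ n ≥ N, -ε < seqVal q n ω - seqVal p n ω := by
  have h := eventually_iff_ae (a := a) (fun ε _ n ω => -ε < seqVal q n ω - seqVal p n ω)
    fun ε m n => measurableSet_lt measurable_const
      ((measurable_seqVal q n).sub (measurable_seqVal p n))
  simp only [← neg_lt_sub_eval_iff_ae] at h
  refine Iff.trans ?_ (h.trans (eventually_congr (Eventually.of_forall fun ω =>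
    forall_congr' fun _ => forall_congr' fun ε => forall_congr' fun _ => exists_congr fun N =>
      ⟨fun h => h N le_rfl, fun h _ _ => h⟩)))
  exact forall_congr' fun ε => forall_congr' fun _ => exists_congr fun N =>
      ⟨fun h _ n _ => h n, fun h n => h N n (natLE_refl N)⟩

/-- `f` is the pointwise limit, almost everywhere on `a`, of the conditional sequence `q`. -/
def IsSeqLim (q : (ratSeq (MeasureAlgebra μ)).carrier a) (f : Ω → ℝ) : Prop :=
  ∀ᵐ ω ∂μ, ω ∈ a.rep → Tendsto (fun n => (seqVal q n ω : ℝ)) atTop (𝓝 (f ω))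

theorem IsSeqLim.isCauchySeq {q : (ratSeq (MeasureAlgebra μ)).carrier a} {f : Ω → ℝ}
    (h : IsSeqLim q f) : IsCauchySeq a q := by
  rw [isCauchySeq_iff_ae]
  filter_upwards [h] with ω h hω
  exact (h hω).cauchySeq

/-- Completeness of ℝ gives a limit at almost every point of a. Passing to the restriction of μ to a
yields a globally measurable limit function without any convergence off a. -/
theorem IsCauchySeq.exists_isSeqLim {q : (ratSeq (MeasureAlgebra μ)).carrier a}
    (h : IsCauchySeq a q) : ∃ f : Ω → ℝ, Measurable f ∧ IsSeqLim q f := by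
  rw [isCauchySeq_iff_ae, ← ae_restrict_iff' a.measurableSet_rep] at h
  obtain ⟨f, hf, hlim⟩ := measurable_limit_of_tendsto_metrizable_ae
    (μ := μ.restrict a.rep) (L := atTop) (f := fun n ω => (seqVal q n ω : ℝ))
    -- ℚ carries the discrete σ-algebra, so every map out of it is measurable.
    (fun n => ((measurable_from_top (f := fun x : ℚ => (x : ℝ))).comp
      (measurable_seqVal q n)).aemeasurable)
    (h.mono fun ω hω => cauchySeq_tendsto_of_complete hω)
  exact ⟨f, hf, (ae_restrict_iff' a.measurableSet_rep).1 hlim⟩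

/-- The source of surjectivity: the floor approximants of f are measurable in ω, hence form a
conditional sequence. -/
theorem exists_isSeqLim (a : MeasureAlgebra μ) {f : Ω → ℝ} (hf : Measurable f) :
    ∃ q : (ratSeq (MeasureAlgebra μ)).carrier a, IsSeqLim q f := by
  have hQ : ∀ n : ℕ, Measurable fun ω => ((⌊f ω * (n + 1)⌋ : ℚ) / (n + 1) : ℚ) := fun n =>
    (measurable_from_top (f := fun k : ℤ => ((k : ℚ) / (n + 1) : ℚ))).comp
      (hf.mul_const _).floor
  refine ⟨seqOf a _ hQ, ?_⟩
  filter_upwards [seqVal_seqOf a _ hQ] with ω h hω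
  simp only [h hω]
  exact tendsto_floor_mul_div (f ω)

theorem IsSeqLim.restr {q : (ratSeq (MeasureAlgebra μ)).carrier a} {f : Ω → ℝ}
    (h : IsSeqLim q f) {b : MeasureAlgebra μ} (hb : b ≤ a) :
    IsSeqLim ((ratSeq (MeasureAlgebra μ)).restr hb q) f := by
  filter_upwards [h, seqVal_restr hb q, le_def.1 hb] with ω h1 h2 h3 hω
  simp only [h2 hω]
  exact h1 (h3 hω)

theorem isSeqLim_const (a : MeasureAlgebra μ) (z : ℚ) :
    IsSeqLim ((ratSeq (MeasureAlgebra μ)).restr le_top (constSeq _ z) : (ratSeq _).carrier a)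
      fun _ => (z : ℝ) := by
  filter_upwards [seqVal_const a z] with ω h hω
  simp only [h hω]
  exact tendsto_const_nhds

variable {q p : (ratSeq (MeasureAlgebra μ)).carrier a} {f g : Ω → ℝ}

theorem IsSeqLim.add (hq : IsSeqLim q f) (hp : IsSeqLim p g) :
    IsSeqLim (seqMap₂ (fun x y => x + y) q p) fun ω => f ω + g ω := by
  filter_upwards [hq, hp, seqVal_map₂ (fun x y => x + y) q p] with ω h1 h2 h3 hω
  simp only [h3 hω, Rat.cast_add]
  exact (h1 hω).add (h2 hω)

theorem IsSeqLim.mul (hq : IsSeqLim q f) (hp : IsSeqLim p g) :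
    IsSeqLim (seqMap₂ (fun x y => x * y) q p) fun ω => f ω * g ω := by
  filter_upwards [hq, hp, seqVal_map₂ (fun x y => x * y) q p] with ω h1 h2 h3 hω
  simp only [h3 hω, Rat.cast_mul]
  exact (h1 hω).mul (h2 hω)

theorem IsSeqLim.neg (hq : IsSeqLim q f) : IsSeqLim (seqNeg q) fun ω => -f ω := by
  filter_upwards [hq, seqVal_neg q] with ω h1 h2 hω
  simp only [h2 hω, Rat.cast_neg]
  exact (h1 hω).neg

theorem IsSeqLim.isSeqLE_iff (hq : IsSeqLim q f) (hp : IsSeqLim p g) :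
    IsSeqLE a q p ↔ ∀ᵐ ω ∂μ, ω ∈ a.rep → f ω ≤ g ω := by
  rw [isSeqLE_iff_ae]
  refine eventually_congr ?_
  filter_upwards [hq, hp] with ω h1 h2
  exact forall_congr' fun hω => le_lim_iff_of_tendsto (h1 hω) (h2 hω)

/-- Read from left to right this makes the limit depend only on the equivalence class; read from
right to left it makes the limit determine the class. -/
theorem IsSeqLim.isNullDiff_iff (hq : IsSeqLim q f) (hp : IsSeqLim p g) :
    IsNullDiff a q p ↔ ∀ᵐ ω ∂μ, ω ∈ a.rep → f ω = g ω := by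
  rw [isNullDiff_iff_ae]
  refine eventually_congr ?_
  filter_upwards [hq, hp] with ω h1 h2
  exact forall_congr' fun hω => lim_eq_iff_of_tendsto (h1 hω) (h2 hω)

end PointSequences

/-! ### Generated conditional topologies and continuity -/

section Topology

variable {A : Type u} [CompleteBooleanAlgebra A]

/-- Conditional intersections are formed levelwise, so openness in the generated topology can be
tested against each topology containing G separately. -/
theorem mem_membersOf_condTopology {X : CondSet A} {G : Set (CondSubset X)} {O : CondSubset X} :
    O ∈ membersOf (condTopology G) ↔ ∀ T, IsCondTopology T ∧ G ⊆ membersOf T → O ∈ membersOf T :=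
  Iff.rfl

/-- Every closure property is inherited from the members of the intersection. -/
theorem isCondTopology_condTopology {X : CondSet A} (G : Set (CondSubset X)) :
    IsCondTopology (condTopology G) where
  empty_mem := mem_membersOf_condTopology.2 fun _ hT => hT.1.empty_mem
  full_mem := mem_membersOf_condTopology.2 fun _ hT => hT.1.full_mem
  inter_mem U hU V hV := mem_membersOf_condTopology.2 fun T hT =>
    hT.1.inter_mem U (mem_membersOf_condTopology.1 hU T hT) V (mem_membersOf_condTopology.1 hV T hT)
  sUnion_mem S hS := mem_membersOf_condTopology.2 fun T hT =>
    hT.1.sUnion_mem S fun _ hO => mem_membersOf_condTopology.1 (hS hO) T hT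

theorem subset_membersOf_condTopology {X : CondSet A} (G : Set (CondSubset X)) :
    G ⊆ membersOf (condTopology G) := fun _ hO =>
  mem_membersOf_condTopology.2 fun _ hT => hT.2 hO

theorem powerset_restr {X : CondSet A} {a b : A} (h : a ≤ b) (Y : (powerset X).carrier b) :
    ((powerset X).restr h Y).1 = Y.1.cut a := by
  obtain ⟨Z, rfl⟩ := (powerset X).surjective b Y
  rw [CondSet.restr_res]
  exact (CondSubset.cut_cut h Z.1).symm

namespace CondFun

variable {X Y : CondSet A} (f : CondFun X Y ⊤)

theorem mem_preimage (V : CondSubset Y) {a : A} (x : X.carrier a) :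
    x ∈ (f.preimage V).sets a ↔ f.app x ∈ V.sets a := Iff.rfl

theorem preimage_on_le (V : CondSubset Y) : (f.preimage V).on ≤ V.on := by
  obtain ⟨x, hx⟩ := ((f.preimage V).nonempty_iff _).2 le_rfl
  exact V.le_on ((f.mem_preimage V x).1 hx)

/-- The conditional preimage as a conditional function between conditional power sets. -/
noncomputable def preimageFun : CondFun (powerset Y) (powerset X) ⊤ where
  toFun _ _ V := ⟨f.preimage V.1, (f.preimage_on_le V.1).trans V.2⟩
  restr_toFun {a b} h _ V := Subtype.ext <| by
    have e : f.preimage (V.1.cut a) = (f.preimage V.1).cut a := CondSubset.ext' fun _ => rfl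
    refine ((congrArg f.preimage (powerset_restr h V)).trans e).trans ?_
    exact (powerset_restr (X := X) h ⟨f.preimage V.1, (f.preimage_on_le V.1).trans V.2⟩).symm

/-- Pulling T back along the preimage map P(Y) → P(X) gives the analogue of the final topology: its
members are the conditional subsets of Y with preimage in T. Obtaining it as a conditional preimage
makes it a conditional subset of P(Y) without further work. -/
theorem mem_membersOf_preimageFun_preimage {T : CondSubset (powerset X)} {V : CondSubset Y} :
    V ∈ membersOf (f.preimageFun.preimage T) ↔ f.preimage V ∈ membersOf T := Iff.rfl

theorem preimage_sUnion (S : Set (CondSubset Y)) :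
    f.preimage (CondSubset.sUnion S) = CondSubset.sUnion (f.preimage '' S) := by
  refine CondSubset.ext' fun c => Set.ext fun x => ?_
  refine exists_congr fun ι => exists_congr fun b => exists_congr fun h => forall_congr' fun i => ?_
  rw [Set.exists_mem_image]
  refine exists_congr fun V => and_congr_right fun _ => ?_
  rw [mem_preimage, f.natural.eq]

theorem isCondTopology_preimageFun_preimage {T : CondSubset (powerset X)} (hT : IsCondTopology T) :
    IsCondTopology (f.preimageFun.preimage T) where
  empty_mem := by
    have : f.preimage (CondSubset.empty Y) = CondSubset.empty X := CondSubset.ext' fun _ => rfl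
    rw [mem_membersOf_preimageFun_preimage, this]
    exact hT.empty_mem
  full_mem := by
    have : f.preimage (CondSubset.full Y) = CondSubset.full X := CondSubset.ext' fun _ => rfl
    rw [mem_membersOf_preimageFun_preimage, this]
    exact hT.full_mem
  inter_mem U hU V hV := by
    have : f.preimage (CondSubset.sInter {U, V}) =
        CondSubset.sInter {f.preimage U, f.preimage V} := by
      refine CondSubset.ext' fun a => Set.ext fun x => ?_
      change (∀ W ∈ ({U, V} : Set _), f.app x ∈ W.sets a) ↔
        ∀ W ∈ ({f.preimage U, f.preimage V} : Set _), x ∈ W.sets a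
      simp [mem_preimage]
    rw [mem_membersOf_preimageFun_preimage, this]
    exact hT.inter_mem _ hU _ hV
  sUnion_mem S hS := by
    have := hT.sUnion_mem (f.preimage '' S) (Set.image_subset_iff.2 fun _ hV => hS hV)
    rw [← preimage_sUnion] at this
    exact this

theorem condContinuous_condTopology {T : CondSubset (powerset X)} (hT : IsCondTopology T)
    {G : Set (CondSubset Y)} (hG : ∀ B ∈ G, f.preimage B ∈ membersOf T) :
    CondContinuous T (condTopology G) f := by
  rintro x U ⟨-, O, hO, hx, hOU⟩
  refine ⟨top_le_iff.1 (((f.preimage U).nonempty_iff ⊤).1 ⟨x, hOU _ hx⟩), f.preimage O, ?_, hx,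
    fun a y hy => hOU a hy⟩
  exact mem_membersOf_condTopology.1 hO _ ⟨f.isCondTopology_preimageFun_preimage hT, hG⟩

theorem exists_inverse (hf : ∀ a, Function.Bijective fun x : X.carrier a => f.app x) :
    ∃ g : CondFun Y X ⊤, (∀ a (x : X.carrier a), g.app (f.app x) = x) ∧
      ∀ a (y : Y.carrier a), f.app (g.app y) = y := by
  choose g hgf hfg using fun a => Function.bijective_iff_has_inverse.1 (hf a)
  refine ⟨⟨fun a _ => g a, fun {a b} h _ y => (hf a).1 ?_⟩, hgf, hfg⟩
  change f.app (g a _) = f.app _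
  rw [f.natural.eq]
  exact (hfg a _).trans (congrArg _ (hfg b y).symm)

end CondFun

variable {K L : CondOrdRing A}

/-- A conditional bijection which respects `0`, `+`, `-` and the order is continuous for the
topologies generated by the balls. -/
theorem condContinuous_of_inverse (φ : CondFun K.toCondSet L.toCondSet ⊤)
    (ψ : CondFun L.toCondSet K.toCondSet ⊤) (hψφ : ∀ a (x : K.carrier a), ψ.app (φ.app x) = x)
    (hφψ : ∀ a (y : L.carrier a), φ.app (ψ.app y) = y) (hzero : φ.app K.zero = L.zero)
    (hadd : ∀ a (x y : K.carrier a), φ.app (K.add.app (x, y)) = L.add.app (φ.app x, φ.app y))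
    (hneg : ∀ a (x : K.carrier a), φ.app (K.neg.app x) = L.neg.app (φ.app x))
    (hle : ∀ a (x y : K.carrier a), K.le.rel a x y ↔ L.le.rel a (φ.app x) (φ.app y)) :
    CondFun.CondContinuous K.topology L.topology φ := by
  have hinj : ∀ {a} {x y : K.carrier a}, φ.app x = φ.app y ↔ x = y := fun {a x y} =>
    ⟨fun e => by rw [← hψφ a x, e, hψφ], fun e => by rw [e]⟩
  have hlt : ∀ a (x y : K.carrier a), K.le.lt a x y ↔ L.le.lt a (φ.app x) (φ.app y) := by
    intro a x y
    refine and_congr (hle a x y) (forall_congr' fun b => forall_congr' fun h => ?_)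
    rw [← φ.natural.eq, ← φ.natural.eq, hinj]
  have habs : ∀ a (z m : K.carrier a), K.IsAbs a z m ↔ L.IsAbs a (φ.app z) (φ.app m) := by
    intro a z m
    simp only [CondOrdRing.IsAbs, hle, hneg]
    refine and_congr Iff.rfl ⟨fun H m' => ?_, fun H m' => H _⟩
    rw [← hφψ a m']
    exact H _
  have hsub : ∀ a (x y : K.carrier a), φ.app (K.sub x y) = L.sub (φ.app x) (φ.app y) := by
    intro a x y
    rw [CondOrdRing.sub, hadd, hneg]
    rfl
  refine φ.condContinuous_condTopology (isCondTopology_condTopology _) ?_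
  rintro _ ⟨y, δ, hδ, rfl⟩
  refine subset_membersOf_condTopology _ ⟨ψ.app y, ψ.app δ, ?_, ?_⟩
  · rwa [hlt, hφψ, hzero]
  · refine CondSubset.ext' fun a => Set.ext fun x => ?_
    change (∃ m, L.IsAbs a (L.sub (L.restr le_top y) (φ.app x)) m ∧
        L.le.lt a m (L.restr le_top δ)) ↔
      ∃ m, K.IsAbs a (K.sub (K.restr le_top (ψ.app y)) x) m ∧
        K.le.lt a m (K.restr le_top (ψ.app δ))
    simp only [habs, hlt, hsub, φ.natural.eq, hφψ]
    exact ⟨fun ⟨m, hm⟩ => ⟨ψ.app m, by rwa [hφψ]⟩, fun ⟨m, hm⟩ => ⟨φ.app m, hm⟩⟩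

end Topology

section Isomorphism

open MeasureAlgebra

variable {Ω : Type u} [MeasurableSpace Ω] {μ : Measure Ω} [SigmaFinite μ] {a : MeasureAlgebra μ}

theorem l0_eq_iff_ae {f g : (l0Set μ).carrier a} :
    f = g ↔ ∀ᵐ ω ∂μ, ω ∈ a.rep → f.1 ω = g.1 ω := by
  rw [← ind_mul_eq_iff, l0_ind_mul, l0_ind_mul]
  exact Subtype.ext_iff

theorem l0_le_iff_ae {f g : (l0Set μ).carrier a} :
    (condL0 μ).le.rel a f g ↔ ∀ᵐ ω ∂μ, ω ∈ a.rep → f.1 ω ≤ g.1 ω := by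
  rw [← l0_ind_mul_le_iff, l0_ind_mul f, l0_ind_mul g]
  rfl

theorem IsSeqLim.congr {q : (ratSeq (MeasureAlgebra μ)).carrier a} {f g : Ω → ℝ}
    (h : IsSeqLim q f) (hfg : ∀ᵐ ω ∂μ, ω ∈ a.rep → f ω = g ω) : IsSeqLim q g := by
  filter_upwards [h, hfg] with ω h1 h2 hω
  rw [← h2 hω]
  exact h1 hω

theorem exists_l0_isSeqLim (q : (cauchySet (MeasureAlgebra μ)).carrier a) :
    ∃ f : (l0Set μ).carrier a, IsSeqLim q.1 f.1 := by
  obtain ⟨f, hf, h⟩ := IsCauchySeq.exists_isSeqLim (q := q.1) q.2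
  refine ⟨⟨_, AEEqFun.mk f hf.aestronglyMeasurable, rfl⟩, h.congr ?_⟩
  filter_upwards [coeFn_ind_mul a (AEEqFun.mk f hf.aestronglyMeasurable),
    AEEqFun.coeFn_mk f (hf.aestronglyMeasurable (μ := μ))] with ω h1 h2 hω
  rw [h1.1 hω, h2]

/-- The limit in `𝐋⁰` of a conditional Cauchy sequence. -/
noncomputable def seqLim (q : (cauchySet (MeasureAlgebra μ)).carrier a) : (l0Set μ).carrier a :=
  (exists_l0_isSeqLim q).choose

theorem isSeqLim_seqLim (q : (cauchySet (MeasureAlgebra μ)).carrier a) :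
    IsSeqLim q.1 (seqLim q).1 := (exists_l0_isSeqLim q).choose_spec

theorem seqLim_eq_iff {q p : (cauchySet (MeasureAlgebra μ)).carrier a} :
    seqLim q = seqLim p ↔ (nullRel (MeasureAlgebra μ)).rel a q p := by
  rw [l0_eq_iff_ae]
  exact ((isSeqLim_seqLim q).isNullDiff_iff (isSeqLim_seqLim p)).symm

theorem IsSeqLim.seqLim_eq {q : (cauchySet (MeasureAlgebra μ)).carrier a}
    {f : (l0Set μ).carrier a} (h : IsSeqLim q.1 f.1) : seqLim q = f :=
  l0_eq_iff_ae.2 (((isSeqLim_seqLim q).isNullDiff_iff h).1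
    ((nullRel_equivalence (A := MeasureAlgebra μ) a).refl q))

theorem seqLim_le_iff {q p : (cauchySet (MeasureAlgebra μ)).carrier a} :
    (condL0 μ).le.rel a (seqLim q) (seqLim p) ↔ IsSeqLE a q.1 p.1 :=
  l0_le_iff_ae.trans ((isSeqLim_seqLim q).isSeqLE_iff (isSeqLim_seqLim p)).symm

theorem seqLim_surjective : Function.Surjective
    (seqLim : (cauchySet (MeasureAlgebra μ)).carrier a → (l0Set μ).carrier a) := fun f => by
  obtain ⟨q, hq⟩ := exists_isSeqLim a f.1.measurable
  exact ⟨⟨q, hq.isCauchySeq⟩, IsSeqLim.seqLim_eq hq⟩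

theorem seqLim_restr {b : MeasureAlgebra μ} (h : b ≤ a)
    (q : (cauchySet (MeasureAlgebra μ)).carrier a) :
    seqLim ((cauchySet (MeasureAlgebra μ)).restr h q) = (l0Set μ).restr h (seqLim q) := by
  refine IsSeqLim.seqLim_eq ?_
  rw [show ((cauchySet (MeasureAlgebra μ)).restr h q).1 = _ from
    ((cauchySubset (MeasureAlgebra μ)).natural_val cauchySubset_on).eq h q, l0_restr]
  refine ((isSeqLim_seqLim q).restr h).congr ?_
  filter_upwards [coeFn_ind_mul b (seqLim q).1] with ω h1 hω
  exact (h1.1 hω).symm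

/-- The limit as a conditional function `𝐑 → 𝐋⁰`. -/
noncomputable def realToL0 (μ : Measure Ω) [SigmaFinite μ] :
    CondFun (condReal (MeasureAlgebra μ)).toCondSet (condL0 μ).toCondSet ⊤ where
  toFun b _ := Quotient.lift (s := ⟨_, nullRel_equivalence b⟩) seqLim fun _ _ => seqLim_eq_iff.2
  restr_toFun {b c} h _ x := by
    induction x using Quotient.inductionOn with | _ q =>
    exact (congrArg _ (quot_restr h q)).trans (seqLim_restr h q)

theorem realToL0_bijective (a : MeasureAlgebra μ) : Function.Bijective
    fun x : (condReal (MeasureAlgebra μ)).carrier a => (realToL0 μ).app x := by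
  refine ⟨fun x y => ?_, fun f => ?_⟩
  · induction x using Quotient.inductionOn with | _ q =>
    induction y using Quotient.inductionOn with | _ p =>
    exact fun h => Quotient.sound (s := ⟨_, nullRel_equivalence a⟩) (seqLim_eq_iff.1 h)
  · obtain ⟨q, rfl⟩ := seqLim_surjective f
    exact ⟨Quotient.mk _ q, rfl⟩

theorem realToL0_zero : (realToL0 μ).app (condReal (MeasureAlgebra μ)).zero = (condL0 μ).zero := by
  refine IsSeqLim.seqLim_eq ((isSeqLim_const ⊤ 0).congr ?_)
  filter_upwards [AEEqFun.coeFn_zero (α := Ω) (β := ℝ) (μ := μ)] with ω h _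
  rw [Rat.cast_zero]
  exact h.symm

theorem realToL0_one : (realToL0 μ).app (condReal (MeasureAlgebra μ)).one = (condL0 μ).one := by
  refine IsSeqLim.seqLim_eq ((isSeqLim_const ⊤ 1).congr ?_)
  filter_upwards [AEEqFun.coeFn_one (α := Ω) (β := ℝ) (μ := μ)] with ω h _
  rw [Rat.cast_one]
  exact h.symm

theorem realToL0_add (x y : (condReal (MeasureAlgebra μ)).carrier a) :
    (realToL0 μ).app ((condReal (MeasureAlgebra μ)).add.app (x, y)) =
      (condL0 μ).add.app ((realToL0 μ).app x, (realToL0 μ).app y) := by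
  induction x using Quotient.inductionOn with | _ q =>
  induction y using Quotient.inductionOn with | _ p =>
  refine IsSeqLim.seqLim_eq (((isSeqLim_seqLim q).add (isSeqLim_seqLim p)).congr ?_)
  filter_upwards [AEEqFun.coeFn_add (seqLim q).1 (seqLim p).1] with ω h _
  exact h.symm

theorem realToL0_mul (x y : (condReal (MeasureAlgebra μ)).carrier a) :
    (realToL0 μ).app ((condReal (MeasureAlgebra μ)).mul.app (x, y)) =
      (condL0 μ).mul.app ((realToL0 μ).app x, (realToL0 μ).app y) := by
  induction x using Quotient.inductionOn with | _ q =>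
  induction y using Quotient.inductionOn with | _ p =>
  refine IsSeqLim.seqLim_eq (((isSeqLim_seqLim q).mul (isSeqLim_seqLim p)).congr ?_)
  filter_upwards [AEEqFun.coeFn_mul (seqLim q).1 (seqLim p).1] with ω h _
  exact h.symm

theorem realToL0_neg (x : (condReal (MeasureAlgebra μ)).carrier a) :
    (realToL0 μ).app ((condReal (MeasureAlgebra μ)).neg.app x) =
      (condL0 μ).neg.app ((realToL0 μ).app x) := by
  induction x using Quotient.inductionOn with | _ q =>
  refine IsSeqLim.seqLim_eq ((isSeqLim_seqLim q).neg.congr ?_)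
  filter_upwards [AEEqFun.coeFn_neg (seqLim q).1] with ω h _
  exact h.symm

theorem realToL0_le_iff (x y : (condReal (MeasureAlgebra μ)).carrier a) :
    (condReal (MeasureAlgebra μ)).le.rel a x y ↔
      (condL0 μ).le.rel a ((realToL0 μ).app x) ((realToL0 μ).app y) := by
  induction x using Quotient.inductionOn with | _ q =>
  induction y using Quotient.inductionOn with | _ p =>
  exact seqLim_le_iff.symm

end Isomorphism

end CondSetTheory

theorem mainTheorem8 {Ω : Type*} [MeasurableSpace Ω] (μ : MeasureTheory.Measure Ω)
    [MeasureTheory.SigmaFinite μ] :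
    ∃ (φ : CondSetTheory.CondFun
          (CondSetTheory.condReal (CondSetTheory.MeasureAlgebra μ)).toCondSet
          (CondSetTheory.condL0 μ).toCondSet ⊤)
      (ψ : CondSetTheory.CondFun
          (CondSetTheory.condL0 μ).toCondSet
          (CondSetTheory.condReal (CondSetTheory.MeasureAlgebra μ)).toCondSet ⊤),
      -- `φ` is a conditional bijection with inverse `ψ`
      φ.CondBijective ∧
      (∀ a (x : (CondSetTheory.condReal (CondSetTheory.MeasureAlgebra μ)).carrier a),
        ψ.app (φ.app x) = x) ∧
      (∀ a (f : (CondSetTheory.condL0 μ).carrier a), φ.app (ψ.app f) = f) ∧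
      -- `φ` respects the algebraic structure
      φ.app (CondSetTheory.condReal (CondSetTheory.MeasureAlgebra μ)).zero =
        (CondSetTheory.condL0 μ).zero ∧
      φ.app (CondSetTheory.condReal (CondSetTheory.MeasureAlgebra μ)).one =
        (CondSetTheory.condL0 μ).one ∧
      (∀ a (x y : (CondSetTheory.condReal (CondSetTheory.MeasureAlgebra μ)).carrier a),
        φ.app ((CondSetTheory.condReal (CondSetTheory.MeasureAlgebra μ)).add.app (x, y)) =
          (CondSetTheory.condL0 μ).add.app (φ.app x, φ.app y)) ∧
      (∀ a (x y : (CondSetTheory.condReal (CondSetTheory.MeasureAlgebra μ)).carrier a),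
        φ.app ((CondSetTheory.condReal (CondSetTheory.MeasureAlgebra μ)).mul.app (x, y)) =
          (CondSetTheory.condL0 μ).mul.app (φ.app x, φ.app y)) ∧
      -- `φ` respects the order
      (∀ a (x y : (CondSetTheory.condReal (CondSetTheory.MeasureAlgebra μ)).carrier a),
        (CondSetTheory.condReal (CondSetTheory.MeasureAlgebra μ)).le.rel a x y ↔
          (CondSetTheory.condL0 μ).le.rel a (φ.app x) (φ.app y)) ∧
      -- `φ` is a conditional homeomorphism
      CondSetTheory.CondFun.CondContinuous
        (CondSetTheory.condReal (CondSetTheory.MeasureAlgebra μ)).topology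
        (CondSetTheory.condL0 μ).topology φ ∧
      CondSetTheory.CondFun.CondContinuous
        (CondSetTheory.condL0 μ).topology
        (CondSetTheory.condReal (CondSetTheory.MeasureAlgebra μ)).topology ψ := by
  obtain ⟨ψ, hψφ, hφψ⟩ :=
    (CondSetTheory.realToL0 μ).exists_inverse CondSetTheory.realToL0_bijective
  refine ⟨CondSetTheory.realToL0 μ, ψ,
    ⟨fun a => (CondSetTheory.realToL0_bijective a).1, (CondSetTheory.realToL0_bijective ⊤).2⟩,
    hψφ, hφψ, CondSetTheory.realToL0_zero, CondSetTheory.realToL0_one,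
    fun _ => CondSetTheory.realToL0_add, fun _ => CondSetTheory.realToL0_mul,
    fun _ => CondSetTheory.realToL0_le_iff,
    CondSetTheory.condContinuous_of_inverse _ ψ hψφ hφψ CondSetTheory.realToL0_zero
      (fun _ => CondSetTheory.realToL0_add) (fun _ => CondSetTheory.realToL0_neg)
      fun _ => CondSetTheory.realToL0_le_iff,
    CondSetTheory.condContinuous_of_inverse ψ _ hφψ hψφ ?_ (fun a f g => ?_) (fun a f => ?_)
      fun a f g => ?_⟩
  · rw [← CondSetTheory.realToL0_zero, hψφ]
  · refine (CondSetTheory.realToL0_bijective a).1 ((hφψ a _).trans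
      (Eq.trans ?_ (CondSetTheory.realToL0_add _ _).symm))
    rw [hφψ, hφψ]
  · refine (CondSetTheory.realToL0_bijective a).1 ((hφψ a _).trans
      (Eq.trans ?_ (CondSetTheory.realToL0_neg _).symm))
    rw [hφψ]
  · rw [CondSetTheory.realToL0_le_iff, hφψ, hφψ]
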